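/- Conventions. A valuation $v$ on a field $K$ is written additively and considered up to equivalence, i.e. it is given by its valuation ring $\mathcal O_v$; $vK$ is its value group, $Kv$ its residue field, and a bar denotes residues. An extension of $v$ to $L\supseteq K$ is a valuation $w$ on $L$ with $\mathcal O_w\cap K=\mathcal O_v$. $\Omega_v(L)$ is the set of extensions $w$ of $v$ to $L$ with $Lw/Kv$ transcendental, and $\Omega^*_v(L)$ is the set of those $w\in\Omega_v(L)$ for which $Lw/Kv$ is not ruled, i.e. $Lw$ is not of the form $k'(z)$ with $k'/Kv$ finite and $z$ transcendental over $Kv$. For a polynomial $g=\sum_{i=0}^n a_it^i$ of degree $n$ with coefficients in a subfield $R$ of $L$, and $x\in L\setminus R$, put $S_{g,x}(w)=\{i\mid w(a_ix^i)=\min_{0\le j\le n}w(a_jx^j)\}$ and $\Omega_{S,g,x}=\{w\in\Omega_v(L)\mid S_{g,x}(w)=S\}$, and let $\mathcal S(g,x)$ be the set of all $S\subseteq\{0,\dots,n\}$ with $|S|\ge2$ and $\Omega_{S,g,x}\ne\emptyset$. For $S\in\mathcal S(g,x)$ and $R=K$ let $i_0=\min S$, let $d$ be the greatest common divisor of the $i-i_0$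 ($i\in S$), let $b\in K^\times$ be such that $w(bx^d)=0$ for all $w\in\Omega_{S,g,x}$, and let $e_S$ be the order of $v(b)/d$ in $(vK\otimes\mathbb Q)/vK$. Let $\mathcal C_g(S)$ be the set of $c\in K^\times$ with $w(cx^{e_S})=0$ for all $w\in\Omega_{S,g,x}$. For $c\in\mathcal C_g(S)$ put $$p_{S,g,c}(t)=\sum_{i\in S}\overline{a_ia_{i_0}^{-1}c^{-n_i}}\,t^{n_i}\in Kv[t],\qquad n_i=\frac{i-i_0}{e_S}.$$ $\mathsf{Mult}(S,g,x)$ is the set of multiplicities of the roots of $p_{S,g,c}$ in an algebraic closure (it does not depend on $c$). A polynomial is called purely inseparable of degree $r$ if it has degree $r$ and only one root in an algebraic closure. Statement. Let $E$ be a field with a valuation $v$, and let $F/E$ be a function field in one variable in which $E$ is relatively algebraically closed. Let $f\in E[t]$ and $X\in F\setminus E$, and assume that $\mathrm{char}\,Ev=0$ or $\mathrm{char}\,Ev>\deg f$. Let $S\in\mathcal S(f,X)$, $i_0=\min S$, $e=e_S$, $c\in\mathcal C_f(S)$, let $a_{i_0}$ be the coefficient of $t^{i_0}$ in $f$, let $q\in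 Ev[t]$ be a monic irreducible factor of $p_{S,f,c}$, and let $r$ be the highest power to which $q$ divides $p_{S,f,c}$. Put $\Omega_{S,f,X,q}=\{w\in\Omega_{S,f,X}\mid q(\overline{cX^e})=0\text{ in }Fw\}$. Let $Q\in\mathcal O_v[t]$ be monic with $\overline Q=q$. Let $F_Q=F(\alpha)$ be a field generated over $F$ by a root $\alpha$ of $Q$, let $F'=F_Q(\lambda)$ be a field generated over $F_Q$ by an element $\lambda$ with $\lambda^e=\alpha^{-1}c$, and put $E'=E(\alpha,\lambda)$, $X_1=\lambda X-1$ and $g(t)=f(\lambda^{-1}(t+1))\in E'[t]$. Then $Q$ is irreducible over $F$ (so $F_Q\cong F[t]/(Q)$), the polynomial $s^e-\alpha^{-1}c$ is irreducible over $F_Q$, $E'/E$ is finite and $F'=FE'$. If $F=E(X)[\sqrt{f(X)}]$, then $F'=E'(X_1)[\sqrt{g(X_1)}]$. Moreover, for every $w\in\Omega_{S,f,X,q}$: (1) There is a unique extension $w_Q$ of $w$ to $F_Q$ with $w_Q(\alpha)=0$ and $\overline\alpha=\overline{cX^e}$ in $F_Qw_Q$, and $w_QF_Q=wF$. (2) There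 is a unique extension $w'$ of $w$ to $F'$ with $w'(\lambda X)=0$ and $\overline{\lambda X}=1$ in $F'w'$, and $F'w'=Fw$. (3) The polynomial $p(t)=a_{i_0}^{-1}\lambda^{i_0}f(\lambda^{-1}t)$ has coefficients in $\mathcal O_{w'}$ and is primitive (i.e. $\overline p\neq 0$), and $\overline{\lambda X}$ is a root of $\overline p$ of multiplicity $r$. (4) $S_{g,X_1}(w')\subseteq\{0,\dots,r\}$. (5) Put $S_1=S_{g,X_1}(w')$ and suppose $|S_1|\ge2$. Then, over the base field $E'$ with the valuation $w'|_{E'}$, either $\max\mathsf{Mult}(S_1,g,X_1)<r$, or $p_{S_1,g,c_1}$ is purely inseparable of degree $r$ for $c_1\in\mathcal C_g(S_1)$. Finally: (6) Let $\Omega=\{w'\in\Omega_v(F')\mid w'|_F\in\Omega_{S,f,X,q},\ w'(\lambda X)=0,\ \overline{\lambda X}=1\text{ in }F'w'\}$. Restriction to $F$ is a bijection from $\Omega\cap\Omega^*_v(F')$ onto $\Omega_{S,f,X,q}\cap\Omega^*_v(F)$; in particular $|\Omega_{S,f,X,q}\cap\Omega^*_v(F)|=|\Omega\cap\Omega^*_v(F')|$.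 If $F=E(X)[\sqrt{f(X)}]$, then $$\Omega\cap\Omega^*_v(F')\subseteq\bigcup_{S_1\in\mathcal S(g,X_1),\ S_1\subseteq\{0,\dots,r\}}\Omega_{S_1,g,X_1}.$$ -/

import Mathlib

open Polynomial

noncomputable section

namespace ResidueReduction

/-!
A valuation on a field is given by its valuation ring: a `ValuationSubring`.  Values are taken in the
(multiplicatively written) canonical value group, so that "`w(x) = 0`" reads `w.valuation x = 1`, and
minima of additively written values are maxima here.
-/

/-- `w` is an extension of `v` along `K → L`: it restricts to `v` on `K`. -/
def Extends {K L : Type*} [Field K] [Field L] [Algebra K L]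
    (v : ValuationSubring K) (w : ValuationSubring L) : Prop :=
  w.comap (algebraMap K L) = v

/-- The inclusion `𝒪_v → 𝒪_w` of valuation rings. -/
def ringMap {K L : Type*} [Field K] [Field L] [Algebra K L]
    {v : ValuationSubring K} {w : ValuationSubring L} (h : Extends v w) : v →+* w :=
  (algebraMap K L).restrict v w (fun x hx => by
    have hx' : x ∈ w.comap (algebraMap K L) := by rw [h]; exact hx
    exact hx')

theorem ringMap_isLocalHom {K L : Type*} [Field K] [Field L] [Algebra K L]
    {v : ValuationSubring K} {w : ValuationSubring L} (h : Extends v w) :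
    IsLocalHom (ringMap h) := by
  constructor
  intro a ha
  obtain ⟨b, hb⟩ := ha.exists_right_inv
  have hval : algebraMap K L (a : K) * (b : L) = 1 := congrArg Subtype.val hb
  have ha0 : (a : K) ≠ 0 := by
    intro h0
    rw [h0] at hval
    simp at hval
  have hbi : algebraMap K L ((a : K)⁻¹) = (b : L) := by
    rw [map_inv₀]
    exact inv_eq_of_mul_eq_one_right hval
  have hv : ∀ y : K, algebraMap K L y ∈ w → y ∈ v := by
    intro y hy
    have hy' : y ∈ w.comap (algebraMap K L) := hy
    rwa [show w.comap (algebraMap K L) = v from h] at hy'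
  have hmem : (a : K)⁻¹ ∈ v := hv _ (by rw [hbi]; exact b.2)
  exact IsUnit.of_mul_eq_one ⟨_, hmem⟩ (Subtype.ext (mul_inv_cancel₀ ha0))

/-- The residue field `Kv`. -/
abbrev Res {K : Type*} [Field K] (v : ValuationSubring K) : Type _ := IsLocalRing.ResidueField v

/-- The embedding of residue fields `Kv → Lw`. -/
def resMap {K L : Type*} [Field K] [Field L] [Algebra K L]
    {v : ValuationSubring K} {w : ValuationSubring L} (h : Extends v w) : Res v →+* Res w :=
  haveI := ringMap_isLocalHom h
  IsLocalRing.ResidueField.map (ringMap h)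

open Classical in
/-- The residue of `x` in `Kv`; only meaningful for `x ∈ 𝒪_v` (it is `0` otherwise). -/
def res {K : Type*} [Field K] (v : ValuationSubring K) (x : K) : Res v :=
  if hx : x ∈ v then IsLocalRing.residue v ⟨x, hx⟩ else 0

/-- `M / k` is ruled: `M = k'(x)` for a finite extension `k' / k` and some `x` transcendental
over `k`. -/
def IsRuled (k M : Type*) [Field k] [Field M] [Algebra k M] : Prop :=
  ∃ (k' : IntermediateField k M) (x : M), FiniteDimensional k k' ∧ Transcendental k x ∧
    IntermediateField.adjoin k' {x} = ⊤

/-- `L / K` is a function field in one variable in which `K` is relatively algebraically closed. -/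
def IsRegularFunctionField (K L : Type*) [Field K] [Field L] [Algebra K L] : Prop :=
  (⊤ : IntermediateField K L).FG ∧ Algebra.trdeg K L = 1 ∧ algebraicClosure K L = ⊥

/-- `L = K(x)[√g(x)]`. -/
def IsQuadraticOver {K L : Type*} [Field K] [Field L] [Algebra K L] (g : K[X]) (x : L) : Prop :=
  ∃ y : L, y ^ 2 = aeval x g ∧ IntermediateField.adjoin K {x, y} = ⊤

/-- `Ω_v(L)`: the residually transcendental extensions of `v` to `L`. -/
def Omega {K : Type*} [Field K] (v : ValuationSubring K) (L : Type*) [Field L] [Algebra K L] :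
    Set (ValuationSubring L) :=
  {w | ∃ h : Extends v w, letI := (resMap h).toAlgebra; Algebra.Transcendental (Res v) (Res w)}

/-- `Ω*_v(L)`: those `w ∈ Ω_v(L)` for which `Lw / Kv` is not ruled. -/
def OmegaStar {K : Type*} [Field K] (v : ValuationSubring K) (L : Type*) [Field L] [Algebra K L] :
    Set (ValuationSubring L) :=
  {w | w ∈ Omega v L ∧ ∃ h : Extends v w, letI := (resMap h).toAlgebra; ¬ IsRuled (Res v) (Res w)}

open Classical in
/-- `S_{g,x}(w)`: the indices `i ∈ {0, …, deg g}` for which the term `a_i x ^ i` of `g(x)` has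
minimal (additively written) value. -/
def supp {R L : Type*} [Field R] [Field L] [Algebra R L] (g : R[X]) (x : L)
    (w : ValuationSubring L) : Finset ℕ :=
  (Finset.range (g.natDegree + 1)).filter fun i =>
    ∀ j ∈ Finset.range (g.natDegree + 1),
      w.valuation (algebraMap R L (g.coeff j) * x ^ j) ≤
        w.valuation (algebraMap R L (g.coeff i) * x ^ i)

/-- `Ω_{S,g,x} = {w ∈ Ω_v(L) | S_{g,x}(w) = S}`; the coefficients of `g` may lie in an
extension `R` of `K`. -/
def OmegaS {K R L : Type*} [Field K] [Field R] [Field L] [Algebra K L] [Algebra R L]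
    (v : ValuationSubring K) (g : R[X]) (x : L) (S : Finset ℕ) : Set (ValuationSubring L) :=
  {w | w ∈ Omega v L ∧ supp g x w = S}

/-- `𝒮(g,x)`: the `S ⊆ {0, …, deg g}` with `|S| ≥ 2` and `Ω_{S,g,x}` nonempty. -/
def Supports {K R L : Type*} [Field K] [Field R] [Field L] [Algebra K L] [Algebra R L]
    (v : ValuationSubring K) (g : R[X]) (x : L) : Set (Finset ℕ) :=
  {S | S ⊆ Finset.range (g.natDegree + 1) ∧ 2 ≤ S.card ∧ (OmegaS v g x S).Nonempty}

/-- `i₀ = min S`. -/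
def first (S : Finset ℕ) : ℕ := sInf (S : Set ℕ)

/-- The greatest common divisor `d` of the differences `i - i₀`, `i ∈ S`. -/
def gap (S : Finset ℕ) : ℕ := S.gcd fun i => i - first S

/-- `e_S`: the order of `v(b)/d` in `(vK)^ℚ / vK`, where `b ∈ Kˣ` is such that `w(b x ^ d) = 0` for
all `w ∈ Ω_{S,g,x}`.  That is, the least `e ≥ 1` with `e v(b) = d γ` for some `γ ∈ vK`. -/
def expo {K L : Type*} [Field K] [Field L] [Algebra K L]
    (v : ValuationSubring K) (g : K[X]) (x : L) (S : Finset ℕ) : ℕ :=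
  sInf {e : ℕ | 0 < e ∧ ∃ b : K, b ≠ 0 ∧
    (∀ w ∈ OmegaS v g x S, w.valuation (algebraMap K L b * x ^ gap S) = 1) ∧
    ∃ γ : v.ValueGroup, v.valuation b ^ e = γ ^ gap S}

/-- `𝒞_g(S)`: the `c ∈ Kˣ` with `w(c x ^ e_S) = 0` for all `w ∈ Ω_{S,g,x}`. -/
def Scale {K L : Type*} [Field K] [Field L] [Algebra K L]
    (v : ValuationSubring K) (g : K[X]) (x : L) (S : Finset ℕ) : Set K :=
  {c | c ≠ 0 ∧ ∀ w ∈ OmegaS v g x S, w.valuation (algebraMap K L c * x ^ expo v g x S) = 1}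

/-- The residue polynomial `p_{S,g,c} = ∑_{i ∈ S} res(a_i a_{i₀}⁻¹ c ^ (-n_i)) t ^ n_i` over `Kv`,
where `n_i = (i - i₀) / e_S`. -/
def resPoly {K L : Type*} [Field K] [Field L] [Algebra K L]
    (v : ValuationSubring K) (g : K[X]) (x : L) (S : Finset ℕ) (c : K) : (Res v)[X] :=
  ∑ i ∈ S, monomial ((i - first S) / expo v g x S)
    (res v (g.coeff i * (g.coeff (first S))⁻¹ * (c ^ ((i - first S) / expo v g x S))⁻¹))

/-- `Ω_{S,g,x,q} = {w ∈ Ω_{S,g,x} | q(res(c x ^ e_S)) = 0 in Lw}`. -/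
def OmegaSq {K L : Type*} [Field K] [Field L] [Algebra K L]
    (v : ValuationSubring K) (g : K[X]) (x : L) (S : Finset ℕ) (c : K) (q : (Res v)[X]) :
    Set (ValuationSubring L) :=
  {w | w ∈ OmegaS v g x S ∧ ∃ h : Extends v w,
    q.eval₂ (resMap h) (res w (algebraMap K L c * x ^ expo v g x S)) = 0}

/-- The multiplicities of the roots of `p` in an algebraic closure. -/
def Mult {k : Type*} [Field k] (p : k[X]) : Set ℕ :=
  {m | ∃ β : AlgebraicClosure k, aeval β p = 0 ∧
    m = (p.map (algebraMap k (AlgebraicClosure k))).rootMultiplicity β}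

/-- `p` is purely inseparable of degree `r`: it has degree `r` and a single root in an algebraic
closure. -/
def IsPurelyInsepPoly {k : Type*} [Field k] (p : k[X]) (r : ℕ) : Prop :=
  ∃ a β : AlgebraicClosure k, a ≠ 0 ∧
    p.map (algebraMap k (AlgebraicClosure k)) = C a * (X - C β) ^ r

/-- The base extension `E' = E[α][l]` inside a field `F'` containing `α` and `l`. -/
def baseExt (E : Type*) {F' : Type*} [Field E] [Field F'] [Algebra E F'] (α l : F') :
    IntermediateField E F' :=
  IntermediateField.adjoin E {α, l}

/-- `f(l⁻¹ t)`. -/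
def scalePoly {E K : Type*} [Field E] [Field K] [Algebra E K] (f : E[X]) (l : K) : K[X] :=
  (f.map (algebraMap E K)).comp (C l⁻¹ * X)

/-- `f(l⁻¹ (t + 1))`. -/
def shiftPoly {E K : Type*} [Field E] [Field K] [Algebra E K] (f : E[X]) (l : K) : K[X] :=
  (f.map (algebraMap E K)).comp (C l⁻¹ * (X + 1))

/-- The set `Ω` of all `w' ∈ Ω_v(F')` with `w'|_F ∈ Ω_{S,f,x,q}`, `w'(l x) = 0` and
residue of `l x` equal to `1`. -/
def OmegaLift {E F F' : Type*} [Field E] [Field F] [Field F'] [Algebra E F] [Algebra F F']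
    [Algebra E F'] (v : ValuationSubring E) (f : E[X]) (x : F) (S : Finset ℕ) (c : E)
    (q : (Res v)[X]) (l : F') : Set (ValuationSubring F') :=
  {w' | w' ∈ Omega v F' ∧ w'.comap (algebraMap F F') ∈ OmegaSq v f x S c q ∧
    w'.valuation (l * algebraMap F F' x) = 1 ∧ res w' (l * algebraMap F F' x) = 1}

end ResidueReduction

end

open Polynomial

noncomputable section

namespace ResidueReduction

/-! ### Arithmetic of residues in a valuation ring -/

section Residues

variable {K : Type*} [Field K] {v : ValuationSubring K} {x y : K}

/-! Write additively in this outline. Let `w ∈ Ω_{S,f,X,q}`. The residue of `cX^e` is a root of `q`,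
and this root is simple because the assumption on the characteristic makes `q` separable. So over
`w` the generator `α` reduces to a simple root of the reduction of `Q`. At the next stage `(λX)^e =
α⁻¹cX^e` has residue `1`, and `1` is a simple root of `t^e - 1` because `e` is nonzero in `Ev`. A
generator reducing to a prescribed simple root (`IsSimpleRootGenerator`) determines one extension of
the valuation, with the same residue field and value group. No henselization is used: `P'(α)` is a
unit that carries integral elements into `𝒪_w[α]`, so every element of the extended valuation ring
is a quotient of polynomials in `α` with unit denominator. The value group is found by comparing
conjugates (`exists_valuation_eq`).

Irreducibility is a degree count. The products `α^i λ^j` with `i < deg Q`, `j < e` are linearly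
independent over `E`, because the powers of the residue of `α` are independent and the values of the
powers of `λ` lie in distinct cosets of `vE`. As `E` is relatively algebraically closed in `F`, the
degree of `λ` over `F` is that over `E`, and both steps of the tower must have full degree.

Since `λX` is a unit, the normalized coefficients of `f(λ⁻¹t)` have the values of the quotients of
the terms `a_iX^i` by `a_{i₀}X^{i₀}`. The reduction is therefore `t^{i₀} p_{S,f,c}(ᾱt^e)`, in which
`1` is a root of multiplicity exactly `r`. After the shift by `1` the coefficient of `t^r` is a unit
and `X₁` has positive value, so no term of index above `r` is minimal. The residue polynomial of
`S₁` thus has degree at most `r`, and a root of multiplicity at least `r` exhausts it.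

The bijection follows from equality of residue fields. For the covering it remains to see that a
single minimal term of `g(X₁)` forces a ruled residue field. Then the square root is close to the
square root of a monomial, and `F'` has the same residues as some `K(Z)` with `K/E` finite
(`isRuled_of_supp_eq_singleton`). The ruled residue theorem for `K(Z)` is `exists_ruled_residues`.
Its proof takes a polynomial `P` of least degree such that no power of `P(Z)` times a constant is a
unit with algebraic residue, and refines the valuation so that `P(Z)` becomes infinitely large. Then
`P`-adic expansions have no cancellation, the residues of polynomials of degree below `deg P` form a
finite extension `k'`, and the remaining residues are generated over `k'` by one transcendental
element. -/

theorem res_of_mem (hx : x ∈ v) : res v x = IsLocalRing.residue v ⟨x, hx⟩ := dif_pos hx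

theorem res_coe (x : v) : res v (x : K) = IsLocalRing.residue v x := res_of_mem x.2

theorem res_of_notMem (hx : x ∉ v) : res v x = 0 := dif_neg hx

theorem exists_res_eq (a : Res v) : ∃ x ∈ v, res v x = a := by
  obtain ⟨x, rfl⟩ := IsLocalRing.residue_surjective a
  exact ⟨x, x.2, res_coe x⟩

theorem mem_iff_valuation_le_one : x ∈ v ↔ v.valuation x ≤ 1 := (v.valuation_le_one_iff x).symm

theorem mem_of_valuation_eq_one (hx : v.valuation x = 1) : x ∈ v :=
  mem_iff_valuation_le_one.2 hx.le

theorem mem_of_valuation_lt_one (hx : v.valuation x < 1) : x ∈ v :=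
  mem_iff_valuation_le_one.2 hx.le

theorem res_add (hx : x ∈ v) (hy : y ∈ v) : res v (x + y) = res v x + res v y := by
  rw [res_of_mem hx, res_of_mem hy, res_of_mem (v.add_mem _ _ hx hy), ← map_add]; rfl

theorem res_mul (hx : x ∈ v) (hy : y ∈ v) : res v (x * y) = res v x * res v y := by
  rw [res_of_mem hx, res_of_mem hy, res_of_mem (v.mul_mem _ _ hx hy), ← map_mul]; rfl

theorem res_neg (hx : x ∈ v) : res v (-x) = -res v x := by
  rw [res_of_mem hx, res_of_mem (v.neg_mem _ hx), ← map_neg]; rfl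

theorem res_sub (hx : x ∈ v) (hy : y ∈ v) : res v (x - y) = res v x - res v y := by
  rw [sub_eq_add_neg, sub_eq_add_neg, res_add hx (v.neg_mem _ hy), res_neg hy]

@[simp] theorem res_zero : res v 0 = 0 := by
  rw [res_of_mem v.zero_mem]; exact map_zero _

@[simp] theorem res_one : res v 1 = 1 := by
  rw [res_of_mem v.one_mem]; exact map_one _

theorem res_pow (hx : x ∈ v) (n : ℕ) : res v (x ^ n) = res v x ^ n := by
  rw [res_of_mem hx, res_of_mem (pow_mem hx n), ← map_pow]; rfl

theorem res_natCast (n : ℕ) : res v (n : K) = n := by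
  rw [res_of_mem (natCast_mem v n), ← map_natCast (IsLocalRing.residue v)]; rfl

theorem res_sum {ι : Type*} (s : Finset ι) (f : ι → K) (hf : ∀ i ∈ s, f i ∈ v) :
    res v (∑ i ∈ s, f i) = ∑ i ∈ s, res v (f i) := by
  classical
  induction s using Finset.induction_on with
  | empty => simp
  | insert a s ha ih =>
    rw [Finset.sum_insert ha, Finset.sum_insert ha, res_add (hf a (by simp))
      (sum_mem fun i hi => hf i (by simp [hi])), ih fun i hi => hf i (by simp [hi])]

theorem res_eq_zero_iff (hx : x ∈ v) : res v x = 0 ↔ v.valuation x < 1 := by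
  rw [res_of_mem hx, IsLocalRing.residue_eq_zero_iff, v.valuation_lt_one_iff]

theorem res_ne_zero_iff : res v x ≠ 0 ↔ v.valuation x = 1 := by
  by_cases hx : x ∈ v
  · rw [Ne, res_eq_zero_iff hx, not_lt]
    exact ⟨fun h => le_antisymm (mem_iff_valuation_le_one.1 hx) h, fun h => h.ge⟩
  · rw [res_of_notMem hx]
    simp only [ne_eq, not_true_eq_false, false_iff]
    exact fun h => hx (mem_of_valuation_eq_one h)

theorem res_eq_res_iff (hx : x ∈ v) (hy : y ∈ v) : res v x = res v y ↔ v.valuation (x - y) < 1 := by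
  rw [← sub_eq_zero, ← res_sub hx hy, res_eq_zero_iff (sub_mem hx hy)]

theorem res_inv (hx : v.valuation x = 1) : res v x⁻¹ = (res v x)⁻¹ := by
  have hx0 : x ≠ 0 := by rintro rfl; simp at hx
  refine eq_inv_of_mul_eq_one_left ?_
  rw [← res_mul (mem_of_valuation_eq_one (by simp [hx])) (mem_of_valuation_eq_one hx),
    inv_mul_cancel₀ hx0, res_one]

end Residues

/-! ### Extensions of valuation rings and their residue maps -/

section Extensions

variable {K L M : Type*} [Field K] [Field L] [Field M] [Algebra K L] [Algebra L M] [Algebra K M]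
  [IsScalarTower K L M]
  {v : ValuationSubring K} {w : ValuationSubring L} {u : ValuationSubring M}

namespace Extends

theorem mem_iff (h : Extends v w) {x : K} : algebraMap K L x ∈ w ↔ x ∈ v := by
  conv_rhs => rw [← show w.comap (algebraMap K L) = v from h]
  exact Iff.rfl

theorem valuation_le_iff (h : Extends v w) {x y : K} :
    w.valuation (algebraMap K L x) ≤ w.valuation (algebraMap K L y) ↔
      v.valuation x ≤ v.valuation y := by
  rcases eq_or_ne y 0 with rfl | hy
  · simp
  · have hy' : algebraMap K L y ≠ 0 := by simpa using hy
    have hv : ∀ {F : Type _} [Field F] (u : ValuationSubring F) (a b : F), b ≠ 0 →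
        (u.valuation a ≤ u.valuation b ↔ a / b ∈ u) := by
      intro F _ u a b hb
      rw [mem_iff_valuation_le_one, map_div₀, div_le_one₀ (zero_lt_iff.2 (by simpa using hb))]
    rw [hv w _ _ hy', ← map_div₀, h.mem_iff]
    rw [mem_iff_valuation_le_one, map_div₀, div_le_one₀ (zero_lt_iff.2 (by simpa using hy))]

theorem valuation_eq_iff (h : Extends v w) {x y : K} :
    w.valuation (algebraMap K L x) = w.valuation (algebraMap K L y) ↔
      v.valuation x = v.valuation y := by
  simp only [le_antisymm_iff, h.valuation_le_iff]

theorem valuation_lt_iff (h : Extends v w) {x y : K} :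
    w.valuation (algebraMap K L x) < w.valuation (algebraMap K L y) ↔
      v.valuation x < v.valuation y := by
  simp only [lt_iff_not_ge, h.valuation_le_iff]

theorem valuation_eq_one_iff (h : Extends v w) {x : K} :
    w.valuation (algebraMap K L x) = 1 ↔ v.valuation x = 1 := by
  simpa using h.valuation_eq_iff (x := x) (y := 1)

theorem valuation_lt_one_iff (h : Extends v w) {x : K} :
    w.valuation (algebraMap K L x) < 1 ↔ v.valuation x < 1 := by
  simpa using h.valuation_lt_iff (x := x) (y := 1)

theorem resMap_res (h : Extends v w) {x : K} (hx : x ∈ v) :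
    resMap h (res v x) = res w (algebraMap K L x) := by
  rw [res_of_mem hx, res_of_mem (h.mem_iff.2 hx)]
  rfl

theorem trans (h : Extends v w) (h' : Extends w u) : Extends v u := by
  have e : algebraMap K M = (algebraMap L M).comp (algebraMap K L) := IsScalarTower.algebraMap_eq ..
  unfold Extends at *
  rw [e, ← ValuationSubring.comap_comap, h', h]

theorem comap_right (h : Extends v u) : Extends v (u.comap (algebraMap L M)) := by
  have e : algebraMap K M = (algebraMap L M).comp (algebraMap K L) := IsScalarTower.algebraMap_eq ..
  unfold Extends at *
  rw [ValuationSubring.comap_comap, ← e, h]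

theorem comap_self (u : ValuationSubring M) : Extends (u.comap (algebraMap L M)) u := rfl

theorem resMap_trans (h : Extends v w) (h' : Extends w u) (h'' : Extends v u) (a : Res v) :
    resMap h'' a = resMap h' (resMap h a) := by
  obtain ⟨x, hx, rfl⟩ := exists_res_eq a
  rw [resMap_res h'' hx, resMap_res h hx, resMap_res h' (h.mem_iff.2 hx),
    ← IsScalarTower.algebraMap_apply]

end Extends

/-- The local ring `𝒪_v` is dominated by some valuation ring of `L`. An `x ∈ K` outside `𝒪_v` but
inside the dominating ring would make the nonunit `x⁻¹` of `𝒪_v` a unit there, against domination.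
-/
theorem exists_extends (K L : Type*) [Field K] [Field L] [Algebra K L] (v : ValuationSubring K) :
    ∃ w : ValuationSubring L, Extends v w := by
  obtain ⟨w, hw, hloc⟩ := IsLocalRing.exists_factor_valuationRing
    ((algebraMap K L).comp (algebraMap v K))
  refine ⟨w, ?_⟩
  ext x
  refine ⟨fun hx => ?_, fun hx => hw ⟨x, hx⟩⟩
  by_contra hxv
  have hx0 : x ≠ 0 := by rintro rfl; exact hxv v.zero_mem
  have hxi : x⁻¹ ∈ v := (v.mem_or_inv_mem x).resolve_left hxv
  have : IsUnit (((algebraMap K L).comp (algebraMap v K)).codRestrict w.toSubring hw ⟨x⁻¹, hxi⟩) := by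
    refine IsUnit.of_mul_eq_one ⟨algebraMap K L x, hx⟩ (Subtype.ext ?_)
    change algebraMap K L x⁻¹ * algebraMap K L x = 1
    rw [← map_mul, inv_mul_cancel₀ hx0, map_one]
  obtain ⟨b, hb⟩ := (hloc.map_nonunit _ this).exists_right_inv
  have hb' : x⁻¹ * (b : K) = 1 := congrArg Subtype.val hb
  have : x = b := by
    have := congrArg (x * ·) hb'
    simpa [← mul_assoc, hx0] using this.symm
  exact hxv (this ▸ b.2)

end Extensions

/-! ### Integral elements and localization of the integral closure -/

section IntegralElements

-- Traces of integral elements are integral, so `b` lies in the trace dual of `A[α]`. By Euler's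
-- formula this dual is `A[α]` divided by the derivative of the minimal polynomial at `α`.
open scoped Pointwise in
theorem exists_mul_aeval_derivative_minpoly_eq {A K L : Type*} [CommRing A] [IsDomain A]
    [IsIntegrallyClosed A] [Field K] [Field L] [Algebra A K] [IsFractionRing A K] [Algebra K L]
    [Algebra A L] [IsScalarTower A K L] [FiniteDimensional K L] [Algebra.IsSeparable K L] {α b : L}
    (hα : Algebra.adjoin K {α} = ⊤) (hαi : IsIntegral A α) (hb : IsIntegral A b) :
    ∃ h : A[X], b * aeval α (derivative (minpoly K α)) = aeval α h := by
  have hne : aeval α (derivative (minpoly K α)) ≠ 0 :=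
    (Algebra.IsSeparable.isSeparable K α).aeval_derivative_ne_zero (minpoly.aeval K α)
  have hmem : b ∈ (Algebra.traceForm K L).dualSubmodule
      (Subalgebra.toSubmodule (Algebra.adjoin A {α})) := by
    rw [LinearMap.BilinForm.mem_dualSubmodule]
    intro y hy
    have hy' : IsIntegral A y := by
      have : Algebra.adjoin A {α} ≤ integralClosure A L :=
        Algebra.adjoin_le (Set.singleton_subset_iff.2 hαi)
      exact this hy
    rw [Algebra.traceForm_apply, Submodule.mem_one]
    exact IsIntegrallyClosed.isIntegral_iff.1 (Algebra.isIntegral_trace (hb.mul hy'))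
  rw [traceForm_dualSubmodule_adjoin A K hα hαi] at hmem
  obtain ⟨y, hy, hyb⟩ := Submodule.mem_smul_pointwise_iff_exists _ _ _ |>.1 hmem
  rw [Subalgebra.mem_toSubmodule, Algebra.adjoin_singleton_eq_range_aeval] at hy
  obtain ⟨h, rfl⟩ := hy
  refine ⟨h, ?_⟩
  rw [← hyb, smul_eq_mul, mul_comm, mul_inv_cancel_left₀ hne]
  rfl

variable {K L : Type*} [Field K] [Field L] [Algebra K L] {w : ValuationSubring K}

/-- The integral closure is the intersection of the valuation rings containing it. -/
theorem isIntegral_of_forall_mem {x : L}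
    (hx : ∀ V : ValuationSubring L, (∀ a ∈ w, algebraMap K L a ∈ V) → x ∈ V) : IsIntegral w x := by
  by_contra hxi
  obtain ⟨V, hV, hxV⟩ := Subring.exists_le_valuationSubring_of_isIntegrallyClosedIn
    (R := (integralClosure w L).toSubring) (x := x) hxi
  exact hxV (hx V fun a ha => hV (show algebraMap K L a ∈ integralClosure w L from
    isIntegral_algebraMap (R := w) (x := ⟨a, ha⟩)))

/-- A scaled annihilating polynomial: coefficients in `𝒪_w`, the last unit coefficient is `1`. -/
theorem exists_primitive_annihilator (w : ValuationSubring K) {y : L} (hy : IsAlgebraic K y) :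
    ∃ (p : K[X]) (k : ℕ), aeval y p = 0 ∧ p.coeff k = 1 ∧ (∀ i, p.coeff i ∈ w) ∧
      ∀ i, k < i → w.valuation (p.coeff i) < 1 := by
  obtain ⟨p, hp0, hp⟩ := hy
  obtain ⟨m, hm, hmax⟩ := p.support.exists_max_image (fun i => w.valuation (p.coeff i))
    (Polynomial.support_nonempty.2 hp0)
  set T := p.support.filter fun i => w.valuation (p.coeff i) = w.valuation (p.coeff m) with hT
  have hTne : T.Nonempty := ⟨m, by simp [hT, Polynomial.mem_support_iff.1 hm]⟩
  set k := T.max' hTne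
  have hkT : k ∈ T := T.max'_mem hTne
  have hk0 : p.coeff k ≠ 0 := Polynomial.mem_support_iff.1 (Finset.mem_filter.1 hkT).1
  have hkm : w.valuation (p.coeff k) = w.valuation (p.coeff m) := (Finset.mem_filter.1 hkT).2
  have hpos : 0 < w.valuation (p.coeff k) := zero_lt_iff.2 (by simpa using hk0)
  have hle : ∀ i, w.valuation (p.coeff i) ≤ w.valuation (p.coeff k) := by
    intro i
    by_cases hi : p.coeff i = 0
    · simp [hi]
    · rw [hkm]; exact hmax i (Polynomial.mem_support_iff.2 hi)
  refine ⟨C (p.coeff k)⁻¹ * p, k, by simp [hp], by simp [hk0], fun i => ?_, fun i hi => ?_⟩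
  · rw [mem_iff_valuation_le_one, coeff_C_mul, map_mul, map_inv₀, inv_mul_le_iff₀ hpos, mul_one]
    exact hle i
  · rw [coeff_C_mul, map_mul, map_inv₀, inv_mul_lt_iff₀ hpos, mul_one]
    refine lt_of_le_of_ne (hle i) fun h => ?_
    have hi0 : p.coeff i ≠ 0 := by
      intro h0; rw [h0, map_zero] at h; exact hpos.ne h
    exact absurd (T.le_max' i (by simp [hT, hi0, h, hkm])) (not_le.2 hi)

/-- The valuation ring of an algebraic extension is a localization of the integral closure. -/
theorem Extends.exists_isIntegral_mul_eq {W : ValuationSubring L} (h : Extends w W) {y : L}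
    (hy : IsAlgebraic K y) (hyW : y ∈ W) :
    ∃ s b : L, IsIntegral w s ∧ IsIntegral w b ∧ W.valuation s = 1 ∧ y * s = b := by
  rcases eq_or_ne y 0 with rfl | hy0
  · exact ⟨1, 0, isIntegral_one, isIntegral_zero, by simp, by simp⟩
  obtain ⟨p, k, hp, hk, hpw, hlt⟩ := exists_primitive_annihilator w hy
  set n := p.natDegree
  have hkn : k ≤ n := le_natDegree_of_ne_zero (by rw [hk]; exact one_ne_zero)
  -- The relation for `y` is cut at the index `k`: the upper part gives a polynomial `s` in `y`, the
  -- lower part a polynomial `c` in `y⁻¹`, with `y s = -c`. Each valuation ring over `𝒪_w` contains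
  -- `y` or `y⁻¹`, and in either case contains both `s` and `c`.
  set s : L := ∑ i ∈ Finset.range (n - k + 1), algebraMap K L (p.coeff (k + i)) * y ^ i with hs
  set c : L := ∑ i ∈ Finset.range k, algebraMap K L (p.coeff i) * y⁻¹ ^ (k - 1 - i) with hc
  have hsum : y * s = -c := by
    have h0 : ∑ i ∈ Finset.range (k + (n - k + 1)), algebraMap K L (p.coeff i) * y ^ i = 0 := by
      rw [← hp, aeval_eq_sum_range, show k + (n - k + 1) = p.natDegree + 1 by omega]
      simp [Algebra.smul_def]
    rw [Finset.sum_range_add] at h0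
    have h1 : ∑ i ∈ Finset.range (n - k + 1), algebraMap K L (p.coeff (k + i)) * y ^ (k + i) =
        s * y ^ k := by
      rw [hs, Finset.sum_mul]
      exact Finset.sum_congr rfl fun i _ => by ring
    have h2 : ∑ i ∈ Finset.range k, algebraMap K L (p.coeff i) * y ^ i = c * y⁻¹ * y ^ k := by
      rw [hc, Finset.sum_mul, Finset.sum_mul]
      refine Finset.sum_congr rfl fun i hi => ?_
      have hik := Finset.mem_range.1 hi
      have : y ^ k = y ^ i * y ^ (k - 1 - i) * y := by
        rw [← pow_add, ← pow_succ]; congr 1; omega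
      rw [this, inv_pow]
      field_simp
    rw [h1, h2, ← add_mul] at h0
    have h3 := (mul_eq_zero.1 h0).resolve_right (pow_ne_zero _ hy0)
    field_simp at h3
    linear_combination h3
  have hint : ∀ V : ValuationSubring L, (∀ a ∈ w, algebraMap K L a ∈ V) → s ∈ V ∧ -c ∈ V := by
    intro V hV
    rcases V.mem_or_inv_mem y with hyV | hyV
    · have hsV : s ∈ V := sum_mem fun i _ => V.mul_mem _ _ (hV _ (hpw _)) (pow_mem hyV _)
      exact ⟨hsV, hsum ▸ V.mul_mem _ _ hyV hsV⟩
    · have hcV : -c ∈ V :=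
        V.neg_mem _ (sum_mem fun i _ => V.mul_mem _ _ (hV _ (hpw _)) (pow_mem hyV _))
      refine ⟨?_, hcV⟩
      have : s = y⁻¹ * -c := by rw [← hsum]; field_simp
      rw [this]
      exact V.mul_mem _ _ hyV hcV
  refine ⟨s, -c, isIntegral_of_forall_mem fun V hV => (hint V hV).1,
    isIntegral_of_forall_mem fun V hV => (hint V hV).2, ?_, hsum⟩
  -- The coefficient of index `k` is `1` and all later ones lie in the maximal ideal, so `s` is a
  -- principal unit.
  have h1 : W.valuation (s - 1) < 1 := by
    rw [hs, Finset.sum_range_succ']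
    simp only [add_zero, hk, map_one, pow_zero, mul_one, add_sub_cancel_right]
    refine Valuation.map_sum_lt _ one_ne_zero fun i _ => ?_
    rw [map_mul]
    refine mul_lt_one_of_lt_of_le ?_ (mem_iff_valuation_le_one.1 (pow_mem hyW _))
    exact h.valuation_lt_one_iff.2 (hlt _ (by omega))
  have := Valuation.map_add_eq_of_lt_right W.valuation (x := s - 1) (y := 1) (by simpa using h1)
  simpa using this

end IntegralElements

/-! ### Generators reducing to a simple root: uniqueness, residues, existence -/

section SimpleRoots

variable {K L : Type*} [Field K] [Field L] [Algebra K L] {w : ValuationSubring K}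
  {W : ValuationSubring L}

theorem Extends.aeval_mem (hW : Extends w W) {α : L} (hα : α ∈ W) (h : w[X]) : aeval α h ∈ W := by
  rw [aeval_eq_sum_range]
  refine sum_mem fun i _ => ?_
  rw [Algebra.smul_def]
  exact W.mul_mem _ _ (hW.mem_iff.2 (h.coeff i).2) (pow_mem hα i)

theorem Extends.res_aeval (hW : Extends w W) {α : L} (hα : α ∈ W) (h : w[X]) :
    res W (aeval α h) = (h.map (IsLocalRing.residue w)).eval₂ (resMap hW) (res W α) := by
  rw [eval₂_map, aeval_eq_sum_range, eval₂_eq_sum_range, res_sum]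
  · refine Finset.sum_congr rfl fun i _ => ?_
    have e : algebraMap w L (h.coeff i) = algebraMap K L (h.coeff i : K) := rfl
    rw [Algebra.smul_def, e, res_mul (hW.mem_iff.2 (h.coeff i).2) (pow_mem hα i), res_pow hα,
      RingHom.comp_apply, ← res_coe, hW.resMap_res (h.coeff i).2]
  · intro i _
    rw [Algebra.smul_def]
    exact W.mul_mem _ _ (hW.mem_iff.2 (h.coeff i).2) (pow_mem hα i)

/-- `α` generates `L` over `K` and is a root of a monic irreducible polynomial `P` over `𝒪_w` whose
reduction has the residue of `a` as a simple root. -/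
structure IsSimpleRootGenerator (w : ValuationSubring K) (P : w[X]) (a : K) (α : L) : Prop where
  monic : P.Monic
  irreducible : Irreducible (P.map (algebraMap w K))
  root : aeval α P = 0
  adjoin : IntermediateField.adjoin K {α} = ⊤
  mem : a ∈ w
  eval_res : (P.map (IsLocalRing.residue w)).eval (res w a) = 0
  eval_derivative_res : (P.map (IsLocalRing.residue w)).derivative.eval (res w a) ≠ 0

namespace IsSimpleRootGenerator

variable {P : w[X]} {a : K} {α : L}

theorem isIntegral (H : IsSimpleRootGenerator w P a α) : IsIntegral w α :=
  ⟨P, H.monic, by rw [← aeval_def, H.root]⟩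

theorem minpoly_eq (H : IsSimpleRootGenerator w P a α) :
    minpoly K α = P.map (algebraMap w K) :=
  (minpoly.eq_of_irreducible_of_monic H.irreducible
    (by rw [aeval_map_algebraMap, H.root]) (H.monic.map _)).symm

theorem finiteDimensional (H : IsSimpleRootGenerator w P a α) : FiniteDimensional K L := by
  have : FiniteDimensional K (⊤ : IntermediateField K L) := by
    rw [← H.adjoin]
    exact IntermediateField.adjoin.finiteDimensional (H.isIntegral.tower_top)
  exact IntermediateField.topEquiv.toLinearEquiv.finiteDimensional

theorem isSeparable (H : IsSimpleRootGenerator w P a α) : Algebra.IsSeparable K L := by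
  have hs : IsSeparable K α := by
    rw [IsSeparable, separable_iff_derivative_ne_zero (minpoly.irreducible H.isIntegral.tower_top),
      H.minpoly_eq, derivative_map]
    intro h0
    have h1 : P.derivative = 0 :=
      map_injective _ (IsFractionRing.injective w K) (by rw [h0, Polynomial.map_zero])
    exact H.eval_derivative_res (by rw [derivative_map, h1]; simp)
  have : Algebra.IsSeparable K (⊤ : IntermediateField K L) := by
    rw [← H.adjoin]
    exact (IntermediateField.isSeparable_adjoin_simple_iff_isSeparable K L).2 hs
  exact AlgEquiv.Algebra.isSeparable (IntermediateField.topEquiv (F := K) (E := L))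

theorem algebraAdjoin_eq (H : IsSimpleRootGenerator w P a α) : Algebra.adjoin K {α} = ⊤ := by
  rw [← IntermediateField.adjoin_simple_toSubalgebra_of_isAlgebraic
    (H.isIntegral.tower_top (A := K)).isAlgebraic, H.adjoin, IntermediateField.top_toSubalgebra]

theorem res_aeval (hW : Extends w W) (hα : α ∈ W)
    (hres : res W α = res W (algebraMap K L a)) (ha : a ∈ w) (h : w[X]) :
    res W (aeval α h) = resMap hW ((h.map (IsLocalRing.residue w)).eval (res w a)) := by
  rw [hW.res_aeval hα, hres, ← hW.resMap_res ha, eval₂_at_apply]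

/-- Every element of `𝒪_W` is a quotient of two polynomials in `α` over `𝒪_w`, the denominator
being a unit. -/
theorem exists_mul_aeval_eq (H : IsSimpleRootGenerator w P a α) (hW : Extends w W) (hα : α ∈ W)
    (hres : res W α = res W (algebraMap K L a)) {y : L} (hy : y ∈ W) :
    ∃ s b : w[X], (s.map (IsLocalRing.residue w)).eval (res w a) ≠ 0 ∧
      y * aeval α s = aeval α b := by
  have := H.finiteDimensional
  have := H.isSeparable
  obtain ⟨s, b, hs, hb, hs1, hyb⟩ :=
    hW.exists_isIntegral_mul_eq (Algebra.IsAlgebraic.isAlgebraic (R := K) y) hy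
  -- Multiplying numerator and denominator by `P'(α)` brings both into `𝒪_w[α]`. The denominator
  -- remains a unit because the residue of `a` is a simple root.
  obtain ⟨p, hp⟩ := exists_mul_aeval_derivative_minpoly_eq H.algebraAdjoin_eq H.isIntegral hs
  obtain ⟨p', hp'⟩ := exists_mul_aeval_derivative_minpoly_eq H.algebraAdjoin_eq H.isIntegral hb
  rw [H.minpoly_eq, derivative_map, aeval_map_algebraMap] at hp hp'
  refine ⟨p, p', ?_, ?_⟩
  · have h1 : res W (aeval α p) ≠ 0 := by
      rw [← hp, res_mul (mem_of_valuation_eq_one hs1) (hW.aeval_mem hα _)]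
      refine mul_ne_zero (res_ne_zero_iff.2 hs1) ?_
      rw [res_aeval hW hα hres H.mem, ← derivative_map]
      exact (_root_.map_ne_zero _).2 H.eval_derivative_res
    rw [res_aeval hW hα hres H.mem] at h1
    exact (_root_.map_ne_zero _).1 h1
  · rw [← hp, ← hp', ← mul_assoc, hyb]

/-- The residue of a polynomial in `α` depends only on the residue of `a`. Hence the denominators of
`exists_mul_aeval_eq` are units for both extensions at once, and each ring contains the other. -/
theorem unique (H : IsSimpleRootGenerator w P a α) {W' : ValuationSubring L} (hW : Extends w W)
    (hα : α ∈ W) (hres : res W α = res W (algebraMap K L a)) (hW' : Extends w W') (hα' : α ∈ W')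
    (hres' : res W' α = res W' (algebraMap K L a)) : W = W' := by
  have key : ∀ W W' : ValuationSubring L, Extends w W → α ∈ W →
      res W α = res W (algebraMap K L a) → Extends w W' → α ∈ W' →
      res W' α = res W' (algebraMap K L a) → W ≤ W' := by
    intro W W' hW hα hres hW' hα' hres' y hy
    obtain ⟨s, b, hs, hyb⟩ := H.exists_mul_aeval_eq hW hα hres hy
    have hs' : W'.valuation (aeval α s) = 1 := by
      rw [← res_ne_zero_iff, res_aeval hW' hα' hres' H.mem]
      exact (_root_.map_ne_zero _).2 hs
    have hb' := mem_iff_valuation_le_one.1 (hW'.aeval_mem hα' b)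
    rw [← hyb, map_mul, hs', mul_one] at hb'
    exact mem_iff_valuation_le_one.2 hb'
  exact le_antisymm (key _ _ hW hα hres hW' hα' hres') (key _ _ hW' hα' hres' hW hα hres)

/-- In a presentation `y s(α) = b(α)` with `s(α)` a unit, the residue of `y` is the quotient of the
reductions of `b` and `s` at the residue of `a`, which already lies below. -/
theorem resMap_surjective (H : IsSimpleRootGenerator w P a α) (hW : Extends w W)
    (hα : α ∈ W) (hres : res W α = res W (algebraMap K L a)) :
    Function.Surjective (resMap hW) := by
  intro z
  obtain ⟨y, hy, rfl⟩ := exists_res_eq z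
  obtain ⟨s, b, hs, hyb⟩ := H.exists_mul_aeval_eq hW hα hres hy
  have h1 := congrArg (res W) hyb
  rw [res_mul hy (hW.aeval_mem hα _), res_aeval hW hα hres H.mem,
    res_aeval hW hα hres H.mem] at h1
  refine ⟨(b.map (IsLocalRing.residue w)).eval (res w a) /
    (s.map (IsLocalRing.residue w)).eval (res w a), ?_⟩
  rw [map_div₀, ← h1]
  exact mul_div_cancel_right₀ _ ((_root_.map_ne_zero _).2 hs)

/-- Split `P` into factors `X - β` over `M` and evaluate at `a`. The value `P(a)` is in the maximal
ideal, so some factor `a - β` is; this `β` is a conjugate of `α`. Pulling `V` back along the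
corresponding embedding gives the extension sought in `exists_extends`. -/
theorem exists_algHom (H : IsSimpleRootGenerator w P a α) (M : Type*) [Field M] [IsAlgClosed M]
    [Algebra K M] {V : ValuationSubring M} (hV : Extends w V) :
    ∃ τ : L →ₐ[K] M, V.valuation (algebraMap K M a - τ α) < 1 := by
  have := H.finiteDimensional
  have hsplit := IsAlgClosed.splits (P.map (algebraMap w M))
  have hprod := hsplit.eq_prod_roots_of_monic (H.monic.map _)
  obtain ⟨β, hβ, hβres⟩ : ∃ β ∈ (P.map (algebraMap w M)).roots,
      V.valuation (algebraMap K M a - β) < 1 := by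
    by_contra hcon
    push Not at hcon
    have h1 : V.valuation (aeval (algebraMap K M a) P) < 1 := by
      have haV := hV.mem_iff.2 H.mem
      rw [← res_eq_zero_iff (hV.aeval_mem haV _), hV.res_aeval haV, ← hV.resMap_res H.mem,
        eval₂_at_apply, H.eval_res, map_zero]
    have h2 : aeval (algebraMap K M a) P =
        ((P.map (algebraMap w M)).roots.map fun β => algebraMap K M a - β).prod := by
      rw [aeval_def, ← eval_map]
      conv_lhs => rw [hprod]
      rw [eval_multiset_prod, Multiset.map_map]
      simp
    rw [h2, map_multiset_prod, Multiset.map_map] at h1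
    refine absurd h1 (not_lt.2 ?_)
    refine Multiset.one_le_prod fun x hx => ?_
    obtain ⟨β, hβ, rfl⟩ := Multiset.mem_map.1 hx
    exact hcon β hβ
  have hβ0 : aeval β (minpoly K α) = 0 := by
    rw [H.minpoly_eq, aeval_map_algebraMap, aeval_def, ← eval_map]
    exact (mem_roots'.1 hβ).2
  have hr : β ∈ (minpoly K α).rootSet M := by
    rw [mem_rootSet_of_ne (minpoly.ne_zero H.isIntegral.tower_top)]
    exact hβ0
  rw [← Algebra.IsAlgebraic.range_eval_eq_rootSet_minpoly] at hr
  obtain ⟨τ, rfl⟩ := hr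
  exact ⟨τ, hβres⟩

theorem exists_extends (H : IsSimpleRootGenerator w P a α) :
    ∃ W : ValuationSubring L, Extends w W ∧ α ∈ W ∧ res W α = res W (algebraMap K L a) := by
  obtain ⟨V, hV⟩ := ResidueReduction.exists_extends K (AlgebraicClosure L) w
  obtain ⟨τ, hτ⟩ := H.exists_algHom (AlgebraicClosure L) hV
  have hex : Extends w (V.comap (τ : L →+* AlgebraicClosure L)) := by
    rw [Extends, ValuationSubring.comap_comap]
    have : (τ : L →+* AlgebraicClosure L).comp (algebraMap K L) =
      algebraMap K (AlgebraicClosure L) := τ.comp_algebraMap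
    rw [this]
    exact hV
  have haW := hex.mem_iff.2 H.mem
  have hsub : algebraMap K L a - α ∈ V.comap (τ : L →+* AlgebraicClosure L) := by
    change τ (algebraMap K L a - α) ∈ V
    rw [map_sub, τ.commutes]
    exact mem_of_valuation_lt_one hτ
  have hαW : α ∈ V.comap (τ : L →+* AlgebraicClosure L) := by
    have := sub_mem haW hsub
    simpa using this
  refine ⟨V.comap (τ : L →+* AlgebraicClosure L), hex, hαW, ?_⟩
  rw [eq_comm, res_eq_res_iff haW hαW]
  letI : Algebra L (AlgebraicClosure L) := (τ : L →+* AlgebraicClosure L).toAlgebra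
  have : Extends (V.comap (τ : L →+* AlgebraicClosure L)) V := rfl
  rw [← this.valuation_lt_one_iff]
  change V.valuation (τ (algebraMap K L a - α)) < 1
  rw [map_sub, τ.commutes]
  exact hτ

end IsSimpleRootGenerator

end SimpleRoots

/-! ### Value groups by comparison of conjugates -/

section ValueGroup

/-- Among the terms of `g(ρ)`, the one of index `b` strictly dominates. -/
def HasDominantTerm {M : Type*} [Field M] (V : ValuationSubring M) (ρ : M) (g : M[X]) (b : ℕ) :
    Prop :=
  ∀ i, i ≠ b → V.valuation (g.coeff i * ρ ^ i) < V.valuation (g.coeff b * ρ ^ b)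

theorem HasDominantTerm.pos {M : Type*} [Field M] {V : ValuationSubring M} {ρ : M} {g : M[X]}
    {b : ℕ} (h : HasDominantTerm V ρ g b) : 0 < V.valuation (g.coeff b * ρ ^ b) :=
  zero_le.trans_lt (h (b + 1) (by omega))

/-- At radius `V.valuation ρ` the factor `X - σ` behaves like `X` when `σ` is smaller than `ρ`, and
the dominant index moves to `b + 1`; it behaves like the constant `-σ` when `σ` is larger, and the
index stays `b`. -/
theorem HasDominantTerm.mul_X_sub_C {M : Type*} [Field M] {V : ValuationSubring M} {ρ : M}
    {g : M[X]} {b : ℕ} (h : HasDominantTerm V ρ g b) (hρ : ρ ≠ 0) {σ : M}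
    (hσ : V.valuation σ ≠ V.valuation ρ) : ∃ b', HasDominantTerm V ρ (g * (X - C σ)) b' := by
  have hρ' : 0 < V.valuation ρ := zero_lt_iff.2 (by simpa using hρ)
  have hpos := h.pos
  set t : ℕ → V.ValueGroup := fun i => V.valuation (g.coeff i * ρ ^ i) with ht
  have hle : ∀ i, t i ≤ t b := fun i => by
    rcases eq_or_ne i b with rfl | hi
    · exact le_rfl
    · exact (h i hi).le
  have hcoeff : ∀ i, (g * (X - C σ)).coeff (i + 1) * ρ ^ (i + 1) =
      g.coeff i * ρ ^ i * ρ - g.coeff (i + 1) * ρ ^ (i + 1) * σ := fun i => by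
    rw [coeff_mul_X_sub_C]; ring
  have hcoeff0 : (g * (X - C σ)).coeff 0 * ρ ^ 0 = -(g.coeff 0 * ρ ^ 0 * σ) := by
    rw [mul_coeff_zero]; simp
  rcases lt_or_gt_of_ne hσ with hlt | hgt
  · refine ⟨b + 1, ?_⟩
    have hb : V.valuation ((g * (X - C σ)).coeff (b + 1) * ρ ^ (b + 1)) = t b * V.valuation ρ := by
      rw [hcoeff, sub_eq_add_neg, Valuation.map_add_eq_of_lt_left, map_mul]
      rw [Valuation.map_neg, map_mul, map_mul _ (g.coeff b * ρ ^ b)]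
      exact (mul_le_mul_left (hle (b + 1)) _).trans_lt (mul_lt_mul_of_pos_left hlt hpos)
    intro i hi
    rw [hb]
    have h2 : ∀ i, V.valuation (g.coeff i * ρ ^ i * σ) < t b * V.valuation ρ := fun i => by
      rw [map_mul]
      exact (mul_le_mul_left (hle i) _).trans_lt (mul_lt_mul_of_pos_left hlt hpos)
    cases i with
    | zero => rw [hcoeff0, Valuation.map_neg]; exact h2 0
    | succ i =>
      rw [hcoeff]
      refine Valuation.map_sub_lt _ ?_ (h2 _)
      rw [map_mul]
      exact mul_lt_mul_of_pos_right (h i (by omega)) hρ'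
  · refine ⟨b, ?_⟩
    have h1 : ∀ i, V.valuation (g.coeff i * ρ ^ i * ρ) < t b * V.valuation σ := fun i => by
      rw [map_mul]
      exact (mul_le_mul_left (hle i) _).trans_lt (mul_lt_mul_of_pos_left hgt hpos)
    have hσ' : 0 < V.valuation σ := hρ'.trans hgt
    have hb : V.valuation ((g * (X - C σ)).coeff b * ρ ^ b) = t b * V.valuation σ := by
      rcases b with _ | b
      · rw [hcoeff0, Valuation.map_neg, map_mul]
      · rw [hcoeff, Valuation.map_sub_eq_of_lt_right, map_mul]
        rw [map_mul _ (g.coeff (b + 1) * ρ ^ (b + 1))]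
        exact h1 b
    intro i hi
    rw [hb]
    have h2 : V.valuation (g.coeff i * ρ ^ i * σ) < t b * V.valuation σ := by
      rw [map_mul]
      exact mul_lt_mul_of_pos_right (h i hi) hσ'
    cases i with
    | zero => rw [hcoeff0, Valuation.map_neg]; exact h2
    | succ i =>
      rw [hcoeff]
      exact Valuation.map_sub_lt _ (h1 i) h2

theorem exists_hasDominantTerm {M : Type*} [Field M] (V : ValuationSubring M) {ρ : M} (hρ : ρ ≠ 0)
    (s : Multiset M) (hs : ∀ σ ∈ s, V.valuation σ ≠ V.valuation ρ) :
    ∃ b, HasDominantTerm V ρ (s.map fun σ => X - C σ).prod b := by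
  induction s using Multiset.induction_on with
  | empty =>
    refine ⟨0, fun i hi => ?_⟩
    simp [coeff_one, hi]
  | cons σ s ih =>
    obtain ⟨b, hb⟩ := ih fun τ hτ => hs τ (Multiset.mem_cons_of_mem hτ)
    rw [Multiset.map_cons, Multiset.prod_cons, mul_comm]
    exact hb.mul_X_sub_C hρ (hs σ (Multiset.mem_cons_self σ s))

/-- A root whose value differs from the values of all other roots has a value in the value group
of the field of coefficients. -/
theorem exists_valuation_eq_of_roots {K M : Type*} [Field K] [Field M] [Algebra K M]
    (V : ValuationSubring M) {ρ : M} (hρ : ρ ≠ 0) (m : K[X]) (s : Multiset M)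
    (hm : m.map (algebraMap K M) = (s.map fun σ => X - C σ).prod * (X - C ρ))
    (hs : ∀ σ ∈ s, V.valuation σ ≠ V.valuation ρ) :
    ∃ z : K, V.valuation ρ = V.valuation (algebraMap K M z) := by
  obtain ⟨b, hb⟩ := exists_hasDominantTerm V hρ s hs
  set g := (s.map fun σ => X - C σ).prod
  have hρ' : 0 < V.valuation ρ := zero_lt_iff.2 (by simpa using hρ)
  have hpos := hb.pos
  have hg0 : V.valuation (g.coeff b) ≠ 0 := by
    intro h0; rw [map_mul, h0, zero_mul] at hpos; exact lt_irrefl _ hpos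
  have hpow : ∀ n : ℕ, 0 < V.valuation ρ ^ n := fun n => pow_pos hρ' n
  have h1 : V.valuation ((m.map (algebraMap K M)).coeff (b + 1)) = V.valuation (g.coeff b) := by
    rw [hm, coeff_mul_X_sub_C, Valuation.map_sub_eq_of_lt_left]
    have := hb (b + 1) (by omega)
    rw [pow_succ', ← mul_assoc, map_mul, map_mul _ (g.coeff b), map_pow] at this
    exact lt_of_mul_lt_mul_right this zero_le
  have h0 : V.valuation ((m.map (algebraMap K M)).coeff b) =
      V.valuation (g.coeff b) * V.valuation ρ := by
    rw [hm]
    rcases b with _ | b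
    · rw [mul_coeff_zero]; simp
    · rw [coeff_mul_X_sub_C, Valuation.map_sub_eq_of_lt_right, map_mul]
      have := hb b (by omega)
      rw [pow_succ', ← mul_assoc, map_mul, map_mul _ (g.coeff (b + 1) * ρ), map_pow] at this
      exact lt_of_mul_lt_mul_right this zero_le
  rw [coeff_map] at h0 h1
  -- The factor `X - ρ` spreads the dominant term of `g` over two consecutive coefficients of `m`,
  -- with the values of `g_b ρ` and `g_b`.
  refine ⟨m.coeff b / m.coeff (b + 1), ?_⟩
  rw [map_div₀, map_div₀, h0, h1, mul_div_cancel_left₀ _ hg0]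

variable {K L : Type*} [Field K] [Field L] [Algebra K L] {w : ValuationSubring K}
  {W : ValuationSubring L}

/-- The roots of the minimal polynomial of `y` are its conjugates, and separability makes them
distinct. After one copy of `y` is removed, every remaining root therefore comes from a nontrivial
embedding, to which `hV` applies. -/
theorem exists_valuation_eq_of_algHom {M : Type*} [Field M] [IsAlgClosed M] [Algebra K M]
    [Algebra L M] [IsScalarTower K L M] [FiniteDimensional K L] [Algebra.IsSeparable K L]
    (V : ValuationSubring M) {y : L} (hy : y ≠ 0)
    (hV : ∀ τ : L →ₐ[K] M, τ ≠ IsScalarTower.toAlgHom K L M →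
      V.valuation (τ y) ≠ V.valuation (algebraMap L M y)) :
    ∃ z : K, V.valuation (algebraMap L M y) = V.valuation (algebraMap K M z) := by
  classical
  have hint : IsIntegral K y := Algebra.IsIntegral.isIntegral y
  have hsep : ((minpoly K y).map (algebraMap K M)).Separable :=
    Polynomial.Separable.map (Algebra.IsSeparable.isSeparable K y)
  have hprod := (IsAlgClosed.splits ((minpoly K y).map (algebraMap K M))).eq_prod_roots_of_monic
    ((minpoly.monic hint).map _)
  have hnd := nodup_roots hsep
  have hroot : ∀ σ, σ ∈ ((minpoly K y).map (algebraMap K M)).roots ↔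
      ∃ τ : L →ₐ[K] M, τ y = σ := by
    intro σ
    have := Set.ext_iff.1 (Algebra.IsAlgebraic.range_eval_eq_rootSet_minpoly (F := K) M y) σ
    rw [mem_rootSet_of_ne (minpoly.ne_zero hint)] at this
    rw [mem_roots ((minpoly.monic hint).map _).ne_zero, IsRoot, eval_map_algebraMap, ← this]
    rfl
  have hymem : algebraMap L M y ∈ ((minpoly K y).map (algebraMap K M)).roots :=
    (hroot _).2 ⟨IsScalarTower.toAlgHom K L M, rfl⟩
  obtain ⟨s, hs⟩ := Multiset.exists_cons_of_mem hymem
  refine exists_valuation_eq_of_roots V (by simpa using hy) (minpoly K y) s ?_ ?_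
  · rw [hs, Multiset.map_cons, Multiset.prod_cons] at hprod
    rw [hprod, mul_comm]
  · intro σ hσ
    obtain ⟨τ, rfl⟩ := (hroot σ).1 (by rw [hs]; exact Multiset.mem_cons_of_mem hσ)
    refine hV τ ?_
    rintro rfl
    rw [hs, Multiset.nodup_cons] at hnd
    exact hnd.1 hσ

namespace IsSimpleRootGenerator

variable {P : w[X]} {a : K} {α : L}

/-- Were another conjugate `τ α = α + δ` also close to `a`, the expansion `0 = P(α + δ) = P'(α)δ +
kδ²` would give `P'(α) = -kδ`. The right side has value below `1`, whereas `P'(α)` is a unit. -/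
theorem one_le_valuation_of_ne (H : IsSimpleRootGenerator w P a α) (hW : Extends w W)
    (hα : α ∈ W) (hres : res W α = res W (algebraMap K L a)) {M : Type*} [Field M] [Algebra K M]
    [Algebra L M] [IsScalarTower K L M] {V : ValuationSubring M} (hV : Extends W V)
    (τ : L →ₐ[K] M) (hτ : τ α ≠ algebraMap L M α) :
    1 ≤ V.valuation (τ (α - algebraMap K L a)) := by
  by_contra hlt
  rw [not_le] at hlt
  have hKV : Extends w V := hW.trans hV
  have ha := hKV.mem_iff.2 H.mem
  have hαV : algebraMap L M α ∈ V := hV.mem_iff.2 hα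
  rw [map_sub, τ.commutes] at hlt
  have hαa : V.valuation (algebraMap L M α - algebraMap K M a) < 1 := by
    rw [IsScalarTower.algebraMap_apply K L M, ← map_sub, hV.valuation_lt_one_iff,
      ← res_eq_res_iff hα (hW.mem_iff.2 H.mem), hres]
  set δ := τ α - algebraMap L M α with hδ
  have hδlt : V.valuation δ < 1 := by
    have : δ = (τ α - algebraMap K M a) - (algebraMap L M α - algebraMap K M a) := by ring
    rw [this]
    exact Valuation.map_sub_lt _ hlt hαa
  have hδV := mem_of_valuation_lt_one hδlt
  obtain ⟨k, hk⟩ := binomExpansion (P.map (ringMap hKV)) ⟨_, hαV⟩ ⟨δ, hδV⟩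
  have hcoe : ∀ (R : w[X]) (x : V), (((R.map (ringMap hKV)).eval x : V) : M) = aeval (x : M) R := by
    intro R x
    rw [eval_map, aeval_def, ← ValuationSubring.coe_subtype, hom_eval₂]
    rfl
  have hk' := congrArg (Subtype.val : V → M) hk
  have e1 : aeval (algebraMap L M α) P = 0 := by
    rw [aeval_algebraMap_apply, H.root, map_zero]
  have e2 : aeval (algebraMap L M α + δ) P = 0 := by
    have h3 : algebraMap L M α + δ = τ α := by rw [hδ]; ring
    rw [h3, ← aeval_map_algebraMap K, aeval_algHom_apply, aeval_map_algebraMap, H.root, map_zero]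
  rw [derivative_map] at hk'
  push_cast [hcoe] at hk'
  rw [e1, e2, zero_add] at hk'
  have h4 : aeval (algebraMap L M α) P.derivative = -((k : M) * δ) := by
    have : (aeval (algebraMap L M α) P.derivative + k * δ) * δ = 0 := by linear_combination -hk'
    linear_combination (mul_eq_zero.1 this).resolve_right (sub_ne_zero.2 hτ)
  have h5 : V.valuation (aeval (algebraMap L M α) P.derivative) = 1 := by
    rw [aeval_algebraMap_apply, hV.valuation_eq_one_iff, ← res_ne_zero_iff,
      res_aeval hW hα hres H.mem, ← derivative_map]
    exact (_root_.map_ne_zero _).2 H.eval_derivative_res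
  rw [h4, Valuation.map_neg, mul_comm, map_mul] at h5
  exact (mul_lt_one_of_lt_of_le hδlt (mem_iff_valuation_le_one.1 k.2)).ne h5

/-- The element `u = α - a` has value below `1`, but all its nontrivial conjugates have value at
least `1`. For a suitable `N` the value of `y u^N` differs from those of its conjugates too. Then
the values of `u` and of `y u^N` both come from `K`, and so does that of `y`. -/
theorem exists_valuation_eq (H : IsSimpleRootGenerator w P a α) (hW : Extends w W)
    (hα : α ∈ W) (hres : res W α = res W (algebraMap K L a)) (y : L) :
    ∃ z : K, W.valuation y = W.valuation (algebraMap K L z) := by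
  rcases eq_or_ne y 0 with rfl | hy
  · exact ⟨0, by simp⟩
  rcases eq_or_ne α (algebraMap K L a) with rfl | hαa
  · have hbot : (⊥ : IntermediateField K L) = ⊤ := by
      rw [← H.adjoin, eq_comm, IntermediateField.adjoin_simple_eq_bot_iff]
      exact IntermediateField.algebraMap_mem _ a
    obtain ⟨z, rfl⟩ := IntermediateField.mem_bot.1 (hbot ▸ (IntermediateField.mem_top (x := y)))
    exact ⟨z, rfl⟩
  have := H.finiteDimensional
  have := H.isSeparable
  let M := AlgebraicClosure L
  obtain ⟨V, hV⟩ := ResidueReduction.exists_extends L M W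
  set u := α - algebraMap K L a with hu
  have hu0 : u ≠ 0 := sub_ne_zero.2 hαa
  have hu1 : V.valuation (algebraMap L M u) < 1 := by
    rw [hV.valuation_lt_one_iff, hu, ← res_eq_res_iff hα (hW.mem_iff.2 H.mem), hres]
  have hτu : ∀ τ : L →ₐ[K] M, τ ≠ IsScalarTower.toAlgHom K L M →
      V.valuation (algebraMap L M u) < V.valuation (τ u) := by
    intro τ hτ
    refine hu1.trans_le (H.one_le_valuation_of_ne hW hα hres hV τ fun h => hτ ?_)
    have : (τ : L →ₐ[K] M).comp (⊤ : IntermediateField K L).val =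
        (IsScalarTower.toAlgHom K L M).comp (⊤ : IntermediateField K L).val := by
      rw [← H.adjoin]
      refine IntermediateField.algHom_ext_of_eq_adjoin _ rfl ?_
      rintro x hx
      rw [Set.mem_singleton_iff] at hx
      subst hx
      exact h
    ext x
    exact DFunLike.congr_fun this ⟨x, IntermediateField.mem_top⟩
  obtain ⟨z₁, hz₁⟩ := exists_valuation_eq_of_algHom V hu0 fun τ hτ => (hτu τ hτ).ne'
  -- Each of the finitely many nontrivial embeddings excludes at most one exponent, because `τ u`
  -- and `u` have different values.
  obtain ⟨N, hN⟩ : ∃ N : ℕ, N ∉ ⋃ τ ∈ {τ : L →ₐ[K] M | τ ≠ IsScalarTower.toAlgHom K L M},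
      {N : ℕ | V.valuation (τ (y * u ^ N)) = V.valuation (algebraMap L M (y * u ^ N))} := by
    refine Set.Finite.exists_notMem (Set.Finite.biUnion (Set.toFinite _) fun τ hτ =>
      Set.Subsingleton.finite ?_)
    have hlt := hτu τ hτ
    have key : ∀ m n : ℕ, m < n →
        V.valuation (τ (y * u ^ m)) = V.valuation (algebraMap L M (y * u ^ m)) →
        V.valuation (τ (y * u ^ n)) = V.valuation (algebraMap L M (y * u ^ n)) → False := by
      intro m n hmn hm hn
      obtain ⟨d, rfl⟩ := Nat.exists_eq_add_of_lt hmn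
      have hne : V.valuation (algebraMap L M (y * u ^ m)) ≠ 0 := by simp [hy, hu0]
      rw [add_assoc, pow_add, ← mul_assoc, map_mul τ (y * u ^ m), map_mul (algebraMap L M) (y * u ^ m),
        map_mul V.valuation (τ (y * u ^ m)), map_mul V.valuation (algebraMap L M (y * u ^ m)),
        hm] at hn
      have := mul_left_cancel₀ hne hn
      rw [map_pow, map_pow, map_pow, map_pow] at this
      exact (pow_lt_pow_left₀ hlt zero_le (Nat.succ_ne_zero d)).ne' this
    intro m hm n hn
    rcases lt_trichotomy m n with h | h | h
    · exact (key m n h hm hn).elim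
    · exact h
    · exact (key n m h hn hm).elim
  obtain ⟨z₂, hz₂⟩ := exists_valuation_eq_of_algHom V (mul_ne_zero hy (pow_ne_zero N hu0))
    fun τ hτ h => hN (Set.mem_biUnion (show τ ∈ {τ | _} from hτ) h)
  refine ⟨z₂ / z₁ ^ N, hV.valuation_eq_iff.1 ?_⟩
  rw [← IsScalarTower.algebraMap_apply, map_div₀, map_div₀, ← hz₂, map_pow, map_pow, ← hz₁,
    map_mul, map_pow, map_mul, map_pow, mul_div_cancel_right₀]
  exact pow_ne_zero _ (by simpa using hu0)

end IsSimpleRootGenerator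

end ValueGroup

/-! ### Principal units -/

section PrincipalUnits

variable {N : Type*} [Field N] {W : ValuationSubring N} {x y : N}

theorem valuation_eq_of_sub_lt (h : W.valuation (x - y) < W.valuation y) :
    W.valuation x = W.valuation y := by
  have := Valuation.map_add_eq_of_lt_right W.valuation h
  rwa [sub_add_cancel] at this

theorem valuation_eq_one_of_sub_one_lt (h : W.valuation (x - 1) < 1) : W.valuation x = 1 := by
  have := valuation_eq_of_sub_lt (W := W) (x := x) (y := 1) (by rwa [map_one])
  rwa [map_one] at this

theorem res_eq_one_iff (hx : x ∈ W) : res W x = 1 ↔ W.valuation (x - 1) < 1 := by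
  rw [← res_one (v := W), res_eq_res_iff hx W.one_mem]

theorem mul_sub_one_lt (hx : W.valuation (x - 1) < 1) (hy : W.valuation (y - 1) < 1) :
    W.valuation (x * y - 1) < 1 := by
  have : x * y - 1 = (x - 1) * y + (y - 1) := by ring
  rw [this]
  refine Valuation.map_add_lt _ ?_ hy
  rw [map_mul, valuation_eq_one_of_sub_one_lt hy, mul_one]
  exact hx

theorem inv_sub_one_lt (hx : W.valuation (x - 1) < 1) : W.valuation (x⁻¹ - 1) < 1 := by
  have hx1 := valuation_eq_one_of_sub_one_lt hx
  have hx0 : x ≠ 0 := by rintro rfl; simp at hx1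
  have : x⁻¹ - 1 = -((x - 1) * x⁻¹) := by field_simp; ring
  rw [this, Valuation.map_neg, map_mul, map_inv₀, hx1]
  simpa using hx

theorem div_sub_one_lt_iff (hy : y ≠ 0) :
    W.valuation (x / y - 1) < 1 ↔ W.valuation (x - y) < W.valuation y := by
  have hy' : 0 < W.valuation y := zero_lt_iff.2 (by simpa using hy)
  rw [div_sub_one hy, map_div₀, div_lt_one₀ hy']

end PrincipalUnits

/-! ### Key polynomials and expansions without cancellation -/

section KeyPolynomials

variable {K N : Type*} [Field K] [Field N] [Algebra K N]

/-- `P` is a key polynomial: a polynomial of least degree for which `P(Z)` does not lie in the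
group `T`, with a refinement `W₁` of `W` in which `P(Z)` is infinitely large compared to `T`. -/
structure IsKeyPolynomial (W W₁ : ValuationSubring N) (T : N → Prop) (Z : N) (P : K[X]) :
    Prop where
  le : W₁ ≤ W
  mul : ∀ x y, T x → T y → T (x * y)
  inv : ∀ x, T x → T x⁻¹
  principal : ∀ x, W.valuation (x - 1) < 1 → T x
  transcendental : Transcendental K Z
  natDegree_pos : 0 < P.natDegree
  mem : ∀ G : K[X], G ≠ 0 → G.natDegree < P.natDegree → T (aeval Z G)
  gt : ∀ u t, T u → 0 < t → W.valuation (u * aeval Z P ^ t) = 1 →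
    1 < W₁.valuation (u * aeval Z P ^ t)

theorem valuation_le_of_le {W W₁ : ValuationSubring N} (h : W₁ ≤ W) {x y : N}
    (hxy : W₁.valuation x ≤ W₁.valuation y) : W.valuation x ≤ W.valuation y := by
  rw [← ValuationSubring.mapOfLE_valuation_apply W₁ W h,
    ← ValuationSubring.mapOfLE_valuation_apply W₁ W h]
  exact ValuationSubring.monotone_mapOfLE W₁ W h hxy

namespace IsKeyPolynomial

variable {W W₁ : ValuationSubring N} {T : N → Prop} {Z : N} {P : K[X]}

theorem ne_zero (H : IsKeyPolynomial W W₁ T Z P) : P ≠ 0 := by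
  rintro rfl; simpa using H.natDegree_pos

theorem aeval_ne_zero (H : IsKeyPolynomial W W₁ T Z P) {G : K[X]} (hG : G ≠ 0) :
    aeval Z G ≠ 0 := fun h => H.transcendental ⟨G, hG, h⟩

theorem valuation_ne (H : IsKeyPolynomial W W₁ T Z P) {u : N} (hu : T u) {t : ℕ} (ht : 0 < t) :
    W₁.valuation (u * aeval Z P ^ t) ≠ 1 := by
  intro h
  have h1 : W.valuation (u * aeval Z P ^ t) = 1 := by
    refine le_antisymm ?_ ?_
    · simpa using valuation_le_of_le H.le (x := u * aeval Z P ^ t) (y := 1) (by simpa using h.le)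
    · simpa using valuation_le_of_le H.le (x := 1) (y := u * aeval Z P ^ t) (by simpa using h.ge)
  exact (H.gt u t hu ht h1).ne' h

theorem notMem (H : IsKeyPolynomial W W₁ T Z P) : ¬ T (aeval Z P) := by
  intro h
  refine H.valuation_ne (H.inv _ h) one_pos ?_
  rw [pow_one, inv_mul_cancel₀ (H.aeval_ne_zero H.ne_zero), map_one]

theorem irreducible (H : IsKeyPolynomial W W₁ T Z P) : Irreducible P := by
  refine ⟨fun h => H.natDegree_pos.ne' (natDegree_eq_zero_of_isUnit h), fun a b hab => ?_⟩
  by_contra hcon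
  push Not at hcon
  have ha0 : a ≠ 0 := by rintro rfl; exact H.ne_zero (by simpa using hab)
  have hb0 : b ≠ 0 := by rintro rfl; exact H.ne_zero (by simpa using hab)
  have hpos : ∀ c : K[X], c ≠ 0 → ¬ IsUnit c → 0 < c.natDegree := fun c hc0 hc =>
    Nat.pos_of_ne_zero fun h => hc (isUnit_iff_degree_eq_zero.2 (by
      rw [degree_eq_natDegree hc0, h]; rfl))
  have ha := hpos a ha0 hcon.1
  have hb := hpos b hb0 hcon.2
  have hd : P.natDegree = a.natDegree + b.natDegree := by rw [hab, natDegree_mul ha0 hb0]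
  apply H.notMem
  rw [hab, map_mul]
  exact H.mul _ _ (H.mem a ha0 (by omega)) (H.mem b hb0 (by omega))

/-- The terms of a `P`-adic expansion are bounded by the sum. -/
theorem valuation_term_le (H : IsKeyPolynomial W W₁ T Z P) (s : Finset ℕ) (G : ℕ → K[X])
    (hG : ∀ i, (G i).natDegree < P.natDegree) {i : ℕ} (hi : i ∈ s) :
    W.valuation (aeval Z (G i) * aeval Z P ^ i) ≤
      W.valuation (∑ j ∈ s, aeval Z (G j) * aeval Z P ^ j) := by
  classical
  set f : ℕ → N := fun i => aeval Z (G i) * aeval Z P ^ i with hf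
  have hP0 := H.aeval_ne_zero H.ne_zero
  -- The nonzero terms have pairwise distinct `W₁`-values, since a quotient of two of them has the
  -- form `u P(Z)^t` with `u ∈ T` and `t > 0`. So for `W₁` the largest term gives the value of the
  -- sum, and the inequality passes to the coarser ring `W`.
  obtain ⟨m, hm, hmax⟩ := s.exists_max_image (fun i => W₁.valuation (f i)) ⟨i, hi⟩
  refine valuation_le_of_le H.le ((hmax i hi).trans ?_)
  by_cases hm0 : f m = 0
  · simp [hm0]
  refine (Valuation.map_sum_eq_of_lt W₁.valuation (f := f) hm fun j hj => ?_).ge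
  obtain ⟨hjs, hjm⟩ := Finset.mem_sdiff.1 hj
  rw [Finset.mem_singleton] at hjm
  refine lt_of_le_of_ne (hmax j hjs) fun heq => ?_
  have hGne : ∀ i, f i ≠ 0 → G i ≠ 0 := by
    rintro i hi h; exact hi (by simp [hf, h])
  have hj0 : f j ≠ 0 := by
    intro h; rw [h, map_zero, eq_comm] at heq; simp [hm0] at heq
  have key : ∀ a b, f a ≠ 0 → f b ≠ 0 → a < b → W₁.valuation (f b) ≠ W₁.valuation (f a) := by
    intro a b ha hb hab h
    have hGa := H.aeval_ne_zero (hGne a ha)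
    refine H.valuation_ne (H.mul _ _ (H.mem _ (hGne b hb) (hG b))
      (H.inv _ (H.mem _ (hGne a ha) (hG a)))) (Nat.sub_pos_of_lt hab) ?_
    have : aeval Z (G b) * (aeval Z (G a))⁻¹ * aeval Z P ^ (b - a) = f b / f a := by
      simp only [hf]
      rw [pow_sub₀ _ hP0 hab.le]
      field_simp
    rw [this, map_div₀, h, div_self (by simpa using ha)]
  rcases lt_or_gt_of_ne hjm with hlt | hgt
  · exact key j m hj0 hm0 hlt heq.symm
  · exact key m j hm0 hj0 hgt heq

/-- Put `AB = PQ + D`. Both `AB` and `D`, if nonzero, have values at `Z` in the group `T`, and so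
does `Q`. For `W₁` the element `PQ` cannot exceed `AB`, or else `D` would share its value, which no
element of `T` does. For `W` it cannot equal `AB` in value, or else `PQ` would be the larger for
`W₁`. So `PQ` is negligible and reduction modulo `P` costs only a principal unit. -/
theorem mul_sub_mod_lt (H : IsKeyPolynomial W W₁ T Z P) {A B : K[X]} (hA0 : A ≠ 0) (hB0 : B ≠ 0)
    (hA : A.natDegree < P.natDegree) (hB : B.natDegree < P.natDegree) :
    (A * B) % P ≠ 0 ∧
    W.valuation (aeval Z A * aeval Z B / aeval Z ((A * B) % P) - 1) < 1 := by
  set D := (A * B) % P with hD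
  set Q := (A * B) / P with hQ
  have hdiv : P * Q + D = A * B := EuclideanDomain.div_add_mod _ _
  have hdivZ : aeval Z P * aeval Z Q + aeval Z D = aeval Z A * aeval Z B := by
    rw [← map_mul, ← map_mul, ← map_add, hdiv]
  have hAB : A * B ≠ 0 := mul_ne_zero hA0 hB0
  have hDdeg : D.natDegree < P.natDegree := natDegree_mod_lt _ H.natDegree_pos.ne'
  rcases eq_or_ne Q 0 with hQ0 | hQ0
  · rw [hQ0, mul_zero, zero_add] at hdiv
    rw [hQ0, map_zero, mul_zero, zero_add] at hdivZ
    refine ⟨hdiv ▸ hAB, ?_⟩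
    rw [← hdivZ, div_self (H.aeval_ne_zero (hdiv ▸ hAB))]
    simp
  have hQdeg : Q.natDegree < P.natDegree := by
    have h1 : (P * Q).natDegree = P.natDegree + Q.natDegree := natDegree_mul H.ne_zero hQ0
    have h2 : P * Q = A * B - D := by rw [← hdiv]; ring
    have h3 : (A * B - D).natDegree ≤ max (A * B).natDegree D.natDegree := natDegree_sub_le _ _
    rw [natDegree_mul hA0 hB0, ← h2, h1] at h3
    rcases le_max_iff.1 h3 with h | h <;> omega
  have hTQ := H.mem Q hQ0 hQdeg
  have hTAB : T (aeval Z A * aeval Z B) := H.mul _ _ (H.mem A hA0 hA) (H.mem B hB0 hB)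
  have hABZ : aeval Z A * aeval Z B ≠ 0 :=
    mul_ne_zero (H.aeval_ne_zero hA0) (H.aeval_ne_zero hB0)
  have cmp : ∀ x, T x → x ≠ 0 → W₁.valuation (aeval Z P * aeval Z Q) ≠ W₁.valuation x ∧
      (W.valuation (aeval Z P * aeval Z Q) = W.valuation x →
        W₁.valuation x < W₁.valuation (aeval Z P * aeval Z Q)) := by
    intro x hx hx0
    have e : aeval Z Q * x⁻¹ * aeval Z P ^ 1 = aeval Z P * aeval Z Q / x := by
      rw [pow_one]; field_simp
    have hTx := H.mul _ _ hTQ (H.inv _ hx)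
    have hx1 : 0 < W₁.valuation x := zero_lt_iff.2 (by simpa using hx0)
    constructor
    · intro h
      refine H.valuation_ne hTx one_pos ?_
      rw [e, map_div₀, h, div_self hx1.ne']
    · intro h
      have := H.gt _ 1 hTx one_pos (by rw [e, map_div₀, h, div_self (by simpa using hx0)])
      rwa [e, map_div₀, one_lt_div₀ hx1] at this
  have hlt : W₁.valuation (aeval Z P * aeval Z Q) < W₁.valuation (aeval Z A * aeval Z B) := by
    refine lt_of_le_of_ne (not_lt.1 fun hgt => ?_) (cmp _ hTAB hABZ).1
    have hDv : W₁.valuation (aeval Z D) = W₁.valuation (aeval Z P * aeval Z Q) := by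
      rw [show aeval Z D = aeval Z A * aeval Z B - aeval Z P * aeval Z Q by rw [← hdivZ]; ring]
      exact Valuation.map_sub_eq_of_lt_right _ hgt
    have hD0 : aeval Z D ≠ 0 := by
      intro h
      rw [h, map_zero] at hDv
      rw [← hDv] at hgt
      exact not_lt_zero hgt
    have hD0' : D ≠ 0 := by rintro h; exact hD0 (by rw [h, map_zero])
    exact (cmp _ (H.mem D hD0' hDdeg) hD0).1 hDv.symm
  have hlt' : W.valuation (aeval Z P * aeval Z Q) < W.valuation (aeval Z A * aeval Z B) :=
    lt_of_le_of_ne (valuation_le_of_le H.le hlt.le) fun h =>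
      lt_asymm hlt ((cmp _ hTAB hABZ).2 h)
  have hDv : W.valuation (aeval Z D) = W.valuation (aeval Z A * aeval Z B) := by
    rw [show aeval Z D = aeval Z A * aeval Z B - aeval Z P * aeval Z Q by rw [← hdivZ]; ring]
    exact Valuation.map_sub_eq_of_lt_left _ hlt'
  have hD0 : aeval Z D ≠ 0 := by
    intro h
    rw [h, map_zero, eq_comm] at hDv
    simp [H.aeval_ne_zero hA0, H.aeval_ne_zero hB0] at hDv
  refine ⟨fun h => hD0 (by rw [h, map_zero]), ?_⟩
  rw [div_sub_one_lt_iff hD0, hDv, ← hdivZ, add_sub_cancel_right, hdivZ]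
  exact hlt'

/-- As `P` is irreducible, `A` is invertible modulo `P`; the reduced inverse is an inverse up to a
principal unit by `mul_sub_mod_lt`. -/
theorem exists_mul_sub_one_lt (H : IsKeyPolynomial W W₁ T Z P) {A : K[X]} (hA0 : A ≠ 0)
    (hA : A.natDegree < P.natDegree) : ∃ B : K[X], B ≠ 0 ∧ B.natDegree < P.natDegree ∧
      W.valuation (aeval Z A * aeval Z B - 1) < 1 := by
  have hcop : IsCoprime A P := by
    rw [isCoprime_comm, H.irreducible.coprime_iff_not_dvd]
    exact fun h => absurd (natDegree_le_of_dvd h hA0) (not_le.2 hA)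
  obtain ⟨a, b, hab⟩ := hcop
  have hmod : (A * (a % P)) % P = 1 := by
    have h1 : A * (a % P) = 1 + P * (-(b + A * (a / P))) := by
      rw [EuclideanDomain.mod_eq_sub_mul_div]
      linear_combination hab
    rw [h1, Polynomial.add_mod, EuclideanDomain.mod_eq_zero.2 (dvd_mul_right P _), add_zero]
    exact (Polynomial.mod_eq_self_iff H.ne_zero).2
      (by rw [degree_one]; exact natDegree_pos_iff_degree_pos.1 H.natDegree_pos)
  have hB0 : a % P ≠ 0 := by
    intro h; rw [h, mul_zero, EuclideanDomain.zero_mod] at hmod; exact zero_ne_one hmod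
  have hBdeg : (a % P).natDegree < P.natDegree := natDegree_mod_lt _ H.natDegree_pos.ne'
  refine ⟨a % P, hB0, hBdeg, ?_⟩
  have := (H.mul_sub_mod_lt hA0 hB0 hA hBdeg).2
  rwa [hmod, map_one, div_one] at this

/-- The elements of the form `G(Z) (1 + m)` with `deg G < deg P` and `m` in the maximal ideal. -/
def approx (W : ValuationSubring N) (Z : N) (P : K[X]) (u : N) : Prop :=
  ∃ G : K[X], G ≠ 0 ∧ G.natDegree < P.natDegree ∧ W.valuation (u / aeval Z G - 1) < 1

theorem approx_aeval (H : IsKeyPolynomial W W₁ T Z P) {G : K[X]} (hG0 : G ≠ 0)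
    (hG : G.natDegree < P.natDegree) : approx W Z P (aeval Z G) :=
  ⟨G, hG0, hG, by simp [div_self (H.aeval_ne_zero hG0)]⟩

/-- The degree of `G G'` may reach `deg P`; reducing modulo `P` restores the bound within the same
class of principal units. With `approx_inv` this makes `approx` a group. -/
theorem approx_mul (H : IsKeyPolynomial W W₁ T Z P) {u u' : N} (hu : approx W Z P u)
    (hu' : approx W Z P u') : approx W Z P (u * u') := by
  obtain ⟨G, hG0, hG, hu⟩ := hu
  obtain ⟨G', hG0', hG', hu'⟩ := hu'
  obtain ⟨hD0, hD⟩ := H.mul_sub_mod_lt hG0 hG0' hG hG'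
  refine ⟨_, hD0, natDegree_mod_lt _ H.natDegree_pos.ne', ?_⟩
  have := mul_sub_one_lt (mul_sub_one_lt hu hu') hD
  rwa [div_mul_div_comm, div_mul_div_cancel₀
    (mul_ne_zero (H.aeval_ne_zero hG0) (H.aeval_ne_zero hG0'))] at this

theorem approx_inv (H : IsKeyPolynomial W W₁ T Z P) {u : N} (hu : approx W Z P u) :
    approx W Z P u⁻¹ := by
  obtain ⟨G, hG0, hG, hu⟩ := hu
  obtain ⟨B, hB0, hB, hGB⟩ := H.exists_mul_sub_one_lt hG0 hG
  refine ⟨B, hB0, hB, ?_⟩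
  have := mul_sub_one_lt (inv_sub_one_lt hu) (inv_sub_one_lt hGB)
  have hG' := H.aeval_ne_zero hG0
  convert this using 3
  field_simp

theorem approx_one (H : IsKeyPolynomial W W₁ T Z P) : approx W Z P 1 := by
  have := H.approx_aeval (G := 1) one_ne_zero (by rw [natDegree_one]; exact H.natDegree_pos)
  rwa [map_one] at this

theorem approx_pow (H : IsKeyPolynomial W W₁ T Z P) {u : N} (hu : approx W Z P u) (n : ℕ) :
    approx W Z P (u ^ n) := by
  induction n with
  | zero => rw [pow_zero]; exact H.approx_one
  | succ n ih => rw [pow_succ]; exact H.approx_mul ih hu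

theorem approx_zpow (H : IsKeyPolynomial W W₁ T Z P) {u : N} (hu : approx W Z P u) (n : ℤ) :
    approx W Z P (u ^ n) := by
  cases n with
  | ofNat n => rw [Int.ofNat_eq_natCast, zpow_natCast]; exact H.approx_pow hu n
  | negSucc n => rw [zpow_negSucc]; exact H.approx_inv (H.approx_pow hu _)

theorem approx_mem (H : IsKeyPolynomial W W₁ T Z P) {u : N} (hu : approx W Z P u) : T u := by
  obtain ⟨G, hG0, hG, hu⟩ := hu
  have := H.mul _ _ (H.principal _ hu) (H.mem G hG0 hG)
  rwa [div_mul_cancel₀ _ (H.aeval_ne_zero hG0)] at this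

theorem exists_expansion (H : IsKeyPolynomial W W₁ T Z P) (F : K[X]) :
    ∃ (m : ℕ) (G : ℕ → K[X]), (∀ i, (G i).natDegree < P.natDegree) ∧
      F = ∑ i ∈ Finset.range m, G i * P ^ i := by
  induction hd : F.natDegree using Nat.strong_induction_on generalizing F with
  | _ d ih =>
    rcases eq_or_ne (F / P) 0 with h0 | h0
    · refine ⟨1, fun _ => F % P, fun _ => natDegree_mod_lt _ H.natDegree_pos.ne', ?_⟩
      have := EuclideanDomain.div_add_mod F P
      rw [h0, mul_zero, zero_add] at this
      simp [this]
    · have hdiv := EuclideanDomain.div_add_mod F P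
      have hlt : (F / P).natDegree < F.natDegree := by
        refine natDegree_lt_natDegree h0 (degree_div_lt ?_
          (natDegree_pos_iff_degree_pos.1 H.natDegree_pos))
        rintro rfl
        exact h0 (EuclideanDomain.zero_div)
      obtain ⟨m, G, hG, hFG⟩ := ih _ (hd ▸ hlt) (F / P) rfl
      refine ⟨m + 1, fun i => Nat.casesOn i (F % P) G, ?_, ?_⟩
      · intro i
        cases i with
        | zero => exact natDegree_mod_lt _ H.natDegree_pos.ne'
        | succ i => exact hG i
      · rw [Finset.sum_range_succ']
        conv_lhs => rw [← hdiv, hFG, Finset.mul_sum]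
        simp only [pow_zero, mul_one]
        congr 1
        exact Finset.sum_congr rfl fun i _ => by ring

end IsKeyPolynomial

end KeyPolynomials

/-! ### Lifting linearly independent residues -/

section LinearIndependence

variable {E L : Type*} [Field E] [Field L] [Algebra E L] {v : ValuationSubring E}
  {W : ValuationSubring L} [Algebra (Res v) (Res W)]

/-- If the residues of the `y i` are linearly independent, then the value of a linear combination
of the `y i` is the largest value of the coefficients. -/
theorem Extends.valuation_coeff_le (h : Extends v W)
    (hφ : ∀ a, algebraMap (Res v) (Res W) a = resMap h a) {ι : Type*} [Fintype ι] (y : ι → L)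
    (hy : ∀ i, y i ∈ W) (hli : LinearIndependent (Res v) fun i => res W (y i)) (c : ι → E) (j : ι) :
    W.valuation (algebraMap E L (c j)) ≤ W.valuation (∑ i, algebraMap E L (c i) * y i) := by
  obtain ⟨m, -, hmax⟩ := Finset.univ.exists_max_image (fun i => v.valuation (c i)) ⟨j, by simp⟩
  refine (h.valuation_le_iff.2 (hmax j (by simp))).trans ?_
  by_contra hlt
  rw [not_le] at hlt
  have hm0 : c m ≠ 0 := by
    intro h0; rw [h0, map_zero, map_zero] at hlt; exact not_lt_zero hlt
  have hm' : 0 < W.valuation (algebraMap E L (c m)) := zero_lt_iff.2 (by simpa using hm0)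
  have hc : ∀ i, c i / c m ∈ v := fun i => by
    rw [mem_iff_valuation_le_one, map_div₀, div_le_one₀ (zero_lt_iff.2 (by simpa using hm0))]
    exact hmax i (by simp)
  have hterm : ∀ i, algebraMap E L (c i / c m) * y i ∈ W := fun i =>
    W.mul_mem _ _ (h.mem_iff.2 (hc i)) (hy i)
  have hsum : res W (∑ i, algebraMap E L (c i / c m) * y i) = 0 := by
    rw [res_eq_zero_iff (sum_mem fun i _ => hterm i)]
    have : ∑ i, algebraMap E L (c i / c m) * y i =
        (∑ i, algebraMap E L (c i) * y i) / algebraMap E L (c m) := by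
      rw [Finset.sum_div]
      exact Finset.sum_congr rfl fun i _ => by rw [map_div₀]; ring
    rw [this, map_div₀, div_lt_one₀ hm']
    exact hlt
  rw [res_sum _ _ fun i _ => hterm i] at hsum
  have hz := Fintype.linearIndependent_iff.1 hli (fun i => res v (c i / c m)) (by
    rw [← hsum]
    refine Finset.sum_congr rfl fun i _ => ?_
    rw [Algebra.smul_def, hφ, h.resMap_res (hc i), res_mul (h.mem_iff.2 (hc i)) (hy i)]) m
  rw [div_self hm0, res_one] at hz
  exact one_ne_zero hz

theorem Extends.exists_valuation_sum_eq (h : Extends v W)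
    (hφ : ∀ a, algebraMap (Res v) (Res W) a = resMap h a) {ι : Type*} [Fintype ι] [Nonempty ι]
    (y : ι → L) (hy : ∀ i, y i ∈ W) (hli : LinearIndependent (Res v) fun i => res W (y i))
    (c : ι → E) :
    ∃ j, W.valuation (∑ i, algebraMap E L (c i) * y i) = W.valuation (algebraMap E L (c j)) := by
  have hle := h.valuation_coeff_le hφ y hy hli c
  by_contra hcon
  push Not at hcon
  have hlt := fun i => lt_of_le_of_ne (hle i) (hcon i).symm
  have h0 : W.valuation (∑ i, algebraMap E L (c i) * y i) ≠ 0 :=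
    (zero_le.trans_lt (hlt (Classical.arbitrary ι))).ne'
  refine lt_irrefl _ (Valuation.map_sum_lt (s := Finset.univ) W.valuation h0 fun i _ => ?_)
  rw [map_mul]
  exact (mul_le_of_le_one_right' (mem_iff_valuation_le_one.1 (hy i))).trans_lt (hlt i)

theorem Extends.linearIndependent_of_res (h : Extends v W)
    (hφ : ∀ a, algebraMap (Res v) (Res W) a = resMap h a) {ι : Type*} [Fintype ι] (y : ι → L)
    (hy : ∀ i, y i ∈ W) (hli : LinearIndependent (Res v) fun i => res W (y i)) :
    LinearIndependent E y := by
  refine Fintype.linearIndependent_iff.2 fun c hc j => ?_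
  have := h.valuation_coeff_le hφ y hy hli c j
  simp only [Algebra.smul_def] at hc
  rw [hc, map_zero, le_zero_iff] at this
  simpa using this

end LinearIndependence

/-! ### The field of residues of polynomials of small degree -/

section ResidueField

variable {E K N : Type*} [Field E] [Field K] [Field N] [Algebra E K] [Algebra K N] [Algebra E N]
  [IsScalarTower E K N] {v : ValuationSubring E} {W W₁ : ValuationSubring N}
  {T : N → Prop} {Z : N} {P : K[X]}

namespace IsKeyPolynomial

theorem valuation_eq_one_of_approx {u g : N} (h : W.valuation (u / g - 1) < 1)
    (hu : W.valuation u = 1) : W.valuation g = 1 := by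
  have := valuation_eq_one_of_sub_one_lt h
  rw [map_div₀, hu, one_div] at this
  exact inv_eq_one.1 this

theorem res_eq_of_approx {u g : N} (h : W.valuation (u / g - 1) < 1)
    (hu : W.valuation u = 1) : res W u = res W g := by
  have hg := valuation_eq_one_of_approx h hu
  have hg0 : g ≠ 0 := by rintro rfl; simp at hg
  rw [res_eq_res_iff (mem_of_valuation_eq_one hu) (mem_of_valuation_eq_one hg)]
  rw [div_sub_one_lt_iff hg0, hg] at h
  exact h

/-- The residues of the `G(Z)` with `deg G < deg P`. -/
def residues (W : ValuationSubring N) (Z : N) (P : K[X]) : Set (Res W) :=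
  {b | ∃ G : K[X], G.natDegree < P.natDegree ∧ aeval Z G ∈ W ∧ res W (aeval Z G) = b}

theorem res_mem_residues {u : N} (hu : approx W Z P u) (hu1 : W.valuation u = 1) :
    res W u ∈ residues W Z P := by
  obtain ⟨G, -, hG, h⟩ := hu
  exact ⟨G, hG, mem_of_valuation_eq_one (valuation_eq_one_of_approx h hu1),
    (res_eq_of_approx h hu1).symm⟩

theorem exists_approx_of_mem_residues (H : IsKeyPolynomial W W₁ T Z P) {b : Res W}
    (hb : b ∈ residues W Z P) (hb0 : b ≠ 0) :
    ∃ u, approx W Z P u ∧ W.valuation u = 1 ∧ res W u = b := by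
  obtain ⟨G, hG, -, rfl⟩ := hb
  refine ⟨aeval Z G, H.approx_aeval ?_ hG, res_ne_zero_iff.1 hb0, rfl⟩
  rintro rfl
  simp at hb0

variable [Algebra (Res v) (Res W)]

/-- The residues of the `G(Z)` with `deg G < deg P` form a field. -/
def residueSubfield (H : IsKeyPolynomial W W₁ T Z P) (h : Extends v W)
    (hφ : ∀ a, algebraMap (Res v) (Res W) a = resMap h a) :
    IntermediateField (Res v) (Res W) where
  carrier := residues W Z P
  -- Sums keep the degree bound; products and inverses are brought back under it by the group
  -- `approx`.
  mul_mem' := by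
    intro a b ha hb
    rcases eq_or_ne a 0 with rfl | ha0
    · rwa [zero_mul]
    rcases eq_or_ne b 0 with rfl | hb0
    · rwa [mul_zero]
    obtain ⟨u, hu, hu1, rfl⟩ := H.exists_approx_of_mem_residues ha ha0
    obtain ⟨u', hu', hu1', rfl⟩ := H.exists_approx_of_mem_residues hb hb0
    rw [← res_mul (mem_of_valuation_eq_one hu1) (mem_of_valuation_eq_one hu1')]
    exact res_mem_residues (H.approx_mul hu hu') (by rw [map_mul, hu1, hu1', one_mul])
  add_mem' := by
    rintro _ _ ⟨G, hG, hGW, rfl⟩ ⟨G', hG', hGW', rfl⟩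
    refine ⟨G + G', (natDegree_add_le _ _).trans_lt (max_lt hG hG'), ?_, ?_⟩
    · rw [map_add]; exact add_mem hGW hGW'
    · rw [map_add, res_add hGW hGW']
  algebraMap_mem' := by
    intro a
    obtain ⟨x, hx, rfl⟩ := exists_res_eq a
    refine ⟨C (algebraMap E K x), by rw [natDegree_C]; exact H.natDegree_pos, ?_, ?_⟩
    · rw [aeval_C, ← IsScalarTower.algebraMap_apply]; exact h.mem_iff.2 hx
    · rw [aeval_C, ← IsScalarTower.algebraMap_apply, hφ, h.resMap_res hx]
  inv_mem' := by
    intro a ha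
    rcases eq_or_ne a 0 with rfl | ha0
    · rwa [inv_zero]
    obtain ⟨u, hu, hu1, rfl⟩ := H.exists_approx_of_mem_residues ha ha0
    rw [← res_inv hu1]
    exact res_mem_residues (H.approx_inv hu) (by rw [map_inv₀, hu1, inv_one])

theorem mem_residueSubfield (H : IsKeyPolynomial W W₁ T Z P) (h : Extends v W)
    (hφ : ∀ a, algebraMap (Res v) (Res W) a = resMap h a) {b : Res W} :
    b ∈ H.residueSubfield h hφ ↔ b ∈ residues W Z P := Iff.rfl

/-- Lifts of independent residues are independent over `E` among polynomials over `K` of degree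
below `deg P`, and these form a finite-dimensional `E`-space. -/
theorem finiteDimensional_residueSubfield [FiniteDimensional E K]
    (H : IsKeyPolynomial W W₁ T Z P) (h : Extends v W)
    (hφ : ∀ a, algebraMap (Res v) (Res W) a = resMap h a) :
    FiniteDimensional (Res v) (H.residueSubfield h hφ) := by
  have : FiniteDimensional K (degreeLT K P.natDegree) :=
    (degreeLTEquiv K P.natDegree).symm.finiteDimensional
  have : FiniteDimensional E (degreeLT K P.natDegree) := Module.Finite.trans K _
  have hrank : Module.rank (Res v) (H.residueSubfield h hφ) ≤
      (Module.finrank E (degreeLT K P.natDegree) : ℕ) := by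
    refine rank_le fun s hs => ?_
    choose G hG hGW hGres using fun b : s => (H.mem_residueSubfield h hφ).1 b.1.2
    have hli : LinearIndependent (Res v) fun b : s => res W (aeval Z (G b)) := by
      have : (fun b : s => res W (aeval Z (G b))) =
          (H.residueSubfield h hφ).val.toLinearMap ∘ fun b : s => b.1 := by
        funext b; exact hGres b
      rw [this]
      exact hs.map' _ (LinearMap.ker_eq_bot.2 (H.residueSubfield h hφ).val.injective)
    have hE := h.linearIndependent_of_res hφ _ hGW hli
    have hE' : LinearIndependent E fun b : s =>
        (⟨G b, mem_degreeLT.2 (degree_le_natDegree.trans_lt (Nat.cast_lt.2 (hG b)))⟩ :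
          degreeLT K P.natDegree) := by
      refine LinearIndependent.of_comp
        (((aeval Z).toLinearMap.comp (degreeLT K P.natDegree).subtype).restrictScalars E) ?_
      exact hE
    simpa using hE'.fintype_card_le_finrank
  exact Module.rank_lt_aleph0_iff.1 (hrank.trans_lt (Cardinal.natCast_lt_aleph0))

end IsKeyPolynomial

end ResidueField

/-! ### A single generator for the remaining residues -/

section ResidueGenerator

variable {E K N : Type*} [Field E] [Field K] [Field N] [Algebra E K] [Algebra K N] [Algebra E N]
  [IsScalarTower E K N] {v : ValuationSubring E} {W W₁ : ValuationSubring N}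
  {T : N → Prop} {Z : N} {P : K[X]}

namespace IsKeyPolynomial

/-- By `valuation_term_le` every term would otherwise be strictly smaller than the sum. Such a term
serves to normalize denominators. -/
theorem exists_valuation_eq_term (H : IsKeyPolynomial W W₁ T Z P) (m : ℕ) (G : ℕ → K[X])
    (hG : ∀ i, (G i).natDegree < P.natDegree) (hm : 0 < m) :
    ∃ i, W.valuation (aeval Z (G i) * aeval Z P ^ i) =
      W.valuation (∑ j ∈ Finset.range m, aeval Z (G j) * aeval Z P ^ j) := by
  by_contra hcon
  push Not at hcon
  have hlt : ∀ i ∈ Finset.range m, W.valuation (aeval Z (G i) * aeval Z P ^ i) <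
      W.valuation (∑ j ∈ Finset.range m, aeval Z (G j) * aeval Z P ^ j) := fun i hi =>
    lt_of_le_of_ne (H.valuation_term_le _ G hG hi) (hcon i)
  have h0 : W.valuation (∑ j ∈ Finset.range m, aeval Z (G j) * aeval Z P ^ j) ≠ 0 := by
    have := hlt 0 (Finset.mem_range.2 hm)
    exact (zero_le.trans_lt this).ne'
  exact lt_irrefl _ (Valuation.map_sum_lt W.valuation h0 hlt)

variable [Algebra (Res v) (Res W)]

/-- The residue field of `K(Z)` is generated by one element over the residues of the `G(Z)`,
`deg G < deg P`. -/
theorem exists_residue_generator (H : IsKeyPolynomial W W₁ T Z P) (h : Extends v W)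
    (hφ : ∀ a, algebraMap (Res v) (Res W) a = resMap h a)
    (htors : ∃ m, 0 < m ∧ ∃ a : E, W.valuation (algebraMap E N a * aeval Z P ^ m) = 1)
    (htr : ∀ u t, T u → 0 < t → W.valuation (u * aeval Z P ^ t) = 1 →
      Transcendental (Res v) (res W (u * aeval Z P ^ t))) :
    ∃ z : Res W, Transcendental (Res v) z ∧
      (∃ u ∈ IntermediateField.adjoin K {Z}, u ∈ W ∧ res W u = z) ∧
      ∀ u ∈ IntermediateField.adjoin K {Z}, u ∈ W →
        res W u ∈ IntermediateField.adjoin (H.residueSubfield h hφ) {z} := by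
  classical
  have hP0 := H.aeval_ne_zero H.ne_zero
  -- The least such `e` is the order of the value of `P(Z)` modulo the values of `approx`; it is
  -- finite because some power has a value from `E`.
  have hex : ∃ e, 0 < e ∧ ∃ u, approx W Z P u ∧ W.valuation (u * aeval Z P ^ e) = 1 := by
    obtain ⟨m, hm, a, ha⟩ := htors
    refine ⟨m, hm, algebraMap E N a, ?_, ha⟩
    have ha0 : a ≠ 0 := by rintro rfl; simp at ha
    have := H.approx_aeval (G := C (algebraMap E K a)) (by simpa using ha0)
      (by rw [natDegree_C]; exact H.natDegree_pos)
    rwa [aeval_C, ← IsScalarTower.algebraMap_apply] at this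
  set e := Nat.find hex
  obtain ⟨he, g, hg, hgv⟩ := Nat.find_spec hex
  have hmin : ∀ t, 0 < t → t < e → ∀ u, approx W Z P u → W.valuation (u * aeval Z P ^ t) ≠ 1 :=
    fun t ht hte u hu h1 => Nat.find_min hex hte ⟨ht, u, hu, h1⟩
  have hg0 : g ≠ 0 := by rintro rfl; simp at hgv
  set ζ := g * aeval Z P ^ e with hζ
  have hζ0 : ζ ≠ 0 := mul_ne_zero hg0 (pow_ne_zero _ hP0)
  have hsplit : ∀ (u : N) (t q : ℤ), u * aeval Z P ^ t =
      (u * g⁻¹ ^ q) * aeval Z P ^ (t - e * q) * ζ ^ q := by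
    intro u t q
    rw [hζ, mul_zpow, inv_zpow, zpow_sub₀ hP0, zpow_mul, zpow_natCast]
    field_simp
  have hζq : ∀ q : ℤ, W.valuation (ζ ^ q) = 1 := fun q => by rw [map_zpow₀, hgv, one_zpow]
  -- Dividing `t` by `e` leaves a unit with exponent `t % e`, which minimality of `e` forces to be
  -- `0`.
  have hdvd : ∀ (t : ℤ) u, approx W Z P u → W.valuation (u * aeval Z P ^ t) = 1 → (e : ℤ) ∣ t := by
    intro t u hu h1
    rw [hsplit u t (t / e), map_mul, hζq, mul_one] at h1
    have hmod : t - e * (t / e) = t % e := by rw [Int.emod_def]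
    rw [hmod] at h1
    have hpos := Int.emod_nonneg t (Int.natCast_ne_zero.2 he.ne')
    have hlt := Int.emod_lt_of_pos t (Int.natCast_pos.2 he)
    obtain ⟨s, hs⟩ := Int.eq_ofNat_of_zero_le hpos
    rw [hs] at h1 hlt
    rw [zpow_natCast] at h1
    rcases Nat.eq_zero_or_pos s with rfl | hs0
    · exact Int.dvd_of_emod_eq_zero hs
    · exact absurd h1 (hmin s hs0 (by exact_mod_cast hlt) _
        (H.approx_mul hu (H.approx_zpow (H.approx_inv hg) _)))
  set k' := H.residueSubfield h hφ
  set z := res W ζ with hz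
  have hz0 : z ≠ 0 := res_ne_zero_iff.2 hgv
  have hzmem : z ∈ IntermediateField.adjoin k' {z} := IntermediateField.mem_adjoin_simple_self _ _
  have hk' : ∀ b ∈ k', b ∈ IntermediateField.adjoin k' {z} := fun b hb =>
    IntermediateField.algebraMap_mem _ (⟨b, hb⟩ : k')
  -- A unit monomial is an element of `approx` times a power of `ζ`, so its residue is an element of
  -- `k'` times a power of `z`.
  have hterm : ∀ (t : ℤ) u, approx W Z P u → u * aeval Z P ^ t ∈ W →
      res W (u * aeval Z P ^ t) ∈ IntermediateField.adjoin k' {z} := by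
    intro t u hu hmem
    by_cases h1 : res W (u * aeval Z P ^ t) = 0
    · rw [h1]; exact zero_mem _
    rw [← ne_eq, res_ne_zero_iff] at h1
    obtain ⟨q, rfl⟩ := hdvd t u hu h1
    rw [hsplit u _ q, sub_self, zpow_zero, mul_one] at h1 ⊢
    rw [map_mul, hζq, mul_one] at h1
    have hres : res W (ζ ^ q) = z ^ q := by
      cases q with
      | ofNat n =>
        rw [Int.ofNat_eq_natCast, zpow_natCast, zpow_natCast, res_pow (mem_of_valuation_eq_one hgv)]
      | negSucc n =>
        rw [zpow_negSucc, zpow_negSucc, res_inv (by rw [map_pow, hgv, one_pow]),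
          res_pow (mem_of_valuation_eq_one hgv)]
    rw [res_mul (mem_of_valuation_eq_one h1) (mem_of_valuation_eq_one (hζq q)), hres]
    refine mul_mem (hk' _ ?_) (zpow_mem hzmem q)
    exact res_mem_residues (H.approx_mul hu (H.approx_zpow (H.approx_inv hg) _)) h1
  -- Each term of the expansion is bounded by the whole, so after scaling all terms are integral and
  -- the residue can be taken term by term.
  have hpoly : ∀ (F : K[X]) (t : ℤ) u, approx W Z P u → aeval Z F * (u * aeval Z P ^ t) ∈ W →
      res W (aeval Z F * (u * aeval Z P ^ t)) ∈ IntermediateField.adjoin k' {z} := by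
    intro F t u hu hmem
    obtain ⟨m, G, hG, hF⟩ := H.exists_expansion F
    have hFZ : aeval Z F = ∑ i ∈ Finset.range m, aeval Z (G i) * aeval Z P ^ i := by
      rw [hF, map_sum]; simp
    have hi : ∀ i ∈ Finset.range m, aeval Z (G i) * aeval Z P ^ i * (u * aeval Z P ^ t) ∈ W := by
      intro i hi
      have := H.valuation_term_le _ G hG hi
      rw [← hFZ] at this
      rw [mem_iff_valuation_le_one, map_mul] at hmem ⊢
      exact (mul_le_mul_left this _).trans hmem
    rw [hFZ, Finset.sum_mul, res_sum _ _ hi]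
    refine sum_mem fun i hi' => ?_
    have hi'' := hi i hi'
    by_cases hGi : G i = 0
    · rw [hGi]; simp
    have e1 : aeval Z (G i) * aeval Z P ^ i * (u * aeval Z P ^ t) =
        aeval Z (G i) * u * aeval Z P ^ (i + t) := by
      rw [zpow_add₀ hP0, zpow_natCast]; ring
    rw [e1] at hi'' ⊢
    exact hterm _ _ (H.approx_mul (H.approx_aeval hGi (hG i)) hu) hi''
  refine ⟨z, htr g e (H.approx_mem hg) he hgv, ?_, ?_⟩
  -- The factor `g` need not lie in `K(Z)`; the polynomial value it approximates does, and gives the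
  -- same residue.
  · obtain ⟨G, hG0, -, hGg⟩ := hg
    have hGζ : W.valuation (ζ / (aeval Z G * aeval Z P ^ e) - 1) < 1 := by
      rwa [hζ, mul_div_mul_right _ _ (pow_ne_zero _ hP0)]
    have hmem : ∀ F : K[X], aeval Z F ∈ IntermediateField.adjoin K {Z} := fun F =>
      IntermediateField.mem_adjoin_simple_iff K _ |>.2 ⟨F, 1, by simp⟩
    exact ⟨_, mul_mem (hmem G) (pow_mem (hmem P) e),
      mem_of_valuation_eq_one (valuation_eq_one_of_approx hGζ hgv),
      (res_eq_of_approx hGζ hgv).symm⟩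
  · intro u hu huW
    obtain ⟨A, B, rfl⟩ := IntermediateField.mem_adjoin_simple_iff K u |>.1 hu
    rcases eq_or_ne B 0 with rfl | hB0
    · simp
    have hBZ := H.aeval_ne_zero hB0
    obtain ⟨m, G, hG, hB⟩ := H.exists_expansion B
    have hBZ' : aeval Z B = ∑ i ∈ Finset.range m, aeval Z (G i) * aeval Z P ^ i := by
      rw [hB, map_sum]; simp
    have hm : 0 < m := by
      refine Nat.pos_of_ne_zero ?_
      rintro rfl
      exact hB0 (by simpa using hB)
    obtain ⟨i, hi⟩ := H.exists_valuation_eq_term m G hG hm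
    rw [← hBZ'] at hi
    have hGi : G i ≠ 0 := by
      intro h0
      rw [h0, map_zero, zero_mul, map_zero, eq_comm] at hi
      simp [hBZ] at hi
    have happ := H.approx_inv (H.approx_aeval hGi (hG i))
    -- `D` is the inverse of a term of `B(Z)` that has the value of `B(Z)`, so `B(Z) D` is a unit
    -- and the fraction can be reduced as a quotient of two integral elements.
    set D := (aeval Z (G i))⁻¹ * aeval Z P ^ (-(i : ℤ)) with hD
    have hGi' := H.aeval_ne_zero hGi
    have hBD : W.valuation (aeval Z B * D) = 1 := by
      rw [map_mul, ← hi, ← map_mul, hD, zpow_neg, zpow_natCast]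
      rw [show aeval Z (G i) * aeval Z P ^ i * ((aeval Z (G i))⁻¹ * (aeval Z P ^ i)⁻¹) = 1 by
        field_simp, map_one]
    have hD0 : D ≠ 0 := by intro h0; rw [h0, mul_zero, map_zero] at hBD; exact zero_ne_one hBD
    have hA : aeval Z A * D = aeval Z A / aeval Z B * (aeval Z B * D) := by field_simp
    have hAD : aeval Z A * D ∈ W := by
      rw [hA]; exact W.mul_mem _ _ huW (mem_of_valuation_eq_one hBD)
    have e1 := hpoly A _ _ happ hAD
    have e2 := hpoly B _ _ happ (mem_of_valuation_eq_one hBD)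
    have e3 : res W (aeval Z A / aeval Z B) = res W (aeval Z A * D) / res W (aeval Z B * D) := by
      rw [eq_div_iff (res_ne_zero_iff.2 hBD), ← res_mul huW (mem_of_valuation_eq_one hBD), ← hA]
    rw [e3]
    exact div_mem e1 e2

end IsKeyPolynomial

end ResidueGenerator

/-! ### Torsion of values and algebraicity of residues -/

section Torsion

theorem linearIndependent_pow_of_transcendental {k M : Type*} [Field k] [Field M] [Algebra k M]
    {y : M} (hy : Transcendental k y) : LinearIndependent k fun i : ℕ => y ^ i := by
  have h1 := (basisMonomials k).linearIndependent.map' (aeval y).toLinearMap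
    (LinearMap.ker_eq_bot.2 (transcendental_iff_injective.1 hy))
  have h2 : (fun i : ℕ => y ^ i) = (aeval y).toLinearMap ∘ basisMonomials k := by
    funext i; simp
  rwa [h2]

/-- In an algebraic relation for `u` the maximal value must be attained twice, as the sum vanishes.
The quotient of two such terms is a constant times a positive power of `u`. -/
theorem exists_pow_valuation_eq_one {B N : Type*} [Field B] [Field N] [Algebra B N]
    (W : ValuationSubring N) {u : N} (hu0 : u ≠ 0) (hu : IsAlgebraic B u) :
    ∃ m, 0 < m ∧ ∃ a : B, W.valuation (algebraMap B N a * u ^ m) = 1 := by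
  classical
  obtain ⟨p, hp0, hp⟩ := hu
  set f : ℕ → N := fun i => algebraMap B N (p.coeff i) * u ^ i with hf
  obtain ⟨i, hi, hmax⟩ := p.support.exists_max_image (fun i => W.valuation (f i))
    (support_nonempty.2 hp0)
  have hsum : ∑ j ∈ p.support, f j = 0 := by
    rw [← hp, aeval_def, eval₂_eq_sum, Polynomial.sum]
  have hne : ∀ j ∈ p.support, f j ≠ 0 := fun j hj =>
    mul_ne_zero (by simpa using hj) (pow_ne_zero _ hu0)
  obtain ⟨j, hj, hji, hval⟩ : ∃ j ∈ p.support, j ≠ i ∧ W.valuation (f j) = W.valuation (f i) := by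
    by_contra hcon
    push Not at hcon
    have := Valuation.map_sum_eq_of_lt W.valuation (f := f) hi fun j hj => by
      obtain ⟨hjs, hji⟩ := Finset.mem_sdiff.1 hj
      exact lt_of_le_of_ne (hmax j hjs) (hcon j hjs (by simpa using hji))
    rw [hsum, map_zero, eq_comm] at this
    exact hne i hi (by simpa using this)
  have key : ∀ a b, a ∈ p.support → b ∈ p.support → a < b →
      W.valuation (f b) = W.valuation (f a) →
      ∃ m, 0 < m ∧ ∃ a : B, W.valuation (algebraMap B N a * u ^ m) = 1 := by
    intro a b ha hb hab h
    refine ⟨b - a, Nat.sub_pos_of_lt hab, p.coeff b / p.coeff a, ?_⟩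
    have : algebraMap B N (p.coeff b / p.coeff a) * u ^ (b - a) = f b / f a := by
      have := (hne a ha)
      simp only [hf, map_div₀]
      rw [pow_sub₀ _ hu0 hab.le]
      have h1 : algebraMap B N (p.coeff a) ≠ 0 := by simpa using ha
      field_simp
    rw [this, map_div₀, h, div_self (by simpa using hne a ha)]
  rcases lt_or_gt_of_ne hji with hlt | hgt
  · exact key j i hj hi hlt hval.symm
  · exact key i j hi hj hgt hval

variable {E N : Type*} [Field E] [Field N] [Algebra E N] {v : ValuationSubring E}
  {W : ValuationSubring N} [Algebra (Res v) (Res W)]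

/-- A primitive annihilating polynomial reduces to a nonzero one, since one of its coefficients is
`1`. -/
theorem Extends.isAlgebraic_res (h : Extends v W)
    (hφ : ∀ a, algebraMap (Res v) (Res W) a = resMap h a) {x : N} (hx : x ∈ W)
    (hxa : IsAlgebraic E x) : IsAlgebraic (Res v) (res W x) := by
  obtain ⟨p, k, hp, hk, hpv, -⟩ := exists_primitive_annihilator v hxa
  obtain ⟨p', rfl⟩ : ∃ p' : v[X], p'.map (algebraMap v E) = p :=
    (lifts_iff_coeff_lifts p).2 fun n => ⟨⟨_, hpv n⟩, rfl⟩
  refine ⟨p'.map (IsLocalRing.residue v), ?_, ?_⟩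
  · intro h0
    have h1 := congrArg (fun g => g.coeff k) h0
    simp only [coeff_map, coeff_zero] at h1 hk
    have h2 : p'.coeff k = 1 := Subtype.ext hk
    rw [h2, map_one] at h1
    exact one_ne_zero h1
  · have h1 := h.res_aeval hx p'
    rw [aeval_map_algebraMap] at hp
    rw [hp, res_zero, ← RingHom.ext hφ] at h1
    exact h1.symm

/-- The values of `E(y)` are those of `E` when the residue of `y` is transcendental. -/
theorem Extends.exists_valuation_eq_of_transcendental (h : Extends v W)
    (hφ : ∀ a, algebraMap (Res v) (Res W) a = resMap h a) {y : N} (hy : y ∈ W)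
    (hyt : Transcendental (Res v) (res W y)) {u : N}
    (hu : u ∈ IntermediateField.adjoin E {y}) :
    ∃ a : E, W.valuation u = W.valuation (algebraMap E N a) := by
  have hpoly : ∀ A : E[X], ∃ a : E, W.valuation (aeval y A) = W.valuation (algebraMap E N a) := by
    intro A
    have hli : LinearIndependent (Res v) fun i : Fin (A.natDegree + 1) => res W (y ^ (i : ℕ)) := by
      have h1 : (fun i : Fin (A.natDegree + 1) => res W (y ^ (i : ℕ))) =
          (fun i : ℕ => res W y ^ i) ∘ fun i : Fin (A.natDegree + 1) => (i : ℕ) := by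
        funext i; exact res_pow hy _
      rw [h1]
      exact (linearIndependent_pow_of_transcendental hyt).comp _ Fin.val_injective
    have hsum : aeval y A = ∑ i : Fin (A.natDegree + 1), algebraMap E N (A.coeff i) * y ^ (i : ℕ) := by
      rw [aeval_eq_sum_range, Finset.sum_range]
      simp [Algebra.smul_def]
    obtain ⟨j, hj⟩ := h.exists_valuation_sum_eq hφ
      (fun i : Fin (A.natDegree + 1) => y ^ (i : ℕ)) (fun i => pow_mem hy (i : ℕ)) hli
      fun i => A.coeff i
    exact ⟨_, by rw [hsum]; exact hj⟩
  obtain ⟨A, B, rfl⟩ := IntermediateField.mem_adjoin_simple_iff E u |>.1 hu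
  obtain ⟨a, ha⟩ := hpoly A
  obtain ⟨b, hb⟩ := hpoly B
  exact ⟨a / b, by rw [map_div₀, ha, hb, map_div₀, map_div₀]⟩

/-- Some multiple of a power of `u` is a unit with residue algebraic over `Ev`. -/
def IsResAlgebraic (v : ValuationSubring E) (W : ValuationSubring N) [Algebra (Res v) (Res W)]
    (u : N) : Prop :=
  ∃ m, 0 < m ∧ ∃ a : E, W.valuation (algebraMap E N a * u ^ m) = 1 ∧
    IsAlgebraic (Res v) (res W (algebraMap E N a * u ^ m))

theorem IsResAlgebraic.mul {x y : N} (hx : IsResAlgebraic v W x) (hy : IsResAlgebraic v W y) :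
    IsResAlgebraic v W (x * y) := by
  obtain ⟨m, hm, a, ha, hax⟩ := hx
  obtain ⟨n, hn, b, hb, hby⟩ := hy
  have e : algebraMap E N (a ^ n * b ^ m) * (x * y) ^ (m * n) =
      (algebraMap E N a * x ^ m) ^ n * (algebraMap E N b * y ^ n) ^ m := by
    rw [map_mul, map_pow, map_pow]; ring
  refine ⟨m * n, Nat.mul_pos hm hn, a ^ n * b ^ m, ?_, ?_⟩
  · rw [e, map_mul, map_pow, map_pow, ha, hb, one_pow, one_pow, one_mul]
  · have ha' := mem_of_valuation_eq_one ha
    have hb' := mem_of_valuation_eq_one hb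
    rw [e, res_mul (pow_mem ha' _) (pow_mem hb' _), res_pow ha', res_pow hb']
    exact (hax.pow n).mul (hby.pow m)

theorem IsResAlgebraic.inv {x : N} (hx : IsResAlgebraic v W x) : IsResAlgebraic v W x⁻¹ := by
  obtain ⟨m, hm, a, ha, hax⟩ := hx
  have e : algebraMap E N a⁻¹ * x⁻¹ ^ m = (algebraMap E N a * x ^ m)⁻¹ := by
    rw [map_inv₀, inv_pow, mul_inv]
  refine ⟨m, hm, a⁻¹, ?_, ?_⟩
  · rw [e, map_inv₀, ha, inv_one]
  · rw [e, res_inv ha]; exact hax.inv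

theorem IsResAlgebraic.of_sub_one_lt {x : N} (hx : W.valuation (x - 1) < 1) :
    IsResAlgebraic v W x := by
  have hx1 := valuation_eq_one_of_sub_one_lt hx
  refine ⟨1, one_pos, 1, by simpa using hx1, ?_⟩
  rw [map_one, one_mul, pow_one, (res_eq_one_iff (mem_of_valuation_eq_one hx1)).2 hx]
  exact isAlgebraic_one

theorem IsResAlgebraic.of_isAlgebraic (h : Extends v W)
    (hφ : ∀ a, algebraMap (Res v) (Res W) a = resMap h a) {x : N} (hx0 : x ≠ 0)
    (hx : IsAlgebraic E x) : IsResAlgebraic v W x := by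
  obtain ⟨m, hm, a, ha⟩ := exists_pow_valuation_eq_one W hx0 hx
  exact ⟨m, hm, a, ha, h.isAlgebraic_res hφ (mem_of_valuation_eq_one ha)
    ((isAlgebraic_algebraMap a).mul (hx.pow m))⟩

theorem IsResAlgebraic.isAlgebraic_res (h : Extends v W)
    (hφ : ∀ a, algebraMap (Res v) (Res W) a = resMap h a) {x : N} (hx1 : W.valuation x = 1)
    (hx : IsResAlgebraic v W x) : IsAlgebraic (Res v) (res W x) := by
  obtain ⟨m, hm, a, ha, hax⟩ := hx
  rw [map_mul, map_pow, hx1, one_pow, mul_one, h.valuation_eq_one_iff] at ha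
  have ha' := mem_of_valuation_eq_one ha
  rw [res_mul (h.mem_iff.2 ha') (pow_mem (mem_of_valuation_eq_one hx1) m),
    res_pow (mem_of_valuation_eq_one hx1), ← h.resMap_res ha', ← hφ] at hax
  have ha0 : algebraMap (Res v) (Res W) (res v a) ≠ 0 := by
    simpa using res_ne_zero_iff.2 ha
  have := (isAlgebraic_algebraMap (R := Res v) (A := Res W) (res v a)).inv.mul hax
  rw [inv_mul_cancel_left₀ ha0] at this
  exact this.of_pow hm

end Torsion

/-! ### Refining a valuation through its residue field -/

section Refinement

variable {N : Type*} [Field N]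

/-- The composite of a valuation ring of `N` with a valuation ring of its residue field. -/
def composite (W : ValuationSubring N) (V : ValuationSubring (Res W)) : ValuationSubring N where
  carrier := {u | u ∈ W ∧ res W u ∈ V}
  mul_mem' := fun ⟨ha, ha'⟩ ⟨hb, hb'⟩ =>
    ⟨W.mul_mem _ _ ha hb, by rw [res_mul ha hb]; exact V.mul_mem _ _ ha' hb'⟩
  one_mem' := ⟨W.one_mem, by rw [res_one]; exact V.one_mem⟩
  add_mem' := fun ⟨ha, ha'⟩ ⟨hb, hb'⟩ =>
    ⟨W.add_mem _ _ ha hb, by rw [res_add ha hb]; exact V.add_mem _ _ ha' hb'⟩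
  zero_mem' := ⟨W.zero_mem, by rw [res_zero]; exact V.zero_mem⟩
  neg_mem' := fun ⟨ha, ha'⟩ => ⟨W.neg_mem _ ha, by rw [res_neg ha]; exact V.neg_mem _ ha'⟩
  mem_or_inv_mem' := by
    intro x
    rcases lt_trichotomy (W.valuation x) 1 with hlt | heq | hgt
    · have hx := mem_of_valuation_lt_one hlt
      exact Or.inl ⟨hx, by rw [(res_eq_zero_iff hx).2 hlt]; exact V.zero_mem⟩
    · rcases V.mem_or_inv_mem (res W x) with hx | hx
      · exact Or.inl ⟨mem_of_valuation_eq_one heq, hx⟩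
      · exact Or.inr ⟨mem_of_valuation_eq_one (by rw [map_inv₀, heq, inv_one]),
          by rwa [res_inv heq]⟩
    · have hlt : W.valuation x⁻¹ < 1 := by
        rw [map_inv₀]; exact inv_lt_one_of_one_lt₀ hgt
      have hx := mem_of_valuation_lt_one hlt
      exact Or.inr ⟨hx, by rw [(res_eq_zero_iff hx).2 hlt]; exact V.zero_mem⟩

/-- Some valuation ring of `Res W` contains the integral closure of `k` but not the transcendental
residue of `u`; its composite with `W` makes `u` infinite and keeps all elements of `W` with
algebraic residue integral. -/
theorem exists_refinement {k : Type*} [Field k] (W : ValuationSubring N) [Algebra k (Res W)] {u : N}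
    (hut : Transcendental k (res W u)) :
    ∃ W₁ : ValuationSubring N, W₁ ≤ W ∧ 1 < W₁.valuation u ∧
      ∀ x ∈ W, IsAlgebraic k (res W x) → x ∈ W₁ := by
  obtain ⟨V, hV, hVu⟩ := Subring.exists_le_valuationSubring_of_isIntegrallyClosedIn
    (R := (integralClosure k (Res W)).toSubring) (x := res W u)
    fun hmem => hut (IsIntegral.isAlgebraic hmem)
  refine ⟨composite W V, fun x hx => hx.1, ?_, fun x hx hxa => ⟨hx, hV hxa.isIntegral⟩⟩
  rw [← not_le, ← mem_iff_valuation_le_one]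
  exact fun hmem => hVu hmem.2

end Refinement

/-! ### The ruled residue theorem for `K(Z)` -/

section Ruled

variable {E K N : Type*} [Field E] [Field K] [Field N] [Algebra E K] [Algebra K N] [Algebra E N]
  [IsScalarTower E K N] {v : ValuationSubring E} {W : ValuationSubring N}
  [Algebra (Res v) (Res W)]

/-- The ruled residue theorem, for `K(Z)` with `K / E` finite inside a field `N` of
transcendence degree one. -/
theorem exists_ruled_residues [FiniteDimensional E K] (h : Extends v W)
    (hφ : ∀ a, algebraMap (Res v) (Res W) a = resMap h a) (Z : N)
    (halg : ∀ y : N, Transcendental E y → ∀ u : N, IsAlgebraic (IntermediateField.adjoin E {y}) u)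
    (hy : ∃ y ∈ IntermediateField.adjoin K {Z}, y ∈ W ∧ Transcendental (Res v) (res W y)) :
    ∃ (k' : IntermediateField (Res v) (Res W)) (z : Res W), FiniteDimensional (Res v) k' ∧
      Transcendental (Res v) z ∧
      (∀ b ∈ k', ∃ u ∈ IntermediateField.adjoin K {Z}, u ∈ W ∧ res W u = b) ∧
      (∃ u ∈ IntermediateField.adjoin K {Z}, u ∈ W ∧ res W u = z) ∧
      ∀ u ∈ IntermediateField.adjoin K {Z}, u ∈ W → res W u ∈ IntermediateField.adjoin k' {z} := by
  classical
  obtain ⟨y, hyZ, hyW, hyt⟩ := hy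
  have hyE : Transcendental E y := fun hya => hyt (h.isAlgebraic_res hφ hyW hya)
  -- `N` is algebraic over `E(y)`, and `E(y)` has the values of `E` because the residue of `y` is
  -- transcendental. So all values in `N` are torsion modulo those of `E`.
  have htors : ∀ u : N, u ≠ 0 → ∃ m, 0 < m ∧ ∃ a : E, W.valuation (algebraMap E N a * u ^ m) = 1 := by
    intro u hu
    obtain ⟨m, hm, a, ha⟩ := exists_pow_valuation_eq_one W hu (halg y hyE u)
    obtain ⟨a', ha'⟩ := h.exists_valuation_eq_of_transcendental hφ hyW hyt a.2
    refine ⟨m, hm, a', ?_⟩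
    rw [map_mul, ← ha', ← map_mul]
    exact ha
  have hKalg : ∀ a : K, IsAlgebraic E (algebraMap K N a) := fun a =>
    (Algebra.IsAlgebraic.isAlgebraic (R := E) a).algebraMap
  have hmem : ∀ F : K[X], aeval Z F ∈ IntermediateField.adjoin K {Z} := fun F =>
    IntermediateField.mem_adjoin_simple_iff K _ |>.2 ⟨F, 1, by simp⟩
  have hZ : Transcendental K Z := by
    intro hZ
    have h1 : Algebra.IsAlgebraic K (IntermediateField.adjoin K {Z}) :=
      IntermediateField.isAlgebraic_adjoin_simple hZ.isIntegral
    have h2 : IsAlgebraic K y :=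
      (h1.isAlgebraic ⟨y, hyZ⟩).algHom (IntermediateField.adjoin K {Z}).val
    exact hyE (h2.restrictScalars E)
  -- If all nonzero polynomial values were residually algebraic, so would be their quotient `y`,
  -- against the choice of `y`.
  have hex : ∃ n, ∃ P : K[X], P ≠ 0 ∧ P.natDegree = n ∧ ¬ IsResAlgebraic v W (aeval Z P) := by
    by_contra hcon
    push Not at hcon
    obtain ⟨A, B, rfl⟩ := IntermediateField.mem_adjoin_simple_iff K y |>.1 hyZ
    have hy1 : W.valuation (aeval Z A / aeval Z B) = 1 := by
      rw [← res_ne_zero_iff]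
      intro h0; rw [h0] at hyt; exact hyt isAlgebraic_zero
    have hA0 : A ≠ 0 := by rintro rfl; simp at hy1
    have hB0 : B ≠ 0 := by rintro rfl; simp at hy1
    refine hyt (IsResAlgebraic.isAlgebraic_res h hφ hy1 ?_)
    rw [div_eq_mul_inv]
    exact (hcon _ A hA0 rfl).mul (hcon _ B hB0 rfl).inv
  obtain ⟨P, hP0, hPn, hPT⟩ := Nat.find_spec hex
  have hPmin : ∀ G : K[X], G ≠ 0 → G.natDegree < P.natDegree → IsResAlgebraic v W (aeval Z G) := by
    intro G hG0 hG
    by_contra hcon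
    exact Nat.find_min hex (hPn ▸ hG) ⟨G, hG0, rfl, hcon⟩
  have hPZ : aeval Z P ≠ 0 := fun h0 => hZ ⟨P, hP0, h0⟩
  obtain ⟨m₀, hm₀, a₀, ha₀⟩ := htors _ hPZ
  have hu₀ : Transcendental (Res v) (res W (algebraMap E N a₀ * aeval Z P ^ m₀)) := fun halg =>
    hPT ⟨m₀, hm₀, a₀, ha₀, halg⟩
  -- This ring makes `a₀ P(Z)^m₀` infinitely large, while units with algebraic residue remain units
  -- by `hunit`.
  obtain ⟨W₁, hW₁, hu₁, hint⟩ := exists_refinement W hu₀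
  have hunit : ∀ x, W.valuation x = 1 → IsAlgebraic (Res v) (res W x) → W₁.valuation x = 1 := by
    intro x hx hxa
    have h1 := mem_iff_valuation_le_one.1 (hint x (mem_of_valuation_eq_one hx) hxa)
    have h2 := mem_iff_valuation_le_one.1 (hint x⁻¹ (mem_of_valuation_eq_one
      (by rw [map_inv₀, hx, inv_one])) (by rw [res_inv hx]; exact hxa.inv))
    have hx0 : x ≠ 0 := by rintro rfl; simp at hx
    rw [map_inv₀, inv_le_one₀ (zero_lt_iff.2 (by simpa using hx0))] at h2
    exact le_antisymm h1 h2
  -- Up to a constant that is a unit, a power of `u P(Z)^t` is a residually algebraic unit times a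
  -- positive power of `a₀ P(Z)^m₀`. Only the last factor is seen by `W₁`.
  have hgt : ∀ u t, IsResAlgebraic v W u → 0 < t → W.valuation (u * aeval Z P ^ t) = 1 →
      1 < W₁.valuation (u * aeval Z P ^ t) := by
    rintro u t ⟨m, hm, b, hb, hba⟩ ht hut
    set x := u * aeval Z P ^ t with hx
    have e : algebraMap E N (b ^ m₀ * a₀ ^ (t * m)) * x ^ (m * m₀) =
        (algebraMap E N b * u ^ m) ^ m₀ * (algebraMap E N a₀ * aeval Z P ^ m₀) ^ (t * m) := by
      rw [hx, map_mul, map_pow, map_pow]; ring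
    have hc : W.valuation (algebraMap E N (b ^ m₀ * a₀ ^ (t * m))) = 1 := by
      have := congrArg W.valuation e
      rw [map_mul, map_pow _ x, hut, one_pow, mul_one] at this
      rw [this, map_mul, map_pow, map_pow, hb, ha₀, one_pow, one_pow, one_mul]
    have hc₁ : W₁.valuation (algebraMap E N (b ^ m₀ * a₀ ^ (t * m))) = 1 :=
      hunit _ hc (h.isAlgebraic_res hφ (mem_of_valuation_eq_one hc) (isAlgebraic_algebraMap _))
    have := congrArg W₁.valuation e
    rw [map_mul, hc₁, one_mul, map_mul, map_pow _ _ m₀, hunit _ hb hba, one_pow, one_mul,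
      map_pow, map_pow] at this
    have h1 : 1 < W₁.valuation x ^ (m * m₀) := by
      rw [this]
      exact one_lt_pow₀ hu₁ (Nat.mul_pos ht hm).ne'
    exact lt_of_not_ge fun hle => (pow_le_one' hle _).not_gt h1
  have H : IsKeyPolynomial W W₁ (IsResAlgebraic v W) Z P :=
    { le := hW₁
      mul := fun _ _ => IsResAlgebraic.mul
      inv := fun _ => IsResAlgebraic.inv
      principal := fun _ => IsResAlgebraic.of_sub_one_lt
      transcendental := hZ
      -- A constant `P` would be algebraic over `E`, hence residually algebraic.
      natDegree_pos := by
        refine Nat.pos_of_ne_zero fun h0 => hPT ?_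
        rw [eq_C_of_natDegree_eq_zero h0, aeval_C] at hPZ ⊢
        exact IsResAlgebraic.of_isAlgebraic h hφ hPZ (hKalg _)
      mem := hPmin
      gt := hgt }
  obtain ⟨z, hzt, hzZ, hz⟩ := H.exists_residue_generator h hφ ⟨m₀, hm₀, a₀, ha₀⟩ (by
    intro u t hu ht hut halg
    refine absurd (hunit _ hut halg) (hgt u t hu ht hut).ne')
  refine ⟨H.residueSubfield h hφ, z, H.finiteDimensional_residueSubfield h hφ, hzt, ?_, hzZ, hz⟩
  rintro b ⟨G, -, hG, rfl⟩
  exact ⟨_, hmem G, hG, rfl⟩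

end Ruled

/-! ### Minimal terms, the exponent `e_S` and the residue polynomial -/

section Supports

variable {E F : Type*} [Field E] [Field F] [Algebra E F] {v : ValuationSubring E}
  {f : E[X]} {x : F} {S : Finset ℕ} {w : ValuationSubring F}

theorem mem_supp_iff {i : ℕ} : i ∈ supp f x w ↔ i ≤ f.natDegree ∧ ∀ j ≤ f.natDegree,
    w.valuation (algebraMap E F (f.coeff j) * x ^ j) ≤
      w.valuation (algebraMap E F (f.coeff i) * x ^ i) := by
  simp [supp]

theorem supp_nonempty (f : E[X]) (x : F) (w : ValuationSubring F) : (supp f x w).Nonempty := by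
  obtain ⟨i, hi, hmax⟩ := (Finset.range (f.natDegree + 1)).exists_max_image
    (fun i => w.valuation (algebraMap E F (f.coeff i) * x ^ i)) ⟨0, by simp⟩
  exact ⟨i, by simp only [supp, Finset.mem_filter]; exact ⟨hi, hmax⟩⟩

theorem first_mem (hS : S.Nonempty) : first S ∈ S := by
  have : sInf (S : Set ℕ) ∈ (S : Set ℕ) := Nat.sInf_mem (by simpa using hS)
  exact this

theorem first_le {i : ℕ} (hi : i ∈ S) : first S ≤ i := Nat.sInf_le (by simpa using hi)

theorem gap_dvd {i : ℕ} (hi : i ∈ S) : gap S ∣ i - first S := Finset.gcd_dvd hi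

theorem gap_pos (hS : 2 ≤ S.card) : 0 < gap S := by
  refine Nat.pos_of_ne_zero fun h0 => ?_
  have : S ⊆ {first S} := fun i hi => by
    have h1 := gap_dvd hi
    rw [h0, zero_dvd_iff] at h1
    have h2 := first_le hi
    rw [Finset.mem_singleton]; omega
  have := Finset.card_le_card this
  rw [Finset.card_singleton] at this
  omega

theorem OmegaS.extends (hw : w ∈ OmegaS v f x S) : Extends v w := hw.1.1

theorem OmegaS.le_natDegree (hw : w ∈ OmegaS v f x S) {i : ℕ} (hi : i ∈ S) : i ≤ f.natDegree := by
  rw [← hw.2] at hi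
  exact (mem_supp_iff.1 hi).1

theorem OmegaS.valuation_le (hw : w ∈ OmegaS v f x S) {i : ℕ} (hi : i ∈ S) (j : ℕ) :
    w.valuation (algebraMap E F (f.coeff j) * x ^ j) ≤
      w.valuation (algebraMap E F (f.coeff i) * x ^ i) := by
  rw [← hw.2] at hi
  by_cases hj : j ≤ f.natDegree
  · exact (mem_supp_iff.1 hi).2 j hj
  · rw [coeff_eq_zero_of_natDegree_lt (not_le.1 hj)]; simp

theorem OmegaS.valuation_eq (hw : w ∈ OmegaS v f x S) {i j : ℕ} (hi : i ∈ S) (hj : j ∈ S) :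
    w.valuation (algebraMap E F (f.coeff j) * x ^ j) =
      w.valuation (algebraMap E F (f.coeff i) * x ^ i) :=
  le_antisymm (OmegaS.valuation_le hw hi j) (OmegaS.valuation_le hw hj i)

theorem OmegaS.valuation_lt (hw : w ∈ OmegaS v f x S) {i j : ℕ} (hi : i ∈ S) (hj : j ∉ S) :
    j ≤ f.natDegree → w.valuation (algebraMap E F (f.coeff j) * x ^ j) <
      w.valuation (algebraMap E F (f.coeff i) * x ^ i) := by
  intro hjn
  refine lt_of_le_of_ne (OmegaS.valuation_le hw hi j) fun h => hj ?_
  rw [← hw.2, mem_supp_iff]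
  exact ⟨hjn, fun k _ => h ▸ OmegaS.valuation_le hw hi k⟩

theorem OmegaS.coeff_ne_zero (hw : w ∈ OmegaS v f x S) (hS : 2 ≤ S.card) (hx : x ≠ 0) {i : ℕ}
    (hi : i ∈ S) : f.coeff i ≠ 0 := by
  intro h0
  have hf : f ≠ 0 := by
    rintro rfl
    have : S ⊆ {0} := fun j hj => by
      have := OmegaS.le_natDegree hw hj
      simp at this
      simp [this]
    have := Finset.card_le_card this
    rw [Finset.card_singleton] at this
    omega
  have := OmegaS.valuation_le hw hi f.natDegree
  rw [h0, map_zero, zero_mul, map_zero, le_zero_iff] at this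
  simp [hx, hf] at this

theorem OmegaS.natDegree_pos (hw : w ∈ OmegaS v f x S) (hS : 2 ≤ S.card) : 0 < f.natDegree := by
  refine Nat.pos_of_ne_zero fun h0 => ?_
  have : S ⊆ {0} := fun j hj => by
    have := OmegaS.le_natDegree hw hj
    rw [Finset.mem_singleton]; omega
  have := Finset.card_le_card this
  rw [Finset.card_singleton] at this
  omega

theorem OmegaS.gap_le (hw : w ∈ OmegaS v f x S) (hS : 2 ≤ S.card) : gap S ≤ f.natDegree := by
  obtain ⟨i, hi, hne⟩ := Finset.exists_mem_ne (by omega : 1 < S.card) (first S)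
  have h1 := first_le hi
  have h2 := Nat.le_of_dvd (by omega) (gap_dvd hi)
  have h3 := OmegaS.le_natDegree hw hi
  omega

/-- There is a uniform `b` with `w(b x ^ d) = 0` on `Ω_{S,f,x}`. -/
theorem exists_gap_scale (hw : w ∈ OmegaS v f x S) (hS : 2 ≤ S.card) (hx : x ≠ 0) :
    ∃ b : E, b ≠ 0 ∧ ∀ w ∈ OmegaS v f x S, w.valuation (algebraMap E F b * x ^ gap S) = 1 := by
  let D : AddSubgroup ℤ :=
    { carrier := {n | ∃ b : E, b ≠ 0 ∧
        ∀ w ∈ OmegaS v f x S, w.valuation (algebraMap E F b * x ^ n) = 1}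
      add_mem' := by
        rintro m n ⟨a, ha, ha'⟩ ⟨b, hb, hb'⟩
        refine ⟨a * b, mul_ne_zero ha hb, fun w hw => ?_⟩
        rw [map_mul (algebraMap E F), zpow_add₀ hx, mul_mul_mul_comm, map_mul, ha' w hw, hb' w hw, one_mul]
      zero_mem' := ⟨1, one_ne_zero, fun w _ => by simp⟩
      neg_mem' := by
        rintro m ⟨a, ha, ha'⟩
        refine ⟨a⁻¹, inv_ne_zero ha, fun w hw => ?_⟩
        rw [map_inv₀, zpow_neg, ← mul_inv, map_inv₀, ha' w hw, inv_one] }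
  have hmem : ∀ i ∈ S, ((i - first S : ℕ) : ℤ) ∈ D := by
    intro i hi
    have hi0 := first_mem ⟨i, hi⟩
    refine ⟨f.coeff i / f.coeff (first S),
      div_ne_zero (OmegaS.coeff_ne_zero hw hS hx hi) (OmegaS.coeff_ne_zero hw hS hx hi0), fun w' hw' => ?_⟩
    have h0 := OmegaS.coeff_ne_zero hw' hS hx hi0
    have e : algebraMap E F (f.coeff i / f.coeff (first S)) * x ^ ((i - first S : ℕ) : ℤ) =
        (algebraMap E F (f.coeff i) * x ^ i) / (algebraMap E F (f.coeff (first S)) * x ^ first S) := by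
      rw [map_div₀, zpow_natCast, pow_sub₀ _ hx (first_le hi)]
      field_simp
    rw [e, map_div₀, OmegaS.valuation_eq hw' hi0 hi, div_self]
    simp [h0, hx]
  obtain ⟨g, hg⟩ := Int.subgroup_cyclic D
  have hgd : ∀ i ∈ S, g.natAbs ∣ i - first S := by
    intro i hi
    have := hmem i hi
    rw [hg, AddSubgroup.mem_closure_singleton] at this
    obtain ⟨n, hn⟩ := this
    rw [← Int.natCast_dvd_natCast, Int.natAbs_dvd]
    exact ⟨n, by rw [← hn, smul_eq_mul, mul_comm]⟩
  have hgap : g.natAbs ∣ gap S := Finset.dvd_gcd hgd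
  have : ((gap S : ℕ) : ℤ) ∈ D := by
    rw [hg, AddSubgroup.mem_closure_singleton]
    obtain ⟨n, hn⟩ := Int.natAbs_dvd.1 (Int.natCast_dvd_natCast.2 hgap)
    exact ⟨n, by rw [hn, smul_eq_mul, mul_comm]⟩
  obtain ⟨b, hb, hb'⟩ := this
  exact ⟨b, hb, fun w hw => by rw [← zpow_natCast]; exact hb' w hw⟩

/-- Since `b x^d` is a unit and value groups are torsion free, `v(b)^n` is a `d`-th power exactly
when `x^n` has the value of an element of `E`. So `e_S` can be read off at a single `w`. -/
theorem mem_expo_set_iff (hw : w ∈ OmegaS v f x S) (hS : 2 ≤ S.card) (hx : x ≠ 0) {n : ℕ} :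
    (0 < n ∧ ∃ b : E, b ≠ 0 ∧
      (∀ w ∈ OmegaS v f x S, w.valuation (algebraMap E F b * x ^ gap S) = 1) ∧
      ∃ γ : v.ValueGroup, v.valuation b ^ n = γ ^ gap S) ↔
    0 < n ∧ ∃ a : E, w.valuation (algebraMap E F a * x ^ n) = 1 := by
  have hgap := (gap_pos hS).ne'
  refine and_congr_right fun _ => ⟨?_, ?_⟩
  · rintro ⟨b, hb0, hb, γ, hγ⟩
    obtain ⟨a, rfl⟩ := v.valuation_surjective γ
    have ha0 : a ≠ 0 := by
      rintro rfl
      rw [map_zero, zero_pow hgap] at hγ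
      exact hb0 (by simpa using eq_zero_of_pow_eq_zero hγ)
    refine ⟨a, ?_⟩
    have h1 := hb w hw
    have h2 : w.valuation (algebraMap E F b) ^ n = w.valuation (algebraMap E F a) ^ gap S := by
      rw [← map_pow, ← map_pow, ← map_pow, ← map_pow, (OmegaS.extends hw).valuation_eq_iff, map_pow, map_pow,
        hγ]
    rw [← pow_left_inj₀ zero_le zero_le hgap, one_pow, map_mul, mul_pow, ← h2, map_pow, ← pow_mul,
      mul_comm n, pow_mul, ← mul_pow, ← map_pow, ← map_mul, h1, one_pow]
  · rintro ⟨a, ha⟩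
    obtain ⟨b, hb0, hb⟩ := exists_gap_scale hw hS hx
    refine ⟨b, hb0, hb, v.valuation a, ?_⟩
    rw [← map_pow, ← map_pow, ← (OmegaS.extends hw).valuation_eq_iff]
    have h1 := hb w hw
    have hx' : w.valuation (x ^ (n * gap S)) ≠ 0 := by simp [hx]
    rw [← mul_left_inj' hx', ← map_mul, ← map_mul, map_pow, map_pow]
    have e1 : algebraMap E F b ^ n * x ^ (n * gap S) = (algebraMap E F b * x ^ gap S) ^ n := by
      rw [mul_pow, ← pow_mul, mul_comm n]
    have e2 : algebraMap E F a ^ gap S * x ^ (n * gap S) = (algebraMap E F a * x ^ n) ^ gap S := by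
      rw [mul_pow, ← pow_mul]
    rw [e1, e2, map_pow, map_pow, h1, ha, one_pow, one_pow]

theorem expo_spec (hw : w ∈ OmegaS v f x S) (hS : 2 ≤ S.card) (hx : x ≠ 0) :
    0 < expo v f x S ∧ ∃ a : E, w.valuation (algebraMap E F a * x ^ expo v f x S) = 1 := by
  rw [← mem_expo_set_iff hw hS hx]
  obtain ⟨b, -, hb⟩ := exists_gap_scale hw hS hx
  have hne : ∃ n, n ∈ {n : ℕ | 0 < n ∧ ∃ b : E, b ≠ 0 ∧
      (∀ w ∈ OmegaS v f x S, w.valuation (algebraMap E F b * x ^ gap S) = 1) ∧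
      ∃ γ : v.ValueGroup, v.valuation b ^ n = γ ^ gap S} :=
    ⟨gap S, (mem_expo_set_iff hw hS hx).2 ⟨gap_pos hS, b, hb w hw⟩⟩
  exact Nat.sInf_mem hne

/-- Dividing by a power of a unit `c x^e` leaves exponent `n % e`, which must vanish by minimality.
-/
theorem expo_dvd (hw : w ∈ OmegaS v f x S) (hS : 2 ≤ S.card) (hx : x ≠ 0) {a : E} {n : ℕ}
    (ha : w.valuation (algebraMap E F a * x ^ n) = 1) : expo v f x S ∣ n := by
  obtain ⟨he, c, hc⟩ := expo_spec hw hS hx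
  set e := expo v f x S
  have hc0 : algebraMap E F c ≠ 0 := by intro h0; simp [h0] at hc
  have h1 : w.valuation (algebraMap E F (a / c ^ (n / e)) * x ^ (n % e)) = 1 := by
    have : algebraMap E F (a / c ^ (n / e)) * x ^ (n % e) =
        (algebraMap E F a * x ^ n) / (algebraMap E F c * x ^ e) ^ (n / e) := by
      conv_rhs => rw [← Nat.mod_add_div n e, pow_add, pow_mul]
      rw [map_div₀, map_pow, mul_pow]
      rw [Nat.mod_add_div]
      field_simp
    rw [this, map_div₀, map_pow, ha, hc, one_pow, div_one]
  rcases Nat.eq_zero_or_pos (n % e) with h0 | hpos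
  · exact Nat.dvd_of_mod_eq_zero h0
  · have : e ≤ n % e := Nat.sInf_le ((mem_expo_set_iff hw hS hx).2 ⟨hpos, _, h1⟩)
    exact absurd (Nat.mod_lt n he) (not_lt.2 this)

theorem expo_dvd_gap (hw : w ∈ OmegaS v f x S) (hS : 2 ≤ S.card) (hx : x ≠ 0) :
    expo v f x S ∣ gap S := by
  obtain ⟨b, -, hb⟩ := exists_gap_scale hw hS hx
  exact expo_dvd hw hS hx (hb w hw)

theorem expo_dvd_sub (hw : w ∈ OmegaS v f x S) (hS : 2 ≤ S.card) (hx : x ≠ 0) {i : ℕ}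
    (hi : i ∈ S) : expo v f x S ∣ i - first S :=
  (expo_dvd_gap hw hS hx).trans (gap_dvd hi)

theorem natCast_res_ne_zero (hchar : ringChar (Res v) = 0 ∨ f.natDegree < ringChar (Res v))
    {n : ℕ} (hn : 0 < n) (hnf : n ≤ f.natDegree) : (n : Res v) ≠ 0 := by
  intro h0
  have := (ringChar.spec (Res v) n).1 h0
  rcases hchar with h | h
  · rw [h, zero_dvd_iff] at this; omega
  · have := Nat.le_of_dvd hn this; omega

variable {c : E}

/-- The normalized coefficients of the residue polynomial are units. -/
theorem valuation_resPoly_coeff (hw : w ∈ OmegaS v f x S) (hS : 2 ≤ S.card) (hx : x ≠ 0)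
    (hc : c ∈ Scale v f x S) {i : ℕ} (hi : i ∈ S) :
    v.valuation (f.coeff i * (f.coeff (first S))⁻¹ *
      (c ^ ((i - first S) / expo v f x S))⁻¹) = 1 := by
  rw [← (OmegaS.extends hw).valuation_eq_one_iff]
  have hi0 := first_mem ⟨i, hi⟩
  have h0 := OmegaS.coeff_ne_zero hw hS hx hi0
  have hc0 : c ≠ 0 := hc.1
  set e := expo v f x S
  set n := (i - first S) / e
  have hn : e * n = i - first S := Nat.mul_div_cancel' (expo_dvd_sub hw hS hx hi)
  have e1 : algebraMap E F (f.coeff i * (f.coeff (first S))⁻¹ * (c ^ n)⁻¹) =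
      (algebraMap E F (f.coeff i) * x ^ i) / (algebraMap E F (f.coeff (first S)) * x ^ first S) /
        (algebraMap E F c * x ^ e) ^ n := by
    have hxi : x ^ i = x ^ (e * n) * x ^ first S := by
      rw [← pow_add]; congr 1; have := first_le hi; omega
    rw [hxi, mul_pow, ← pow_mul]
    simp only [map_mul, map_inv₀, map_pow]
    field_simp
  rw [e1, map_div₀, map_div₀, map_pow, hc.2 w hw, one_pow, div_one, OmegaS.valuation_eq hw hi0 hi, div_self]
  simp [h0, hx]

/-- Only the index `i₀` contributes to the constant term. In particular no factor `q` vanishes at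
`0`, so roots of its lifts are units. -/
theorem resPoly_coeff_zero (hw : w ∈ OmegaS v f x S) (hS : 2 ≤ S.card) (hx : x ≠ 0) :
    (resPoly v f x S c).coeff 0 = 1 := by
  have hne : S.Nonempty := Finset.card_pos.1 (by omega)
  have hi0 := first_mem hne
  have he := (expo_spec hw hS hx).1
  rw [resPoly, finsetSum_coeff, Finset.sum_eq_single_of_mem _ hi0]
  · simp [OmegaS.coeff_ne_zero hw hS hx hi0]
  · intro i hi hne
    rw [coeff_monomial, if_neg]
    have h1 := first_le hi
    have h2 := Nat.le_of_dvd (by omega) (expo_dvd_sub hw hS hx hi)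
    exact (Nat.div_pos h2 he).ne'

theorem natDegree_resPoly_le {L : Type*} [Field L] [Algebra E L] (v : ValuationSubring E) (g : E[X])
    (y : L) (S : Finset ℕ) (c : E) {n : ℕ} (hn : ∀ i ∈ S, i ≤ n) :
    (resPoly v g y S c).natDegree ≤ n := by
  refine natDegree_sum_le_of_forall_le _ _ fun i hi => (natDegree_monomial_le _).trans ?_
  exact (Nat.div_le_self _ _).trans ((Nat.sub_le _ _).trans (hn i hi))

end Supports

/-! ### Lower bounds for degrees from residues and values -/

section Degrees

/-- The coefficients of a monic factor over `F` are integral over `E`, hence lie in `E`. So the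
minimal polynomial over `E` does not split further over `F`. -/
theorem minpoly_eq_map_of_algebraicClosure_eq_bot {E F L : Type*} [Field E] [Field F] [Field L]
    [Algebra E F] [Algebra F L] [Algebra E L] [IsScalarTower E F L]
    (h : algebraicClosure E F = ⊥) {y : L} (hy : IsIntegral E y) :
    minpoly F y = (minpoly E y).map (algebraMap E F) := by
  have hyF : IsIntegral F y := hy.tower_top
  have hdvd : minpoly F y ∣ (minpoly E y).map (algebraMap E F) := by
    rw [minpoly.dvd_iff, aeval_map_algebraMap, minpoly.aeval]
  have hlift := integralClosure.mem_lifts_of_monic_of_dvd_map F (minpoly.monic hy)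
    (minpoly.monic hyF) hdvd
  rw [lifts_iff_coeff_lifts] at hlift
  obtain ⟨p, hp⟩ : ∃ p : E[X], p.map (algebraMap E F) = minpoly F y := by
    refine (lifts_iff_coeff_lifts _).2 fun n => ?_
    obtain ⟨a, ha⟩ := hlift n
    have : (a : F) ∈ algebraicClosure E F := mem_algebraicClosure_iff'.2 a.2
    rw [h, IntermediateField.mem_bot] at this
    obtain ⟨b, hb⟩ := this
    exact ⟨b, by rw [hb, ← ha]; rfl⟩
  have hdvd' : minpoly E y ∣ p := by
    rw [minpoly.dvd_iff, ← aeval_map_algebraMap F, hp, minpoly.aeval]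
  refine (eq_of_monic_of_dvd_of_natDegree_le (minpoly.monic hyF)
    ((minpoly.monic hy).map _) hdvd ?_).symm
  rw [← hp, natDegree_map, natDegree_map]
  refine natDegree_le_of_dvd hdvd' ?_
  rintro rfl
  rw [Polynomial.map_zero] at hp
  exact (minpoly.monic hyF).ne_zero hp.symm

theorem eq_zero_of_sum_eq_zero {N ι : Type*} [Field N] (W : ValuationSubring N) (s : Finset ι)
    (t : ι → N) (hsum : ∑ i ∈ s, t i = 0)
    (hne : ∀ i ∈ s, ∀ j ∈ s, i ≠ j → t i ≠ 0 → t j ≠ 0 → W.valuation (t i) ≠ W.valuation (t j)) :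
    ∀ i ∈ s, t i = 0 := by
  classical
  intro i hi
  obtain ⟨m, hm, hmax⟩ := s.exists_max_image (fun i => W.valuation (t i)) ⟨i, hi⟩
  by_contra hti
  have htm : t m ≠ 0 := by
    intro h0
    have := hmax i hi
    rw [h0, map_zero, le_zero_iff] at this
    exact hti (by simpa using this)
  have := Valuation.map_sum_eq_of_lt W.valuation (f := t) hm fun j hj => by
    obtain ⟨hjs, hjm⟩ := Finset.mem_sdiff.1 hj
    rw [Finset.mem_singleton] at hjm
    by_cases htj : t j = 0
    · rw [htj, map_zero]; exact zero_lt_iff.2 (by simpa using htm)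
    · exact lt_of_le_of_ne (hmax j hjs) (hne j hjs m hm hjm htj htm)
  rw [hsum, map_zero, eq_comm] at this
  exact htm (by simpa using this)

variable {E L : Type*} [Field E] [Field L] [Algebra E L] {v : ValuationSubring E}
  {V : ValuationSubring L} {Q : v[X]} {α l : L} {c : E} {e : ℕ}

theorem Extends.mem_of_monic_root (hV : Extends v V) (hQ : Q.Monic) (hα : aeval α Q = 0) :
    α ∈ V := by
  by_contra hαV
  have hgt : 1 < V.valuation α := by
    rw [← not_le, ← mem_iff_valuation_le_one]; exact hαV
  have h0 := hα
  rw [aeval_eq_sum_range, Finset.sum_range_succ, hQ.coeff_natDegree, one_smul,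
    add_eq_zero_iff_eq_neg'] at h0
  have h1 : V.valuation (α ^ Q.natDegree) < V.valuation (α ^ Q.natDegree) := by
    conv_lhs => rw [h0, Valuation.map_neg]
    refine Valuation.map_sum_lt _ (by rw [map_pow]; exact pow_ne_zero _ (one_pos.trans hgt).ne')
      fun i hi => ?_
    rw [Algebra.smul_def, map_mul, map_pow, map_pow]
    refine (mul_le_of_le_one_left' (mem_iff_valuation_le_one.1
      (hV.mem_iff.2 (Q.coeff i).2))).trans_lt ?_
    exact pow_lt_pow_right₀ hgt (Finset.mem_range.1 hi)
  exact lt_irrefl _ h1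

theorem Extends.res_ne_zero_of_root (hV : Extends v V) (hQ : Q.Monic) (hα : aeval α Q = 0)
    (h0 : (Q.map (IsLocalRing.residue v)).coeff 0 ≠ 0) : V.valuation α = 1 := by
  rw [← res_ne_zero_iff]
  intro hres
  have h1 := hV.res_aeval (hV.mem_of_monic_root hQ hα) Q
  rw [hα, res_zero, hres, eval₂_at_zero, eq_comm, _root_.map_eq_zero] at h1
  exact h0 h1

/-- The monomials `α ^ i l ^ j` are linearly independent over `E` when the residue of `α` has
degree `deg Q` and `l` has ramification index `e`. -/
theorem Extends.linearIndependent_monomials (hV : Extends v V) (hQ : Q.Monic)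
    (hirr : Irreducible (Q.map (IsLocalRing.residue v)))
    (h0 : (Q.map (IsLocalRing.residue v)).coeff 0 ≠ 0) (hα : aeval α Q = 0)
    (he : 0 < e) (hc : c ≠ 0) (hl : l ^ e = α⁻¹ * algebraMap E L c)
    (hmin : ∀ (a : E) (j : ℕ), v.valuation a ^ e = v.valuation c ^ j → e ∣ j) :
    LinearIndependent E fun p : Fin e × Fin Q.natDegree => α ^ (p.2 : ℕ) * l ^ (p.1 : ℕ) := by
  let _ : Algebra (Res v) (Res V) := (resMap hV).toAlgebra
  have hφ : ∀ a, algebraMap (Res v) (Res V) a = resMap hV a := fun _ => rfl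
  have hαV := hV.mem_of_monic_root hQ hα
  have hα1 := hV.res_ne_zero_of_root hQ hα h0
  have hroot : aeval (res V α) (Q.map (IsLocalRing.residue v)) = 0 := by
    rw [aeval_def, RingHom.ext hφ, ← hV.res_aeval hαV, hα, res_zero]
  have hmp : minpoly (Res v) (res V α) = Q.map (IsLocalRing.residue v) :=
    (minpoly.eq_of_irreducible_of_monic hirr hroot (hQ.map _)).symm
  have hdeg : (minpoly (Res v) (res V α)).natDegree = Q.natDegree := by
    rw [hmp, hQ.natDegree_map]
  have hli : LinearIndependent (Res v) fun i : Fin Q.natDegree => res V (α ^ (i : ℕ)) := by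
    have := (linearIndependent_pow (K := Res v) (res V α)).comp (finCongr hdeg.symm)
      (finCongr hdeg.symm).injective
    convert this using 2 with i
    exact res_pow hαV _
  have hn : 0 < Q.natDegree := by
    rw [← hQ.natDegree_map (IsLocalRing.residue v)]
    exact hirr.natDegree_pos
  have : Nonempty (Fin Q.natDegree) := ⟨⟨0, hn⟩⟩
  have hl1 : V.valuation l ^ e = V.valuation (algebraMap E L c) := by
    rw [← map_pow, hl, map_mul, map_inv₀, hα1, inv_one, one_mul]
  have hl0 : l ≠ 0 := by
    rintro rfl
    rw [map_zero, zero_pow he.ne', eq_comm] at hl1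
    simp [hc] at hl1
  refine Fintype.linearIndependent_iff.2 fun g hg => ?_
  -- Grouping by powers of `l`: by independence of the residues, each nonzero `A j` has the value of
  -- an element of `E`.
  set A : Fin e → L := fun j => ∑ i, algebraMap E L (g (j, i)) * α ^ (i : ℕ) with hA
  have hsum : ∑ j, A j * l ^ (j : ℕ) = 0 := by
    rw [← hg, Fintype.sum_prod_type]
    refine Finset.sum_congr rfl fun j _ => ?_
    rw [hA, Finset.sum_mul]
    exact Finset.sum_congr rfl fun i _ => by rw [Algebra.smul_def]; ring
  have hAval : ∀ j, ∃ a : E, V.valuation (A j) = V.valuation (algebraMap E L a) := fun j => by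
    obtain ⟨i, hi⟩ := hV.exists_valuation_sum_eq hφ (fun i : Fin Q.natDegree => α ^ (i : ℕ))
      (fun i => pow_mem hαV _) hli fun i => g (j, i)
    exact ⟨_, hi⟩
  -- Equal values would put the value of `l^(j-i)` among those of `E`, although `0 < j - i < e`;
  -- this contradicts `hmin`.
  have key : ∀ i j : Fin e, i < j → A i ≠ 0 → A j ≠ 0 →
      V.valuation (A i * l ^ (i : ℕ)) ≠ V.valuation (A j * l ^ (j : ℕ)) := by
    intro i j hij hi hj heq
    obtain ⟨a, ha⟩ := hAval i
    obtain ⟨b, hb⟩ := hAval j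
    have hij' : (i : ℕ) < j := hij
    have hb0 : V.valuation (algebraMap E L b) ≠ 0 := by rw [← hb]; simpa using hj
    have h1 : V.valuation (algebraMap E L (a / b)) = V.valuation l ^ ((j : ℕ) - i) := by
      rw [map_mul, map_mul, ha, hb, map_pow, map_pow] at heq
      rw [map_div₀, map_div₀, pow_sub₀ _ (by simpa using hl0) hij'.le]
      have hl' : V.valuation l ^ (i : ℕ) ≠ 0 := pow_ne_zero _ (by simpa using hl0)
      field_simp
      rw [heq, mul_comm]
    have h2 : v.valuation (a / b) ^ e = v.valuation c ^ ((j : ℕ) - i) := by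
      rw [← map_pow, ← map_pow, ← hV.valuation_eq_iff, map_pow, map_pow, map_pow, map_pow, h1,
        ← hl1, ← pow_mul, ← pow_mul, mul_comm]
    have h3 := Nat.le_of_dvd (by omega) (hmin _ _ h2)
    have := j.2
    omega
  have hA0 : ∀ j, A j = 0 := by
    intro j
    have := eq_zero_of_sum_eq_zero V Finset.univ _ hsum (fun i _ j _ hij hi hj => by
      have hi' := left_ne_zero_of_mul hi
      have hj' := left_ne_zero_of_mul hj
      rcases lt_or_gt_of_ne hij with h | h
      · exact key i j h hi' hj'
      · exact (key j i h hj' hi').symm) j (Finset.mem_univ j)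
    exact (mul_eq_zero.1 this).resolve_right (pow_ne_zero _ hl0)
  rintro ⟨j, i⟩
  have := hV.valuation_coeff_le hφ (fun i : Fin Q.natDegree => α ^ (i : ℕ))
    (fun i => pow_mem hαV _) hli (fun i => g (j, i)) i
  change _ ≤ V.valuation (A j) at this
  rw [hA0 j, map_zero, le_zero_iff] at this
  simpa using this

/-- From `α = c l^(-e)` it follows that `α ∈ E(l)`, so `E(l)` contains all `e · deg Q` independent
monomials. -/
theorem Extends.mul_le_natDegree_minpoly (hV : Extends v V) (hQ : Q.Monic)
    (hirr : Irreducible (Q.map (IsLocalRing.residue v)))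
    (h0 : (Q.map (IsLocalRing.residue v)).coeff 0 ≠ 0) (hα : aeval α Q = 0)
    (he : 0 < e) (hc : c ≠ 0) (hl : l ^ e = α⁻¹ * algebraMap E L c)
    (hmin : ∀ (a : E) (j : ℕ), v.valuation a ^ e = v.valuation c ^ j → e ∣ j) :
    IsIntegral E l ∧ e * Q.natDegree ≤ (minpoly E l).natDegree := by
  have hα1 := hV.res_ne_zero_of_root hQ hα h0
  have hα0 : α ≠ 0 := by rintro rfl; simp at hα1
  have hαint : IsIntegral E α := IsIntegral.tower_top (R := v) ⟨Q, hQ, by rw [← aeval_def, hα]⟩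
  have hlint : IsIntegral E l := by
    refine IsIntegral.of_pow he ?_
    rw [hl]
    exact (hαint.inv).mul isIntegral_algebraMap
  refine ⟨hlint, ?_⟩
  have : FiniteDimensional E (IntermediateField.adjoin E {l}) :=
    IntermediateField.adjoin.finiteDimensional hlint
  have hlmem := IntermediateField.mem_adjoin_simple_self E l
  have hαmem : α ∈ IntermediateField.adjoin E {l} := by
    have : α = algebraMap E L c * (l ^ e)⁻¹ := by
      rw [hl]
      have : algebraMap E L c ≠ 0 := by simpa using hc
      field_simp
    rw [this]
    exact mul_mem (IntermediateField.algebraMap_mem _ _) (inv_mem (pow_mem hlmem _))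
  have hli := hV.linearIndependent_monomials hQ hirr h0 hα he hc hl hmin
  have hli' : LinearIndependent E fun p : Fin e × Fin Q.natDegree =>
      (⟨α ^ (p.2 : ℕ) * l ^ (p.1 : ℕ), mul_mem (pow_mem hαmem _) (pow_mem hlmem _)⟩ :
        IntermediateField.adjoin E {l}) :=
    LinearIndependent.of_comp (IntermediateField.adjoin E {l}).val.toLinearMap hli
  have := hli'.fintype_card_le_finrank
  rwa [Fintype.card_prod, Fintype.card_fin, Fintype.card_fin,
    IntermediateField.adjoin.finrank hlint] at this

end Degrees

/-! ### Irreducibility in the tower by counting degrees -/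

section RootTower

theorem finrank_eq_natDegree_minpoly_of_adjoin_eq_top {K L : Type*} [Field K] [Field L]
    [Algebra K L] {y : L} (hy : IsIntegral K y) (h : IntermediateField.adjoin K {y} = ⊤) :
    Module.finrank K L = (minpoly K y).natDegree := by
  rw [← IntermediateField.adjoin.finrank hy, h, IntermediateField.finrank_top']

theorem isScalarTower_of_tower (E F FQ F' : Type*) [Field E] [Field F] [Field FQ] [Field F']
    [Algebra E F] [Algebra F FQ] [Algebra E FQ] [IsScalarTower E F FQ] [Algebra FQ F']
    [Algebra F F'] [IsScalarTower F FQ F'] [Algebra E F'] [IsScalarTower E F F'] :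
    IsScalarTower E FQ F' :=
  IsScalarTower.of_algebraMap_eq fun a => by
    rw [IsScalarTower.algebraMap_apply E F F', IsScalarTower.algebraMap_apply F FQ F',
      ← IsScalarTower.algebraMap_apply E F FQ]

variable {E F FQ F' : Type*} [Field E] [Field F] [Field FQ] [Field F'] [Algebra E F] [Algebra F FQ]
  [Algebra E FQ] [IsScalarTower E F FQ] [Algebra FQ F'] [Algebra F F'] [IsScalarTower F FQ F']
  [Algebra E F'] [IsScalarTower E F F']
  {v : ValuationSubring E} {Q : v[X]} {α : FQ} {l : F'} {c : E} {e : ℕ}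

theorem adjoin_root_eq_top {E F FQ F' : Type*} [Field E] [Field F] [Field FQ] [Field F']
    [Algebra E F] [Algebra F FQ] [Algebra FQ F'] [Algebra F F'] [IsScalarTower F FQ F']
    [Algebra E F'] [IsScalarTower E F F'] {α : FQ} {l : F'} {c : E} {e : ℕ}
    (hFQ : IntermediateField.adjoin F {α} = ⊤)
    (hF' : IntermediateField.adjoin FQ {l} = ⊤) (hc : c ≠ 0)
    (hl : l ^ e = algebraMap FQ F' α⁻¹ * algebraMap E F' c) :
    IntermediateField.adjoin F {l} = ⊤ := by
  have hlmem := IntermediateField.mem_adjoin_simple_self F l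
  have hαmem : algebraMap FQ F' α ∈ IntermediateField.adjoin F {l} := by
    have : algebraMap FQ F' α = algebraMap E F' c * (l ^ e)⁻¹ := by
      rw [hl, map_inv₀]
      have : algebraMap E F' c ≠ 0 := by simpa using hc
      field_simp
    rw [this, IsScalarTower.algebraMap_apply E F F']
    exact mul_mem (IntermediateField.algebraMap_mem _ _) (inv_mem (pow_mem hlmem _))
  have hFQmem : ∀ y : FQ, algebraMap FQ F' y ∈ IntermediateField.adjoin F {l} := by
    intro y
    have hy : y ∈ IntermediateField.adjoin F {α} := hFQ ▸ IntermediateField.mem_top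
    have hle : IntermediateField.adjoin F {α} ≤
        (IntermediateField.adjoin F {l}).comap (IsScalarTower.toAlgHom F FQ F') :=
      IntermediateField.adjoin_le_iff.2 (Set.singleton_subset_iff.2 hαmem)
    exact hle hy
  refine eq_top_iff.2 fun y _ => ?_
  have hy : y ∈ IntermediateField.adjoin FQ {l} := hF' ▸ IntermediateField.mem_top
  obtain ⟨A, B, rfl⟩ := IntermediateField.mem_adjoin_simple_iff FQ y |>.1 hy
  have hpoly : ∀ A : FQ[X], aeval l A ∈ IntermediateField.adjoin F {l} := fun A => by
    rw [aeval_eq_sum_range]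
    refine sum_mem fun i _ => ?_
    rw [Algebra.smul_def]
    exact mul_mem (hFQmem _) (pow_mem hlmem _)
  exact div_mem (hpoly A) (hpoly B)

/-- Both degrees in the tower are bounded by `deg Q` and `e`, while `F' = F(l)` has degree at least
`e · deg Q`: the degree of `l` over `E` is at least that, and it does not drop over `F`. Hence both
bounds are equalities and the two polynomials are minimal polynomials. -/
theorem irreducible_of_tower (hE : algebraicClosure E F = ⊥) (hQ : Q.Monic)
    (hirr : Irreducible (Q.map (IsLocalRing.residue v)))
    (h0 : (Q.map (IsLocalRing.residue v)).coeff 0 ≠ 0)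
    (hα : aeval α (Q.map (algebraMap v E)) = 0)
    (hFQ : IntermediateField.adjoin F {α} = ⊤) (he : 0 < e) (hc : c ≠ 0)
    (hl : l ^ e = algebraMap FQ F' α⁻¹ * algebraMap E F' c)
    (hF' : IntermediateField.adjoin FQ {l} = ⊤)
    (hmin : ∀ (a : E) (j : ℕ), v.valuation a ^ e = v.valuation c ^ j → e ∣ j) :
    Irreducible (Q.map ((algebraMap E F).comp (algebraMap v E))) ∧
      Irreducible (X ^ e - C (α⁻¹ * algebraMap E FQ c)) ∧ IsIntegral E l := by
  have : IsScalarTower E FQ F' := isScalarTower_of_tower E F FQ F'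
  obtain ⟨V, hV⟩ := exists_extends E F' v
  have hα' : aeval (algebraMap FQ F' α) Q = 0 := by
    rw [← aeval_map_algebraMap E, aeval_algebraMap_apply, hα, map_zero]
  obtain ⟨hlint, hle⟩ := hV.mul_le_natDegree_minpoly hQ hirr h0 hα' he hc
    (by rw [hl, map_inv₀]) hmin
  have hlF : IsIntegral F l := hlint.tower_top
  have hlFQ : IsIntegral FQ l := hlint.tower_top
  have hαF : aeval α (Q.map ((algebraMap E F).comp (algebraMap v E))) = 0 := by
    rw [← Polynomial.map_map, aeval_map_algebraMap, hα]
  have hQF := hQ.map ((algebraMap E F).comp (algebraMap v E))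
  have hαint : IsIntegral F α := ⟨_, hQF, by rw [← aeval_def, hαF]⟩
  have hd1 : minpoly F α ∣ Q.map ((algebraMap E F).comp (algebraMap v E)) := minpoly.dvd _ _ hαF
  have hmon : (X ^ e - C (α⁻¹ * algebraMap E FQ c)).Monic := monic_X_pow_sub_C _ he.ne'
  have hd2 : minpoly FQ l ∣ X ^ e - C (α⁻¹ * algebraMap E FQ c) := by
    refine minpoly.dvd _ _ ?_
    rw [map_sub, map_pow, aeval_X, aeval_C, hl, map_mul, ← IsScalarTower.algebraMap_apply, sub_self]
  have hle1 := natDegree_le_of_dvd hd1 hQF.ne_zero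
  have hle2 := natDegree_le_of_dvd hd2 hmon.ne_zero
  rw [hQ.natDegree_map] at hle1
  rw [natDegree_X_pow_sub_C] at hle2
  have hfr := Module.finrank_mul_finrank F FQ F'
  rw [finrank_eq_natDegree_minpoly_of_adjoin_eq_top hαint hFQ,
    finrank_eq_natDegree_minpoly_of_adjoin_eq_top hlFQ hF',
    finrank_eq_natDegree_minpoly_of_adjoin_eq_top hlF (adjoin_root_eq_top hFQ hF' hc hl),
    minpoly_eq_map_of_algebraicClosure_eq_bot hE hlint, natDegree_map] at hfr
  have hpos1 := minpoly.natDegree_pos hαint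
  have hpos2 := minpoly.natDegree_pos hlFQ
  have heq1 : Q.natDegree ≤ (minpoly F α).natDegree := by
    by_contra hlt
    rw [not_le] at hlt
    have h1 : (minpoly F α).natDegree * (minpoly FQ l).natDegree < Q.natDegree * e :=
      Nat.mul_lt_mul_of_lt_of_le hlt hle2 he
    rw [mul_comm e] at hle
    omega
  have heq2 : e ≤ (minpoly FQ l).natDegree := by
    by_contra hlt
    rw [not_le] at hlt
    have h1 : (minpoly F α).natDegree * (minpoly FQ l).natDegree < Q.natDegree * e :=
      Nat.mul_lt_mul_of_le_of_lt hle1 hlt (hpos1.trans_le hle1)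
    rw [mul_comm e] at hle
    omega
  refine ⟨?_, ?_, hlint⟩
  · rw [eq_of_monic_of_dvd_of_natDegree_le (minpoly.monic hαint) hQF hd1
      (by rwa [hQ.natDegree_map])]
    exact minpoly.irreducible hαint
  · rw [eq_of_monic_of_dvd_of_natDegree_le (minpoly.monic hlFQ) hmon hd2
      (by rwa [natDegree_X_pow_sub_C])]
    exact minpoly.irreducible hlFQ

end RootTower

/-! ### Extending valuations through the tower -/

section LiftTower

/-- The data of the tower `F ⊆ F(α) ⊆ F(α)(l)`, where `α` is a root of a lift of a separable
polynomial over the residue field, and `l ^ e = α⁻¹ c`. -/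
structure IsLiftTower {E F FQ F' : Type*} [Field E] [Field F] [Field FQ] [Field F'] [Algebra E F]
    [Algebra F FQ] [Algebra E FQ] [Algebra FQ F'] [Algebra E F'] (v : ValuationSubring E) (x : F)
    (c : E) (e : ℕ) (Q : v[X]) (α : FQ) (l : F') : Prop where
  x_ne_zero : x ≠ 0
  c_ne_zero : c ≠ 0
  e_pos : 0 < e
  e_res_ne_zero : (e : Res v) ≠ 0
  monic : Q.Monic
  separable : (Q.map (IsLocalRing.residue v)).Separable
  coeff_zero_ne_zero : (Q.map (IsLocalRing.residue v)).coeff 0 ≠ 0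
  root : aeval α (Q.map (algebraMap v E)) = 0
  irreducible : Irreducible (Q.map ((algebraMap E F).comp (algebraMap v E)))
  irreducible_pow : Irreducible (X ^ e - C (α⁻¹ * algebraMap E FQ c))
  adjoin_root : IntermediateField.adjoin F {α} = ⊤
  pow_eq : l ^ e = algebraMap FQ F' α⁻¹ * algebraMap E F' c
  adjoin_eq_top : IntermediateField.adjoin FQ {l} = ⊤

/-- The substitution `X ↦ zX` is an automorphism. It serves to replace the generator `l` by `l x`.
-/
theorem irreducible_X_pow_sub_C_mul_pow {K : Type*} [Field K] {a z : K} {e : ℕ} (hz : z ≠ 0)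
    (h : Irreducible (X ^ e - C a)) : Irreducible (X ^ e - C (a * z ^ e)) := by
  let _ := invertibleOfNonzero hz
  rw [← MulEquiv.irreducible_iff (algEquivCMulXAddC z 0)]
  have h1 : algEquivCMulXAddC z 0 (X ^ e - C (a * z ^ e)) = C (z ^ e) * (X ^ e - C a) := by
    rw [algEquivCMulXAddC_apply, map_sub, map_pow, aeval_X, aeval_C, algebraMap_eq, C_0, add_zero,
      mul_pow, mul_sub, ← C_mul, C_pow, mul_comm a]
  rw [h1, irreducible_isUnit_mul (isUnit_C.2 (pow_ne_zero e hz).isUnit)]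
  exact h

variable {E F FQ F' : Type*} [Field E] [Field F] [Field FQ] [Field F'] [Algebra E F] [Algebra F FQ]
  [Algebra E FQ] [IsScalarTower E F FQ] [Algebra FQ F'] [Algebra F F'] [IsScalarTower F FQ F']
  [Algebra E F'] [IsScalarTower E F F']
  {v : ValuationSubring E} {Q : v[X]} {α : FQ} {l : F'} {c : E} {e : ℕ} {x : F}
  {w : ValuationSubring F}

theorem residue_ringMap {K L : Type*} [Field K] [Field L] [Algebra K L] {v : ValuationSubring K}
    {w : ValuationSubring L} (h : Extends v w) :
    (IsLocalRing.residue w).comp (ringMap h) = (resMap h).comp (IsLocalRing.residue v) := rfl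

namespace IsLiftTower

theorem root_generator (T : IsLiftTower v x c e Q α l) (h : Extends v w) {z : F}
    (hz : w.valuation z = 1)
    (hroot : (Q.map (IsLocalRing.residue v)).eval₂ (resMap h) (res w z) = 0) :
    IsSimpleRootGenerator w (Q.map (ringMap h)) z α where
  monic := T.monic.map _
  irreducible := by rw [Polynomial.map_map]; exact T.irreducible
  root := by
    have := T.root
    rw [aeval_def, eval₂_map] at this ⊢
    convert this using 2
    ext a
    simp only [RingHom.comp_apply]
    rw [IsScalarTower.algebraMap_apply E F FQ]
    rfl
  adjoin := T.adjoin_root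
  mem := mem_of_valuation_eq_one hz
  eval_res := by
    rw [Polynomial.map_map, residue_ringMap, ← Polynomial.map_map, eval_map, hroot]
  eval_derivative_res := by
    rw [Polynomial.map_map, residue_ringMap, ← Polynomial.map_map, derivative_map, eval_map]
    exact T.separable.eval₂_derivative_ne_zero _ hroot

theorem valuation_root_eq_one (T : IsLiftTower v x c e Q α l) (h : Extends v w) {W : ValuationSubring FQ}
    (hW : Extends w W) : W.valuation α = 1 := by
  refine (h.trans hW).res_ne_zero_of_root T.monic ?_ T.coeff_zero_ne_zero
  rw [← aeval_map_algebraMap E, T.root]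

theorem root_ne_zero (T : IsLiftTower v x c e Q α l) : α ≠ 0 := by
  obtain ⟨W, hW⟩ := exists_extends E FQ v
  have := hW.res_ne_zero_of_root T.monic
    (by rw [← aeval_map_algebraMap E, T.root]) T.coeff_zero_ne_zero
  rintro rfl
  simp at this

/-- The generator is `l x` instead of `l`, because `(l x)^e = α⁻¹ c x^e` is a unit of residue `1`.
Then `1` is a simple root of the reduction `X^e - 1`, as `e` is nonzero in the residue field. -/
theorem power_generator (T : IsLiftTower v x c e Q α l) {W : ValuationSubring FQ}
    (hvW : Extends v W)
    {u : W} (hu : (u : FQ) = α⁻¹ * algebraMap F FQ (algebraMap E F c * x ^ e))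
    (hres : IsLocalRing.residue W u = 1) :
    IsSimpleRootGenerator W (X ^ e - C u) 1 (l * algebraMap F F' x) where
  monic := monic_X_pow_sub_C _ T.e_pos.ne'
  irreducible := by
    have hx : algebraMap F FQ x ≠ 0 := by simpa using T.x_ne_zero
    have := irreducible_X_pow_sub_C_mul_pow hx T.irreducible_pow
    rw [Polynomial.map_sub, Polynomial.map_pow, map_X, map_C]
    convert this using 3
    rw [show algebraMap W FQ u = (u : FQ) from rfl, hu, map_mul, map_pow, mul_assoc,
      IsScalarTower.algebraMap_apply E F FQ]
  root := by
    rw [map_sub, map_pow, aeval_X, aeval_C, mul_pow, T.pow_eq,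
      IsScalarTower.algebraMap_apply W FQ F', show algebraMap W FQ u = (u : FQ) from rfl, hu,
      map_mul (algebraMap FQ F'), ← IsScalarTower.algebraMap_apply F FQ F', map_mul, map_pow,
      ← IsScalarTower.algebraMap_apply E F F']
    ring
  adjoin := by
    rw [eq_top_iff, ← T.adjoin_eq_top, IntermediateField.adjoin_le_iff, Set.singleton_subset_iff]
    have hx : algebraMap FQ F' (algebraMap F FQ x) ≠ 0 := by simpa using T.x_ne_zero
    have h1 := IntermediateField.mem_adjoin_simple_self FQ (l * algebraMap F F' x)
    have h2 : l = (l * algebraMap F F' x) * (algebraMap FQ F' (algebraMap F FQ x))⁻¹ := by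
      rw [IsScalarTower.algebraMap_apply F FQ F']
      field_simp
    have h3 := mul_mem h1 (inv_mem (IntermediateField.algebraMap_mem
      (IntermediateField.adjoin FQ {l * algebraMap F F' x}) (algebraMap F FQ x)))
    rwa [← h2] at h3
  mem := one_mem _
  eval_res := by
    rw [Polynomial.map_sub, Polynomial.map_pow, map_X, map_C, hres, res_one]; simp
  eval_derivative_res := by
    rw [Polynomial.map_sub, Polynomial.map_pow, map_X, map_C, res_one]
    simp only [derivative_sub, derivative_X_pow, derivative_C, sub_zero, eval_mul, eval_pow, eval_X,
      one_pow, mul_one, eval_C]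
    rw [← map_natCast (resMap hvW)]
    exact (_root_.map_ne_zero _).2 T.e_res_ne_zero

theorem root_eq (T : IsLiftTower v x c e Q α l) :
    algebraMap FQ F' α = algebraMap F F' (algebraMap E F c * x ^ e) *
      ((l * algebraMap F F' x) ^ e)⁻¹ := by
  have hα : algebraMap FQ F' α ≠ 0 := by simpa using T.root_ne_zero
  have hx : algebraMap F F' x ≠ 0 := by simpa using T.x_ne_zero
  have hc : algebraMap E F' c ≠ 0 := by simpa using T.c_ne_zero
  rw [mul_pow, T.pow_eq, map_mul, map_pow, ← IsScalarTower.algebraMap_apply E F F', map_inv₀]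
  field_simp

/-- Since `α = c x^e / (l x)^e`, the residue condition on `l x` forces the one on `α`. A valuation
prescribed on `F'` thus restricts to the extension already known to be unique on `F_Q`. -/
theorem comap_root (T : IsLiftTower v x c e Q α l) (hz : w.valuation (algebraMap E F c * x ^ e) = 1)
    {W' : ValuationSubring F'} (hW' : Extends w W')
    (h1 : W'.valuation (l * algebraMap F F' x) = 1) (h2 : res W' (l * algebraMap F F' x) = 1) :
    res (W'.comap (algebraMap FQ F')) α = res (W'.comap (algebraMap FQ F'))
      (algebraMap F FQ (algebraMap E F c * x ^ e)) ∧
      (W'.comap (algebraMap FQ F')).valuation α = 1 ∧ 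
      Extends w (W'.comap (algebraMap FQ F')) := by
  have hC := Extends.comap_self (L := FQ) W'
  have hz' : W'.valuation (algebraMap F F' (algebraMap E F c * x ^ e)) = 1 :=
    hW'.valuation_eq_one_iff.2 hz
  have hα : W'.valuation (algebraMap FQ F' α) = 1 := by
    rw [T.root_eq, map_mul, map_inv₀, map_pow, hz', h1, one_pow, inv_one, one_mul]
  have hα' := hC.valuation_eq_one_iff.1 hα
  have hz'' : (W'.comap (algebraMap FQ F')).valuation
      (algebraMap F FQ (algebraMap E F c * x ^ e)) = 1 := by
    rw [← hC.valuation_eq_one_iff, ← IsScalarTower.algebraMap_apply F FQ F', hz']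
  refine ⟨?_, hα', hW'.comap_right⟩
  refine (resMap hC).injective ?_
  rw [hC.resMap_res (mem_of_valuation_eq_one hα'), hC.resMap_res (mem_of_valuation_eq_one hz''),
    ← IsScalarTower.algebraMap_apply F FQ F', T.root_eq]
  have h3 := mem_of_valuation_eq_one h1
  rw [res_mul (mem_of_valuation_eq_one hz'), res_inv, res_pow h3, h2, one_pow, inv_one, mul_one]
  · rw [map_pow, h1, one_pow]
  · exact mem_of_valuation_eq_one (by rw [map_inv₀, map_pow, h1, one_pow, inv_one])

theorem existsUnique_extends_root (T : IsLiftTower v x c e Q α l) (h : Extends v w)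
    (hz : w.valuation (algebraMap E F c * x ^ e) = 1)
    (hroot : (Q.map (IsLocalRing.residue v)).eval₂ (resMap h)
      (res w (algebraMap E F c * x ^ e)) = 0) :
    ∃! W : ValuationSubring FQ, Extends w W ∧ W.valuation α = 1 ∧
      res W α = res W (algebraMap F FQ (algebraMap E F c * x ^ e)) := by
  have H := T.root_generator h hz hroot
  obtain ⟨W, hW, hα, hres⟩ := H.exists_extends
  refine ⟨W, ⟨hW, T.valuation_root_eq_one h hW, hres⟩, ?_⟩
  rintro W' ⟨hW', hα', hres'⟩
  exact H.unique hW' (mem_of_valuation_eq_one hα') hres' hW hα hres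

theorem exists_unit_residue_eq_one
    (hz : w.valuation (algebraMap E F c * x ^ e) = 1) {W : ValuationSubring FQ}
    (hW : Extends w W) (hα : W.valuation α = 1)
    (hres : res W α = res W (algebraMap F FQ (algebraMap E F c * x ^ e))) :
    ∃ u : W, (u : FQ) = α⁻¹ * algebraMap F FQ (algebraMap E F c * x ^ e) ∧
      IsLocalRing.residue W u = 1 := by
  have h1 : W.valuation (algebraMap F FQ (algebraMap E F c * x ^ e)) = 1 :=
    hW.valuation_eq_one_iff.2 hz
  have h2 : W.valuation α⁻¹ = 1 := by rw [map_inv₀, hα, inv_one]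
  have h3 := mem_of_valuation_eq_one (v := W) (x := α⁻¹ *
    algebraMap F FQ (algebraMap E F c * x ^ e)) (by rw [map_mul, h1, h2, one_mul])
  refine ⟨⟨_, h3⟩, rfl, ?_⟩
  rw [← res_coe]
  rw [res_mul (mem_of_valuation_eq_one h2) (mem_of_valuation_eq_one h1), res_inv hα, ← hres]
  exact inv_mul_cancel₀ (res_ne_zero_iff.2 hα)

theorem existsUnique_extends (T : IsLiftTower v x c e Q α l) (h : Extends v w)
    (hz : w.valuation (algebraMap E F c * x ^ e) = 1)
    (hroot : (Q.map (IsLocalRing.residue v)).eval₂ (resMap h)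
      (res w (algebraMap E F c * x ^ e)) = 0) :
    ∃! W : ValuationSubring F', Extends w W ∧ W.valuation (l * algebraMap F F' x) = 1 ∧
      res W (l * algebraMap F F' x) = 1 := by
  obtain ⟨W₀, ⟨hW₀, hα₀, hres₀⟩, huniq⟩ := T.existsUnique_extends_root h hz hroot
  obtain ⟨u, hu, hu1⟩ := exists_unit_residue_eq_one hz hW₀ hα₀ hres₀
  have H := T.power_generator (h.trans hW₀) hu hu1
  obtain ⟨W, hW, hl, hres⟩ := H.exists_extends
  rw [map_one, res_one] at hres
  refine ⟨W, ⟨hW₀.trans hW, ?_, hres⟩, ?_⟩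
  · rw [← res_ne_zero_iff, hres]; exact one_ne_zero
  · rintro W' ⟨hW', hl', hres'⟩
    obtain ⟨h1, h2, h3⟩ := T.comap_root hz hW' hl' hres'
    have h4 := huniq _ ⟨h3, h2, h1⟩
    exact H.unique h4 (mem_of_valuation_eq_one hl') (by rw [hres', map_one, res_one]) hW hl
      (by rw [hres, map_one, res_one])

theorem resMap_surjective (T : IsLiftTower v x c e Q α l) (h : Extends v w)
    (hz : w.valuation (algebraMap E F c * x ^ e) = 1)
    (hroot : (Q.map (IsLocalRing.residue v)).eval₂ (resMap h)
      (res w (algebraMap E F c * x ^ e)) = 0)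
    {W : ValuationSubring F'} (hW : Extends w W) (h1 : W.valuation (l * algebraMap F F' x) = 1)
    (h2 : res W (l * algebraMap F F' x) = 1) : Function.Surjective (resMap hW) := by
  obtain ⟨hres, hα, h3⟩ := T.comap_root hz hW h1 h2
  obtain ⟨u, hu, hu1⟩ := exists_unit_residue_eq_one hz h3 hα hres
  have H := T.power_generator (h.trans h3) hu hu1
  have hC := Extends.comap_self (L := FQ) W
  have s1 := H.resMap_surjective hC (mem_of_valuation_eq_one h1) (by rw [h2, map_one, res_one])
  have s2 := (T.root_generator h hz hroot).resMap_surjective h3 (mem_of_valuation_eq_one hα) hres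
  intro y
  obtain ⟨b, rfl⟩ := s1 y
  obtain ⟨a, rfl⟩ := s2 b
  exact ⟨a, h3.resMap_trans hC hW a⟩

end IsLiftTower

end LiftTower

/-! ### Multiplicities of roots -/

section Multiplicities

/-- A root of a separable `q` is simple, and the cofactor of the exact power of an irreducible `q`
is coprime to `q`, so `β` is not a root of it. -/
theorem exists_eq_pow_mul_of_separable {k M : Type*} [Field k] [Field M] (ι : k →+* M) {q P : k[X]}
    (hirr : Irreducible q) (hsep : q.Separable) {r : ℕ} (hr : q ^ r ∣ P)
    (hr' : ¬ q ^ (r + 1) ∣ P) {β : M} (hβ : q.eval₂ ι β = 0) :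
    ∃ h : M[X], P.map ι = (X - C β) ^ r * h ∧ h.eval β ≠ 0 := by
  obtain ⟨u, rfl⟩ := hr
  have hu : u.eval₂ ι β ≠ 0 := by
    intro h0
    have hcop : IsCoprime q u := by
      rw [hirr.coprime_iff_not_dvd]
      rintro ⟨s, rfl⟩
      exact hr' ⟨s, by ring⟩
    obtain ⟨a, b, hab⟩ := hcop
    have := congrArg (eval₂ ι β) hab
    simp [eval₂_add, eval₂_mul, h0, hβ] at this
  have hroot : (q.map ι).IsRoot β := by rwa [IsRoot, eval_map]
  obtain ⟨q₁, hq₁⟩ := dvd_iff_isRoot.2 hroot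
  have hq₁β : q₁.eval β ≠ 0 := by
    intro h0
    have h1 := hsep.eval₂_derivative_ne_zero ι hβ
    rw [← eval_map, ← derivative_map, hq₁] at h1
    simp [h0] at h1
  refine ⟨q₁ ^ r * u.map ι, ?_, ?_⟩
  · rw [Polynomial.map_mul, Polynomial.map_pow, hq₁, mul_pow]; ring
  · rw [eval_mul, eval_pow, eval_map]
    exact mul_ne_zero (pow_ne_zero _ hq₁β) hu

/-- The factor `X - β` becomes `β(X^e - 1) = (X - 1) · β(1 + X + ... + X^(e-1))`, and the last
factor takes the nonzero value `βe` at `1`. So the substitution keeps the multiplicity. -/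
theorem exists_comp_eq_pow_mul {M : Type*} [Field M] {β : M} (hβ : β ≠ 0) {e : ℕ}
    (he : (e : M) ≠ 0) {P h : M[X]} {r : ℕ} (hP : P = (X - C β) ^ r * h) (hh : h.eval β ≠ 0)
    (n : ℕ) : ∃ h' : M[X], X ^ n * P.comp (C β * X ^ e) = (X - C 1) ^ r * h' ∧ h'.eval 1 ≠ 0 := by
  refine ⟨X ^ n * (C β * ∑ i ∈ Finset.range e, X ^ i) ^ r * h.comp (C β * X ^ e), ?_, ?_⟩
  · have h1 : (C β * X ^ e - C β : M[X]) =
        (X - C 1) * (C β * ∑ i ∈ Finset.range e, X ^ i) := by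
      have := geom_sum_mul (X : M[X]) e
      rw [C_1]
      linear_combination (-C β) * this
    rw [hP, mul_comp, pow_comp, sub_comp, X_comp, C_comp, h1, mul_pow]
    ring
  · simp only [eval_mul, eval_pow, eval_X, one_pow, one_mul, eval_C, eval_comp, mul_one,
      eval_finsetSum, Finset.sum_const, Finset.card_range, nsmul_eq_mul]
    exact mul_ne_zero (pow_ne_zero _ (mul_ne_zero hβ he)) hh

theorem rootMultiplicity_eq_of_eq_pow_mul {M : Type*} [Field M] {β : M} {p h : M[X]} {r : ℕ}
    (hp : p = (X - C β) ^ r * h) (hh : h.eval β ≠ 0) : p ≠ 0 ∧ p.rootMultiplicity β = r := by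
  have hh0 : h ≠ 0 := by rintro rfl; simp at hh
  have hp0 : p ≠ 0 := by
    rw [hp]; exact mul_ne_zero (pow_ne_zero _ (X_sub_C_ne_zero β)) hh0
  refine ⟨hp0, ?_⟩
  rw [hp, rootMultiplicity_mul (hp ▸ hp0), rootMultiplicity_X_sub_C_pow,
    rootMultiplicity_eq_zero (by rwa [IsRoot]), add_zero]

/-- A root of multiplicity at least `r` uses up the whole degree, leaving a constant cofactor. -/
theorem mult_lt_or_isPurelyInsepPoly {k : Type*} [Field k] {p : k[X]} {r : ℕ} (hr : 0 < r)
    (hp : p.natDegree ≤ r) : (∀ m ∈ Mult p, m < r) ∨ IsPurelyInsepPoly p r := by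
  by_cases h0 : p = 0
  · left
    rintro m ⟨β, -, rfl⟩
    simpa [h0] using hr
  rw [or_iff_not_imp_left]
  intro h
  push Not at h
  obtain ⟨m, ⟨β, -, rfl⟩, hm⟩ := h
  have hp0 : p.map (algebraMap k (AlgebraicClosure k)) ≠ 0 :=
    (Polynomial.map_ne_zero_iff (algebraMap k (AlgebraicClosure k)).injective).2 h0
  obtain ⟨s, hs⟩ := (le_rootMultiplicity_iff hp0).1 hm
  have hs0 : s ≠ 0 := by rintro rfl; exact hp0 (by rw [hs, mul_zero])
  have hdeg := congrArg natDegree hs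
  rw [natDegree_map, natDegree_mul (pow_ne_zero _ (X_sub_C_ne_zero β)) hs0, natDegree_pow,
    natDegree_X_sub_C, mul_one] at hdeg
  have hs1 := eq_C_of_natDegree_eq_zero (show s.natDegree = 0 by omega)
  refine ⟨s.coeff 0, β, ?_, ?_⟩
  · rintro h1
    rw [h1, C_0] at hs1
    exact hs0 hs1
  · rw [hs, mul_comm, ← hs1]

end Multiplicities

/-! ### Reduction of the scaled and shifted polynomial -/

section ScaledPolynomial

variable {E F F' : Type*} [Field E] [Field F] [Field F'] [Algebra E F]
  [Algebra F F'] [Algebra E F'] [IsScalarTower E F F']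
  {v : ValuationSubring E} {f : E[X]} {x : F} {S : Finset ℕ} {w : ValuationSubring F}
  {W : ValuationSubring F'} {l : F'} {c : E} {e r : ℕ}

theorem scalePoly_coeff {E K : Type*} [Field E] [Field K] [Algebra E K] (f : E[X]) (l : K) (i : ℕ) :
    (scalePoly f l).coeff i = algebraMap E K (f.coeff i) * (l⁻¹) ^ i := by
  rw [scalePoly, comp_C_mul_X_coeff, coeff_map]

/-- As `l x` is a unit, the normalized coefficient `b i` has the value of the quotient of the `i`-th
term of `f(x)` by the one of index `first S`. It is integral always and residually zero off `S`. On
`S`, the relation `l^e = α⁻¹ c` turns it into the coefficient of `resPoly` times a power of `α`. -/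
theorem exists_scaled_polynomial (hw : w ∈ OmegaS v f x S) (hS : 2 ≤ S.card) (hx : x ≠ 0)
    (hc : c ∈ Scale v f x S) (hvW : Extends v W) (hW : Extends w W)
    (h1 : W.valuation (l * algebraMap F F' x) = 1) {α : F'}
    (hα : W.valuation α = 1) (hl : l ^ expo v f x S = α⁻¹ * algebraMap E F' c) :
    ∃ p : W[X], p.map (algebraMap W F') =
        C ((algebraMap E F' (f.coeff (first S)))⁻¹ * l ^ first S) * scalePoly f l ∧
      p.map (IsLocalRing.residue W) =
        X ^ first S * ((resPoly v f x S c).map (resMap hvW)).comp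
          (C (res W α) * X ^ expo v f x S) := by
  have hSne : S.Nonempty := Finset.card_pos.1 (by omega)
  have hi0 := first_mem hSne
  have ha0 := OmegaS.coeff_ne_zero hw hS hx hi0
  have ha0' : algebraMap E F' (f.coeff (first S)) ≠ 0 := by simpa using ha0
  have hl0 : l ≠ 0 := by rintro rfl; simp at h1
  have hx0 : algebraMap F F' x ≠ 0 := by simpa using hx
  have hα0 : α ≠ 0 := by rintro rfl; simp at hα
  have hc0 : algebraMap E F' c ≠ 0 := by simpa using hc.1
  set b : ℕ → F' := fun i => (algebraMap E F' (f.coeff (first S)))⁻¹ * l ^ first S *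
    (algebraMap E F' (f.coeff i) * (l⁻¹) ^ i) with hb
  have hterm : ∀ i, algebraMap F F' (algebraMap E F (f.coeff i) * x ^ i) =
      algebraMap E F' (f.coeff i) * (l⁻¹) ^ i * (l * algebraMap F F' x) ^ i := fun i => by
    rw [map_mul, map_pow, ← IsScalarTower.algebraMap_apply E F F', mul_pow, inv_pow]
    field_simp
  have hval : ∀ i, W.valuation (algebraMap F F' (algebraMap E F (f.coeff i) * x ^ i)) =
      W.valuation (b i) * W.valuation (algebraMap F F' (algebraMap E F (f.coeff (first S)) *
        x ^ first S)) := fun i => by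
    rw [hterm, hterm, ← map_mul, hb]
    have : (algebraMap E F' (f.coeff (first S)))⁻¹ * l ^ first S *
      (algebraMap E F' (f.coeff i) * (l⁻¹) ^ i) * (algebraMap E F' (f.coeff (first S)) * (l⁻¹) ^ first S *
        (l * algebraMap F F' x) ^ first S) = algebraMap E F' (f.coeff i) * (l⁻¹) ^ i *
          (l * algebraMap F F' x) ^ first S := by
      rw [inv_pow l (first S)]
      field_simp
    rw [this, map_mul, map_mul _ _ ((l * algebraMap F F' x) ^ first S), map_pow _ (l * _),
      map_pow _ (l * _), h1, one_pow, one_pow]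
  have hpos : 0 < W.valuation (algebraMap F F' (algebraMap E F (f.coeff (first S)) *
        x ^ first S)) := by
    rw [zero_lt_iff, Valuation.ne_zero_iff]
    simpa [hx] using ha0
  have hbW : ∀ i, b i ∈ W := fun i => by
    rw [mem_iff_valuation_le_one, ← mul_le_mul_iff_left₀ hpos, ← hval, one_mul, hW.valuation_le_iff]
    exact OmegaS.valuation_le hw hi0 i
  have hbS : ∀ i ∈ Finset.range (f.natDegree + 1), i ∉ S → res W (b i) = 0 := fun i hi hiS => by
    rw [res_eq_zero_iff (hbW i), ← mul_lt_mul_iff_left₀ hpos, ← hval, one_mul, hW.valuation_lt_iff]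
    exact OmegaS.valuation_lt hw hi0 hiS (by simpa [Nat.lt_succ_iff] using hi)
  refine ⟨∑ i ∈ Finset.range (f.natDegree + 1), monomial i ⟨b i, hbW i⟩, ?_, ?_⟩
  · ext i
    rw [coeff_C_mul, scalePoly_coeff, coeff_map, finsetSum_coeff]
    simp only [coeff_monomial, Finset.sum_ite_eq', Finset.mem_range]
    split_ifs with hi
    · rfl
    · rw [coeff_eq_zero_of_natDegree_lt (show f.natDegree < i by omega)]; simp
  · have hL : (∑ i ∈ Finset.range (f.natDegree + 1), monomial i (⟨b i, hbW i⟩ : W)).map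
        (IsLocalRing.residue W) = ∑ i ∈ S, monomial i (res W (b i)) := by
      rw [Polynomial.map_sum]
      symm
      refine Finset.sum_subset_zero_on_sdiff (fun i hi => ?_) (fun i hi => ?_) (fun i hi => ?_)
      · simpa [Nat.lt_succ_iff] using OmegaS.le_natDegree hw hi
      · rw [Finset.mem_sdiff] at hi
        rw [map_monomial, ← res_coe]
        simp [hbS i hi.1 hi.2]
      · rw [map_monomial, ← res_coe]
    rw [hL, resPoly, Polynomial.map_sum, comp, eval₂_finsetSum, Finset.mul_sum]
    refine Finset.sum_congr rfl fun i hi => ?_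
    set n := (i - first S) / expo v f x S with hn
    have hin : i = first S + expo v f x S * n := by
      rw [hn, Nat.mul_div_cancel' (expo_dvd_sub hw hS hx hi)]
      have := first_le hi
      omega
    have hb1 := valuation_resPoly_coeff hw hS hx hc hi
    have hbv := mem_of_valuation_eq_one hb1
    have hbi : b i = algebraMap E F' (f.coeff i * (f.coeff (first S))⁻¹ * (c ^ n)⁻¹) * α ^ n := by
      have hα' : α ^ n = algebraMap E F' c ^ n * (l ^ (expo v f x S * n))⁻¹ := by
        rw [pow_mul, hl, mul_pow, inv_pow]
        field_simp
      simp only [hb]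
      rw [hα', map_mul, map_mul, map_inv₀, map_inv₀, map_pow]
      conv_lhs => rw [show (l⁻¹) ^ i = (l⁻¹) ^ (first S + expo v f x S * n) by rw [← hin]]
      rw [pow_add, inv_pow, inv_pow]
      field_simp
    rw [hbi, res_mul (hvW.mem_iff.2 hbv) (pow_mem (mem_of_valuation_eq_one hα) _),
      res_pow (mem_of_valuation_eq_one hα), ← hvW.resMap_res hbv, map_monomial, eval₂_monomial,
      mul_pow, ← C_pow, ← pow_mul, ← C_mul_X_pow_eq_monomial, C_mul]
    conv_lhs => rw [show (X : (Res W)[X]) ^ i = X ^ (first S + expo v f x S * n) by rw [← hin]]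
    rw [pow_add]
    ring

/-- The indices of minimal value of `g(y)`, for `g` a multiple of a polynomial over `𝒪_W` whose
reduction has a zero of multiplicity `r` at `0`. -/
theorem le_of_mem_supp {K L : Type*} [Field K] [Field L] [Algebra K L] {g : K[X]} {y : L}
    {W : ValuationSubring L} {p : W[X]} {a : L} (ha : a ≠ 0)
    (hp : p.map (algebraMap W L) = C a * g.map (algebraMap K L)) {r : ℕ} {h : (Res W)[X]}
    (hpr : p.map (IsLocalRing.residue W) = X ^ r * h) (hh : h.eval 0 ≠ 0) (hy0 : y ≠ 0)
    (hy : W.valuation y < 1) {i : ℕ} (hi : i ∈ supp g y W) : i ≤ r := by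
  by_contra! hri
  have hcoeff : ∀ i, W.valuation ((p.coeff i : W) : L) =
      W.valuation a * W.valuation (algebraMap K L (g.coeff i)) := fun i => by
    have := congrArg (fun s => s.coeff i) hp
    simp only [coeff_map, coeff_C_mul] at this
    rw [← map_mul, ← this]
    rfl
  have hr1 : W.valuation ((p.coeff r : W) : L) = 1 := by
    rw [← res_ne_zero_iff, res_coe, ← coeff_map, hpr, coeff_X_pow_mul', if_pos le_rfl, Nat.sub_self,
      coeff_zero_eq_eval_zero]
    exact hh
  have hgr : g.coeff r ≠ 0 := by
    intro h0
    rw [hcoeff, h0] at hr1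
    simp at hr1
  -- The comparison is with the index `r`, where the normalized coefficient is a unit; for `i > r`
  -- the extra powers of `y` are too small.
  have h1 := (mem_supp_iff.1 hi).2 r (le_natDegree_of_ne_zero hgr)
  have hva : 0 < W.valuation a := by
    rw [zero_lt_iff, Valuation.ne_zero_iff]; exact ha
  rw [← mul_le_mul_iff_right₀ hva, map_mul, map_mul, ← mul_assoc, ← mul_assoc, ← hcoeff, ← hcoeff,
    hr1, one_mul, map_pow, map_pow] at h1
  have h2 : W.valuation ((p.coeff i : W) : L) * W.valuation y ^ i ≤ W.valuation y ^ i :=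
    mul_le_of_le_one_left' (mem_iff_valuation_le_one.1 (p.coeff i).2)
  have h3 := h1.trans h2
  refine absurd h3 (not_le.2 ?_)
  refine pow_lt_pow_right_of_lt_one₀ ?_ hy hri
  rw [zero_lt_iff, Valuation.ne_zero_iff]; exact hy0

theorem shiftPoly_eq_comp {E K : Type*} [Field E] [Field K] [Algebra E K] (f : E[X]) (l : K) :
    shiftPoly f l = (scalePoly f l).comp (X + 1) := by
  rw [shiftPoly, scalePoly, comp_assoc, mul_comp, C_comp, X_comp]

end ScaledPolynomial

/-! ### Transport of ruledness along residue embeddings -/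

section Ruled

/-- The ambient `M` may be larger than `A`. It suffices that the image of `A` contains `k'` and `z`
and lies in `k'(z)`, for then `A` is isomorphic to `k'(z)`. -/
theorem isRuled_of_algHom {k A M : Type*} [Field k] [Field A] [Field M] [Algebra k A] [Algebra k M]
    (ι : A →ₐ[k] M) (k' : IntermediateField k M) (z : M) (hfin : FiniteDimensional k k')
    (hz : Transcendental k z) (hk' : ∀ b ∈ k', ∃ a, ι a = b) (hz' : ∃ a, ι a = z)
    (hgen : ∀ a, ι a ∈ IntermediateField.adjoin k' {z}) : IsRuled k A := by
  obtain ⟨z₀, rfl⟩ := hz'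
  refine ⟨k'.comap ι, z₀, ?_, ?_, ?_⟩
  · let j : k'.comap ι →ₗ[k] k' :=
      { toFun := fun a => ⟨ι a, a.2⟩
        map_add' := fun a b => Subtype.ext (map_add ι _ _)
        map_smul' := fun a b => Subtype.ext (map_smul ι a (b : A)) }
    refine FiniteDimensional.of_injective j fun a b hab => Subtype.ext (ι.injective ?_)
    exact congrArg Subtype.val hab
  · intro h
    exact hz (h.algHom ι)
  · have h2 : ι '' ((k'.comap ι : Set A) ∪ {z₀}) = (k' : Set M) ∪ {ι z₀} := by
      rw [Set.image_union, Set.image_singleton]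
      congr 1
      ext b
      constructor
      · rintro ⟨a, ha, rfl⟩
        exact ha
      · intro hb
        obtain ⟨a, rfl⟩ := hk' b hb
        exact ⟨a, hb, rfl⟩
    refine eq_top_iff.2 fun a _ => ?_
    rw [← IntermediateField.mem_restrictScalars (K := k), IntermediateField.restrictScalars_adjoin]
    have h3 := hgen a
    rw [← IntermediateField.mem_restrictScalars (K := k), IntermediateField.restrictScalars_adjoin,
      ← h2, ← IntermediateField.adjoin_map] at h3
    obtain ⟨b, hb, hba⟩ := h3
    rwa [← ι.injective hba]

theorem IsRuled.of_algEquiv {k A M : Type*} [Field k] [Field A] [Field M] [Algebra k A]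
    [Algebra k M] (φ : A ≃ₐ[k] M) (h : IsRuled k M) : IsRuled k A := by
  obtain ⟨k', z, hfin, hz, hgen⟩ := h
  exact isRuled_of_algHom (φ : A →ₐ[k] M) k' z hfin hz (fun b _ => ⟨_, φ.apply_symm_apply b⟩)
    ⟨_, φ.apply_symm_apply z⟩ fun a => hgen ▸ IntermediateField.mem_top

variable {E F F' : Type*} [Field E] [Field F] [Field F'] [Algebra E F]
  [Algebra F F'] [Algebra E F'] [IsScalarTower E F F']
  {v : ValuationSubring E} {w : ValuationSubring F} {W : ValuationSubring F'}

theorem mem_omega_iff_of_surjective (hW : Extends w W) (hvw : Extends v w) (hvW : Extends v W)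
    (hs : Function.Surjective (resMap hW)) :
    (w ∈ Omega v F ↔ W ∈ Omega v F') ∧ (w ∈ OmegaStar v F ↔ W ∈ OmegaStar v F') := by
  let _ := (resMap hvw).toAlgebra
  let _ := (resMap hvW).toAlgebra
  let φ : Res w ≃ₐ[Res v] Res W :=
    { RingEquiv.ofBijective (resMap hW) ⟨(resMap hW).injective, hs⟩ with
      commutes' := fun a => (hvw.resMap_trans hW hvW a).symm }
  have h1 : Algebra.Transcendental (Res v) (Res w) ↔ Algebra.Transcendental (Res v) (Res W) := by
    rw [Algebra.transcendental_iff_not_isAlgebraic, Algebra.transcendental_iff_not_isAlgebraic,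
      φ.isAlgebraic_iff]
  have h2 : IsRuled (Res v) (Res w) ↔ IsRuled (Res v) (Res W) :=
    ⟨fun h => h.of_algEquiv φ.symm, fun h => h.of_algEquiv φ⟩
  have h3 : w ∈ Omega v F ↔ W ∈ Omega v F' :=
    ⟨fun ⟨_, h⟩ => ⟨hvW, h1.1 h⟩, fun ⟨_, h⟩ => ⟨hvw, h1.2 h⟩⟩
  exact ⟨h3, fun ⟨h, _, h'⟩ => ⟨h3.1 h, hvW, fun h4 => h' (h2.2 h4)⟩,
    fun ⟨h, _, h'⟩ => ⟨h3.2 h, hvw, fun h4 => h' (h2.1 h4)⟩⟩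

end Ruled

/-! ### Transcendence degree one -/

section TranscendenceDegree

theorem isAlgebraic_adjoin_of_trdeg_eq_one {E N : Type*} [Field E] [Field N] [Algebra E N]
    (h : Algebra.trdeg E N = 1) {y : N} (hy : Transcendental E y) (u : N) :
    IsAlgebraic (IntermediateField.adjoin E {y}) u := by
  have hi : AlgebraicIndependent E fun _ : Unit => y := algebraicIndependent_unique_type_iff.2 hy
  have hb := hi.isTranscendenceBasis_of_lift_trdeg_le_of_finite (by rw [h]; simp)
  have := hb.isAlgebraic_field
  rw [Set.range_const] at this
  exact this.isAlgebraic u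

theorem trdeg_eq_one_of_isAlgebraic {E F N : Type*} [Field E] [Field F] [Field N] [Algebra E F]
    [Algebra F N] [Algebra E N] [IsScalarTower E F N] [Algebra.IsAlgebraic F N]
    (h : Algebra.trdeg E F = 1) : Algebra.trdeg E N = 1 := by
  have := lift_trdeg_add_eq E F N
  rw [h, trdeg_eq_zero] at this
  simpa using this.symm

end TranscendenceDegree

/-! ### Square roots close to one add no residues -/

section SquareRoots

/-- If `d` is a square in `K`, then `η ∈ K`. Otherwise `X² - d` is irreducible and reduces to `X² -
1`, of which `1` is a simple root since `2` is a unit; so `resMap_surjective` applies to the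
generator `η`. -/
theorem exists_res_eq_of_sq {K N : Type*} [Field K] [Field N] [Algebra K N]
    (V : ValuationSubring N) (h2 : V.valuation 2 = 1) {η : N} {d : K}
    (hd : η ^ 2 = algebraMap K N d) (hη : V.valuation (η - 1) < 1) {a : N}
    (ha : a ∈ IntermediateField.adjoin K {η}) (haV : a ∈ V) :
    ∃ b : K, algebraMap K N b ∈ V ∧ res V (algebraMap K N b) = res V a := by
  by_cases h : ∃ b, b ^ 2 = d
  · obtain ⟨b, rfl⟩ := h
    have h3 : η ∈ (⊥ : IntermediateField K N) := by
      rw [IntermediateField.mem_bot]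
      rw [map_pow, sq_eq_sq_iff_eq_or_eq_neg] at hd
      rcases hd with rfl | rfl
      · exact ⟨b, rfl⟩
      · exact ⟨-b, map_neg _ _⟩
    rw [IntermediateField.adjoin_simple_eq_bot_iff.2 h3, IntermediateField.mem_bot] at ha
    obtain ⟨b', rfl⟩ := ha
    exact ⟨b', haV, rfl⟩
  push Not at h
  have hKN := Extends.comap_self (L := K) V
  have hLN := Extends.comap_self (L := IntermediateField.adjoin K {η}) V
  have hKL : Extends (V.comap (algebraMap K N))
    (V.comap (algebraMap (IntermediateField.adjoin K {η}) N)) := hKN.comap_right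
  have hη1 : V.valuation η = 1 := by
    have : η = 1 + (η - 1) := by ring
    rw [this]
    exact Valuation.map_one_add_of_lt _ hη
  have hηV := mem_of_valuation_eq_one hη1
  have hηres : res V η = 1 := (res_eq_one_iff hηV).2 hη
  have hdV : algebraMap K N d ∈ V := hd ▸ pow_mem hηV 2
  have hdK : d ∈ V.comap (algebraMap K N) := hdV
  have hdres : res (V.comap (algebraMap K N)) d = 1 := by
    refine (resMap hKN).injective ?_
    rw [hKN.resMap_res hdK, ← hd, res_pow hηV, hηres, one_pow, map_one]
  have hgen : (IntermediateField.AdjoinSimple.gen K η) ∈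
      V.comap (algebraMap (IntermediateField.adjoin K {η}) N) := hηV
  have hgenres : res (V.comap (algebraMap (IntermediateField.adjoin K {η}) N))
      (IntermediateField.AdjoinSimple.gen K η) = 1 := by
    refine (resMap hLN).injective ?_
    rw [hLN.resMap_res hgen, map_one]
    exact hηres
  have h2res : (2 : Res (V.comap (algebraMap K N))) ≠ 0 := by
    intro h0
    have h1 := congrArg (resMap hKN) h0
    rw [map_ofNat, map_zero] at h1
    have h3 := res_ne_zero_iff.2 h2
    rw [show (2 : N) = ((2 : ℕ) : N) by simp, res_natCast] at h3
    exact h3 (by simpa using h1)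
  have H : IsSimpleRootGenerator (V.comap (algebraMap K N))
      (X ^ 2 - C (⟨d, hdK⟩ : V.comap (algebraMap K N))) 1
      (IntermediateField.AdjoinSimple.gen K η) :=
    { monic := monic_X_pow_sub_C _ two_ne_zero
      irreducible := by
        rw [Polynomial.map_sub, Polynomial.map_pow, map_X, map_C]
        exact X_pow_sub_C_irreducible_of_prime Nat.prime_two h
      root := by
        rw [map_sub, map_pow, aeval_X, aeval_C, sub_eq_zero]
        exact Subtype.ext hd
      adjoin := by
        rw [← IntermediateField.lift_inj, IntermediateField.lift_top,
          IntermediateField.lift_adjoin_simple]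
        rfl
      mem := one_mem _
      eval_res := by
        rw [Polynomial.map_sub, Polynomial.map_pow, map_X, map_C, ← res_coe, res_one]
        simp [hdres]
      eval_derivative_res := by
        rw [Polynomial.map_sub, Polynomial.map_pow, map_X, map_C, res_one]
        simpa [one_add_one_eq_two] using h2res }
  obtain ⟨z, hz⟩ := H.resMap_surjective hKL hgen (by rw [hgenres, map_one, res_one])
    (res (V.comap (algebraMap (IntermediateField.adjoin K {η}) N)) ⟨a, ha⟩)
  obtain ⟨b, hb, rfl⟩ := exists_res_eq z
  refine ⟨b, hb, ?_⟩
  have := congrArg (resMap hLN) hz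
  rw [hKL.resMap_res hb, hLN.resMap_res (hKL.mem_iff.2 hb),
    hLN.resMap_res (show _ ∈ V.comap _ from haV)] at this
  exact this

end SquareRoots

/-! ### Ruled residues for quadratic extensions with one dominant term -/

section QuadraticRuled

variable {E F' N : Type*} [Field E] [Field F'] [Field N] [Algebra E F'] [Algebra F' N]
  [Algebra E N] [IsScalarTower E F' N]
  {v : ValuationSubring E} {W : ValuationSubring F'} {V : ValuationSubring N}

/-- Neither of `F'` and `K(Z)` need contain the other; only their residues inside `Res V` are
compared. The ruled residue theorem for `K(Z)` then describes the residue field of `F'`. -/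
theorem isRuled_of_residues_eq (hvW : Extends v W) (hWV : Extends W V)
    (htr : Algebra.trdeg E N = 1) (K : IntermediateField E N) [FiniteDimensional E K] (Z : N)
    (hMF : ∀ u ∈ IntermediateField.adjoin K {Z}, u ∈ V →
      ∃ a : F', algebraMap F' N a ∈ V ∧ res V (algebraMap F' N a) = res V u)
    (hFM : ∀ a : F', algebraMap F' N a ∈ V →
      ∃ u ∈ IntermediateField.adjoin K {Z}, u ∈ V ∧ res V u = res V (algebraMap F' N a))
    (htrans : letI := (resMap hvW).toAlgebra; Algebra.Transcendental (Res v) (Res W)) :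
    letI := (resMap hvW).toAlgebra; IsRuled (Res v) (Res W) := by
  have hvV := hvW.trans hWV
  let _ : Algebra (Res v) (Res W) := (resMap hvW).toAlgebra
  let _ : Algebra (Res v) (Res V) := (resMap hvV).toAlgebra
  let ι : Res W →ₐ[Res v] Res V :=
    { resMap hWV with commutes' := fun a => (hvW.resMap_trans hWV hvV a).symm }
  have hι : ∀ a, ι a = resMap hWV a := fun _ => rfl
  have hback : ∀ u ∈ IntermediateField.adjoin K {Z}, u ∈ V → ∃ a, ι a = res V u := by
    intro u hu huV
    obtain ⟨a, haV, ha⟩ := hMF u hu huV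
    exact ⟨res W a, by rw [hι, hWV.resMap_res (hWV.mem_iff.1 haV), ha]⟩
  have hforth : ∀ a, ∃ u ∈ IntermediateField.adjoin K {Z}, u ∈ V ∧ res V u = ι a := by
    intro a
    obtain ⟨b, hb, rfl⟩ := exists_res_eq a
    obtain ⟨u, hu, huV, h⟩ := hFM b (hWV.mem_iff.2 hb)
    exact ⟨u, hu, huV, by rw [h, hι, hWV.resMap_res hb]⟩
  obtain ⟨k', z, hfin, hz, hk', ⟨u, hu, huV, hzu⟩, hgen⟩ := exists_ruled_residues (K := K) hvV
    (fun _ => rfl) Z (fun y hy u => isAlgebraic_adjoin_of_trdeg_eq_one htr hy u) (by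
      obtain ⟨a, ha⟩ := htrans
      obtain ⟨u, hu, huV, h⟩ := hforth a
      refine ⟨u, hu, huV, ?_⟩
      rw [h]
      exact fun h' => ha ((isAlgebraic_algHom_iff ι ι.injective).1 h'))
  refine isRuled_of_algHom ι k' z hfin hz (fun b hb => ?_) ?_ fun a => ?_
  · obtain ⟨u, hu, huV, rfl⟩ := hk' b hb
    exact hback u hu huV
  · rw [← hzu]; exact hback u hu huV
  · obtain ⟨u, hu, huV, h⟩ := hforth a
    rw [← h]
    exact hgen u hu huV

theorem algebraMap_mem_of_adjoin_eq_top {E' : IntermediateField E F'} {T : Set F'}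
    (htop : IntermediateField.adjoin E' T = ⊤) (M : IntermediateField E N)
    (hE' : ∀ a ∈ E', algebraMap F' N a ∈ M) (hT : ∀ a ∈ T, algebraMap F' N a ∈ M) (a : F') :
    algebraMap F' N a ∈ M := by
  have h1 : a ∈ (IntermediateField.adjoin E' T).restrictScalars E := by
    rw [htop]; exact IntermediateField.mem_top
  rw [IntermediateField.restrictScalars_adjoin] at h1
  have h2 : IntermediateField.adjoin E ((E' : Set F') ∪ T) ≤
      M.comap (IsScalarTower.toAlgHom E F' N) :=
    IntermediateField.adjoin_le_iff.2 fun b hb => hb.elim (hE' b) (hT b)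
  exact h2 h1

theorem mem_of_mem_adjoin {K : IntermediateField E N} {Z : N} {M : IntermediateField E N}
    (hK : K ≤ M) (hZ : Z ∈ M) {u : N} (hu : u ∈ IntermediateField.adjoin K {Z}) : u ∈ M := by
  rw [← IntermediateField.mem_restrictScalars (K := E),
    IntermediateField.restrictScalars_adjoin] at hu
  have h2 : IntermediateField.adjoin E ((K : Set N) ∪ {Z}) ≤ M :=
    IntermediateField.adjoin_le_iff.2 (Set.union_subset hK (Set.singleton_subset_iff.2 hZ))
  exact h2 hu

theorem algebraMap_aeval_mem {E' : IntermediateField E F'} (g : E'[X]) {y : F'}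
    (M : IntermediateField E N) (hE' : ∀ a ∈ E', algebraMap F' N a ∈ M)
    (hy : algebraMap F' N y ∈ M) : algebraMap F' N (aeval y g) ∈ M := by
  rw [aeval_eq_sum_range, map_sum]
  refine sum_mem fun i _ => ?_
  rw [Algebra.smul_def, map_mul, map_pow]
  exact mul_mem (hE' _ (g.coeff i).2) (pow_mem hy i)

/-- If `y ^ 2 = g(x₁)` and `y = η u`, where `η` is close to `1`, then `E'(x₁, y)` has the same
residues as the field `K(Z)` containing `x₁` and `u`. -/
theorem isRuled_of_eq_mul (hvW : Extends v W) (hWV : Extends W V)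
    (htr : Algebra.trdeg E N = 1) {E' : IntermediateField E F'} {g : E'[X]} {x₁ y : F'}
    (hy : y ^ 2 = aeval x₁ g) (htop : IntermediateField.adjoin E' {x₁, y} = ⊤)
    (h2 : V.valuation 2 = 1) (K : IntermediateField E N) [FiniteDimensional E K] {Z η u : N}
    (hη : V.valuation (η - 1) < 1) {d : F'} (hd : η ^ 2 = algebraMap F' N d)
    (hE'K : ∀ a ∈ E', algebraMap F' N a ∈ K)
    (hx₁ : algebraMap F' N x₁ ∈ IntermediateField.adjoin K {Z})
    (hu : u ∈ IntermediateField.adjoin K {Z}) (hyu : algebraMap F' N y = η * u) (hu0 : u ≠ 0)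
    (hK : ∀ a ∈ K, a ∈ IntermediateField.adjoin F' {η})
    (hZ : Z ∈ IntermediateField.adjoin F' {η})
    (htrans : letI := (resMap hvW).toAlgebra; Algebra.Transcendental (Res v) (Res W)) :
    letI := (resMap hvW).toAlgebra; IsRuled (Res v) (Res W) := by
  have hKmem : ∀ a ∈ K, a ∈ IntermediateField.adjoin K {Z} := fun a ha =>
    IntermediateField.algebraMap_mem (IntermediateField.adjoin K {Z}) (⟨a, ha⟩ : K)
  -- Here `η² = g(x₁)/u²`. So `η` is quadratic over `K(Z)` as well as over `F'`, and adjoining it to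
  -- either one adds no residues.
  have hη2 : η ^ 2 ∈ IntermediateField.adjoin K {Z} := by
    have h3 : η ^ 2 = algebraMap F' N (aeval x₁ g) / u ^ 2 := by
      rw [← hy, map_pow, hyu]
      field_simp
    rw [h3]
    refine div_mem ?_ (pow_mem hu 2)
    exact algebraMap_aeval_mem g ((IntermediateField.adjoin K {Z}).restrictScalars E)
      (fun a ha => hKmem _ (hE'K a ha)) hx₁
  refine isRuled_of_residues_eq hvW hWV htr K Z (fun a ha haV => ?_) (fun a haV => ?_) htrans
  · refine exists_res_eq_of_sq V h2 hd hη ?_ haV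
    exact mem_of_mem_adjoin (M := (IntermediateField.adjoin F' {η}).restrictScalars E) hK hZ ha
  · set M := (IntermediateField.adjoin K {Z}).restrictScalars E with hM
    have hmem : ∀ b ∈ M, b ∈ IntermediateField.adjoin M {η} := fun b hb =>
      IntermediateField.algebraMap_mem (IntermediateField.adjoin M {η}) (⟨b, hb⟩ : M)
    have ha : algebraMap F' N a ∈ IntermediateField.adjoin M {η} := by
      refine algebraMap_mem_of_adjoin_eq_top htop
        ((IntermediateField.adjoin M {η}).restrictScalars E)
        (fun b hb => hmem _ (hKmem _ (hE'K b hb))) ?_ a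
      rintro b (rfl | rfl)
      · exact hmem _ hx₁
      · rw [hyu]
        exact mul_mem (IntermediateField.mem_adjoin_simple_self _ η) (hmem _ hu)
    obtain ⟨b, hb, hb'⟩ := exists_res_eq_of_sq (K := M) V h2 (d := ⟨η ^ 2, hη2⟩) rfl hη ha haV
    exact ⟨b, b.2, hb, hb'⟩

/-- The function field of a conic with a linear term. -/
theorem isRuled_of_natDegree_eq_one (hvW : Extends v W) (hWV : Extends W V)
    (htr : Algebra.trdeg E N = 1) {E' : IntermediateField E F'} [FiniteDimensional E E'] {g : E'[X]}
    {x₁ y : F'} (hy : y ^ 2 = aeval x₁ g) (htop : IntermediateField.adjoin E' {x₁, y} = ⊤)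
    (hg : g.natDegree = 1)
    (htrans : letI := (resMap hvW).toAlgebra; Algebra.Transcendental (Res v) (Res W)) :
    letI := (resMap hvW).toAlgebra; IsRuled (Res v) (Res W) := by
  have hfin : FiniteDimensional E (E'.map (IsScalarTower.toAlgHom E F' N)) :=
    (E'.equivMap (IsScalarTower.toAlgHom E F' N)).toLinearEquiv.finiteDimensional
  have hE' : ∀ a ∈ E', algebraMap F' N a ∈ E'.map (IsScalarTower.toAlgHom E F' N) :=
    fun a ha => ⟨a, ha, rfl⟩
  have hKmem : ∀ a ∈ E', algebraMap F' N a ∈ IntermediateField.adjoin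
      (E'.map (IsScalarTower.toAlgHom E F' N)) {algebraMap F' N y} := fun a ha =>
    IntermediateField.algebraMap_mem (IntermediateField.adjoin _ {algebraMap F' N y})
      (⟨_, hE' a ha⟩ : E'.map (IsScalarTower.toAlgHom E F' N))
  -- A linear `g` can be solved for `x₁`, so `F' = E'(y)` is itself a rational function field and `Z
  -- = y` works.
  refine isRuled_of_residues_eq hvW hWV htr (E'.map (IsScalarTower.toAlgHom E F' N))
    (algebraMap F' N y) (fun u hu huV => ?_) (fun a haV => ⟨_, ?_, haV, rfl⟩) htrans
  · obtain ⟨a, ha⟩ := mem_of_mem_adjoin (M := (IsScalarTower.toAlgHom E F' N).fieldRange)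
      (by rintro _ ⟨a, -, rfl⟩; exact ⟨a, rfl⟩) ⟨y, rfl⟩ hu
    exact ⟨a, ha ▸ huV, congrArg (res V) ha⟩
  · refine algebraMap_mem_of_adjoin_eq_top htop ((IntermediateField.adjoin _
      {algebraMap F' N y}).restrictScalars E) hKmem ?_ a
    have hymem := IntermediateField.mem_adjoin_simple_self
      (E'.map (IsScalarTower.toAlgHom E F' N)) (algebraMap F' N y)
    rintro b (rfl | rfl)
    · have h1 : g.coeff 1 ≠ 0 := by
        rw [← hg]
        exact leadingCoeff_ne_zero.2 (by rintro rfl; simp at hg)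
      have h1' : (g.coeff 1 : F') ≠ 0 := by simpa using h1
      rw [aeval_eq_sum_range, hg, Finset.sum_range_succ, Finset.sum_range_one, Algebra.smul_def,
        Algebra.smul_def, pow_zero, pow_one, mul_one] at hy
      have h3 : b = (y ^ 2 - (g.coeff 0 : F')) * (g.coeff 1 : F')⁻¹ := by
        rw [hy]
        change b = ((g.coeff 0 : F') + (g.coeff 1 : F') * b - _) * _
        field_simp
        ring
      rw [h3, map_mul, map_sub, map_pow, map_inv₀]
      exact mul_mem (sub_mem (pow_mem hymem 2) (hKmem _ (g.coeff 0).2))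
        (inv_mem (hKmem _ (g.coeff 1).2))
    · exact hymem

/-- The term `b x₁^j` strictly dominates `g(x₁)`, so `y` is close to a square root `s` of it and `y
= η s` with `η` close to `1`. For even `j`, `s` is a power of `x₁` times `√b`; for odd `j`, it is a
power of `x₁` times `√(b x₁)`. In both cases `s` and `x₁` lie in a rational function field over a
finite extension of `E`. -/
theorem isRuled_of_supp_eq_singleton (hvW : Extends v W) (htr : Algebra.trdeg E F' = 1)
    {E' : IntermediateField E F'} [FiniteDimensional E E'] {g : E'[X]} {x₁ y : F'}
    (hx₁ : x₁ ≠ 0) (hy : y ^ 2 = aeval x₁ g) (htop : IntermediateField.adjoin E' {x₁, y} = ⊤)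
    (hg : g ≠ 0) (h2 : (2 : Res v) ≠ 0) {j : ℕ} (hj : supp g x₁ W = {j})
    (htrans : letI := (resMap hvW).toAlgebra; Algebra.Transcendental (Res v) (Res W)) :
    letI := (resMap hvW).toAlgebra; IsRuled (Res v) (Res W) := by
  obtain ⟨V, hWV⟩ := exists_extends F' (AlgebraicClosure F') W
  have hvV : Extends v V := hvW.trans hWV
  have htr' : Algebra.trdeg E (AlgebraicClosure F') = 1 := trdeg_eq_one_of_isAlgebraic htr
  have hV2 : V.valuation 2 = 1 := by
    rw [← res_ne_zero_iff, show (2 : AlgebraicClosure F') = ((2 : ℕ) : AlgebraicClosure F') by simp,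
      res_natCast, ← map_natCast (resMap hvV)]
    exact (_root_.map_ne_zero _).2 (by simpa using h2)
  have hjmem : j ∈ supp g x₁ W := by rw [hj]; exact Finset.mem_singleton_self j
  have hjmax := mem_supp_iff.1 hjmem
  have hb0 : (g.coeff j : F') ≠ 0 := by
    intro h0
    have := hjmax.2 g.natDegree le_rfl
    rw [show algebraMap E' F' (g.coeff j) = (g.coeff j : F') from rfl, h0, zero_mul, map_zero,
      le_zero_iff] at this
    simp [hx₁, hg] at this
  set b : F' := (g.coeff j : F') with hb
  have hbx : b * x₁ ^ j ≠ 0 := mul_ne_zero hb0 (pow_ne_zero _ hx₁)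
  have hlt : W.valuation (y ^ 2 - b * x₁ ^ j) < W.valuation (b * x₁ ^ j) := by
    have h3 : y ^ 2 - b * x₁ ^ j = ∑ i ∈ (Finset.range (g.natDegree + 1)).erase j,
        algebraMap E' F' (g.coeff i) * x₁ ^ i := by
      rw [hy, aeval_eq_sum_range, ← Finset.add_sum_erase _ _ (Finset.mem_range_succ_iff.2 hjmax.1)]
      simp_rw [Algebra.smul_def]
      exact add_sub_cancel_left _ _
    rw [h3]
    refine Valuation.map_sum_lt _ ((Valuation.ne_zero_iff _).2 hbx) fun i hi => ?_
    obtain ⟨hij, hi⟩ := Finset.mem_erase.1 hi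
    have hin := Finset.mem_range_succ_iff.1 hi
    refine lt_of_le_of_ne (hjmax.2 i hin) fun h => hij ?_
    rw [← Finset.mem_singleton, ← hj, mem_supp_iff]
    exact ⟨hin, fun k hk => (hjmax.2 k hk).trans_eq h.symm⟩
  obtain ⟨s, hs, hη⟩ : ∃ s : AlgebraicClosure F', s ^ 2 = algebraMap F' _ (b * x₁ ^ j) ∧
      V.valuation (algebraMap F' _ y / s - 1) < 1 := by
    obtain ⟨s, hs⟩ := IsAlgClosed.exists_pow_nat_eq
      (algebraMap F' (AlgebraicClosure F') (b * x₁ ^ j)) two_pos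
    -- The product of `y/s - 1` and `y/s + 1` is small, so one factor is; if it is the second, `s`
    -- is replaced by `-s`.
    have h3 : V.valuation ((algebraMap F' _ y / s - 1) * (algebraMap F' _ y / s + 1)) < 1 := by
      have h4 : (algebraMap F' _ y / s - 1) * (algebraMap F' _ y / s + 1) =
          algebraMap F' (AlgebraicClosure F') ((y ^ 2 - b * x₁ ^ j) / (b * x₁ ^ j)) := by
        rw [sub_div, div_self hbx, map_sub, map_div₀, ← hs, map_one, map_pow]
        ring
      rw [h4, hWV.valuation_lt_one_iff, map_div₀]
      exact (div_lt_one₀ (zero_lt_iff.2 ((Valuation.ne_zero_iff _).2 hbx))).2 hlt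
    by_cases h5 : V.valuation (algebraMap F' _ y / s - 1) < 1
    · exact ⟨s, hs, h5⟩
    · refine ⟨-s, by rw [neg_sq, hs], ?_⟩
      rw [div_neg, ← neg_add', Valuation.map_neg]
      by_contra h6
      rw [map_mul] at h3
      exact absurd h3 (not_lt.2 (one_le_mul (not_lt.1 h5) (not_lt.1 h6)))
  have hs0 : s ≠ 0 := by
    rintro rfl
    rw [zero_pow two_ne_zero, eq_comm, _root_.map_eq_zero] at hs
    exact hbx hs
  set η := algebraMap F' (AlgebraicClosure F') y / s with hηdef
  have hη0 : η ≠ 0 := by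
    intro h0
    rw [h0, zero_sub, Valuation.map_neg, map_one] at hη
    exact lt_irrefl _ hη
  have hyη : algebraMap F' (AlgebraicClosure F') y = η * s := by rw [hηdef]; field_simp
  have hd : η ^ 2 = algebraMap F' _ (y ^ 2 / (b * x₁ ^ j)) := by
    rw [hηdef, div_pow, hs, map_div₀, map_pow]
  have hηmem := IntermediateField.mem_adjoin_simple_self F' η
  have hFmem : ∀ a : F', algebraMap F' (AlgebraicClosure F') a ∈ IntermediateField.adjoin F' {η} :=
    fun a => IntermediateField.algebraMap_mem _ a
  have hsmem : s ∈ IntermediateField.adjoin F' {η} := by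
    have h3 : s = algebraMap F' _ y * η⁻¹ := by rw [hyη]; field_simp
    rw [h3]
    exact mul_mem (hFmem y) (inv_mem hηmem)
  have hxN : algebraMap F' (AlgebraicClosure F') x₁ ≠ 0 := by simpa using hx₁
  have hfin : FiniteDimensional E (E'.map (IsScalarTower.toAlgHom E F' (AlgebraicClosure F'))) :=
    (E'.equivMap (IsScalarTower.toAlgHom E F' _)).toLinearEquiv.finiteDimensional
  have hE' : ∀ a ∈ E', algebraMap F' _ a ∈
    E'.map (IsScalarTower.toAlgHom E F' (AlgebraicClosure F')) := fun a ha => ⟨a, ha, rfl⟩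
  have hE'mem : E'.map (IsScalarTower.toAlgHom E F' (AlgebraicClosure F')) ≤
      (IntermediateField.adjoin F' {η}).restrictScalars E := by
    rintro _ ⟨a, -, rfl⟩
    exact hFmem a
  have hbint : IsIntegral E b := (IsIntegral.of_finite E (g.coeff j)).map E'.val
  obtain ⟨k, hk⟩ := Nat.even_or_odd' j
  set t := s / algebraMap F' (AlgebraicClosure F') x₁ ^ k with ht
  have htmem : t ∈ IntermediateField.adjoin F' {η} := div_mem hsmem (pow_mem (hFmem _) _)
  have hst : s = t * algebraMap F' (AlgebraicClosure F') x₁ ^ k := by rw [ht]; field_simp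
  have hKmem : ∀ (K : IntermediateField E (AlgebraicClosure F')) (Z : AlgebraicClosure F'),
      ∀ a ∈ K, a ∈ IntermediateField.adjoin K {Z} := fun K Z a ha =>
    IntermediateField.algebraMap_mem (IntermediateField.adjoin K {Z}) (⟨a, ha⟩ : K)
  rw [map_mul, map_pow, hst, mul_pow] at hs
  rcases hk with hk | hk
  -- Even case: `t = √b` is algebraic over `E`, so it enters the constant field and `Z = x₁`.
  · have ht2 : t ^ 2 = algebraMap F' _ b := by
      rw [hk, mul_comm 2 k, pow_mul] at hs
      exact mul_right_cancel₀ (pow_ne_zero _ (pow_ne_zero _ hxN)) hs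
    have htint : IsIntegral E t := by
      refine IsIntegral.of_pow two_pos ?_
      rw [ht2]
      exact hbint.algebraMap
    have := IntermediateField.adjoin.finiteDimensional htint
    refine isRuled_of_eq_mul hvW hWV htr' hy htop hV2
      (E'.map (IsScalarTower.toAlgHom E F' _) ⊔ IntermediateField.adjoin E {t})
      (Z := algebraMap F' _ x₁) hη hd (fun a ha => ?_)
      (IntermediateField.mem_adjoin_simple_self _ _) ?_ hyη hs0 ?_ (hFmem x₁) htrans
    · exact (le_sup_left : E'.map (IsScalarTower.toAlgHom E F' _) ≤
        _ ⊔ IntermediateField.adjoin E {t}) (hE' a ha)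
    · rw [hst]
      refine mul_mem (hKmem _ _ _ ?_) (pow_mem (IntermediateField.mem_adjoin_simple_self _ _) _)
      exact (le_sup_right : IntermediateField.adjoin E {t} ≤ E'.map (IsScalarTower.toAlgHom E F' _) ⊔
        _) (IntermediateField.mem_adjoin_simple_self E t)
    · exact sup_le hE'mem (IntermediateField.adjoin_le_iff.2 (Set.singleton_subset_iff.2 htmem))
  -- Odd case: `Z = t`, and `x₁ = t²/b` is rational in `t`.
  · have ht2 : t ^ 2 = algebraMap F' _ b * algebraMap F' _ x₁ := by
      refine mul_right_cancel₀ (pow_ne_zero 2 (pow_ne_zero k hxN)) (hs.trans ?_)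
      rw [hk]
      ring
    have hbN : algebraMap F' (AlgebraicClosure F') b ≠ 0 := by simpa using hb0
    have htself := IntermediateField.mem_adjoin_simple_self
      (E'.map (IsScalarTower.toAlgHom E F' (AlgebraicClosure F'))) t
    have hxt : algebraMap F' (AlgebraicClosure F') x₁ ∈ IntermediateField.adjoin
        (E'.map (IsScalarTower.toAlgHom E F' (AlgebraicClosure F'))) {t} := by
      have h3 : algebraMap F' (AlgebraicClosure F') x₁ = t ^ 2 * (algebraMap F' _ b)⁻¹ := by
        rw [ht2]; field_simp
      rw [h3]
      exact mul_mem (pow_mem htself 2) (inv_mem (hKmem _ _ _ (hE' _ (g.coeff j).2)))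
    refine isRuled_of_eq_mul hvW hWV htr' hy htop hV2
      (E'.map (IsScalarTower.toAlgHom E F' _)) (Z := t) hη hd hE' hxt ?_ hyη hs0
      hE'mem htmem htrans
    rw [hst]
    exact mul_mem htself (pow_mem hxt k)

end QuadraticRuled

/-! ### The tower attached to a residue factor -/

section Setup

variable {E F : Type*} [Field E] [Field F] [Algebra E F] {v : ValuationSubring E}
  {f : E[X]} {x : F} {S : Finset ℕ} {w : ValuationSubring F} {c : E}

/-- The hypothesis makes `(a x^j)^e` have the value of `(c x^e)^j`, a unit, so `a x^j` is a unit
too. This is the ramification condition needed for irreducibility of `s^e - α⁻¹c`. -/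
theorem expo_dvd_of_valuation_pow_eq (hw : w ∈ OmegaS v f x S) (hS : 2 ≤ S.card) (hx : x ≠ 0)
    (hc : c ∈ Scale v f x S) (a : E) (j : ℕ)
    (h : v.valuation a ^ expo v f x S = v.valuation c ^ j) : expo v f x S ∣ j := by
  refine expo_dvd hw hS hx (a := a) ?_
  have hv := OmegaS.extends hw
  rw [← map_pow, ← map_pow, ← hv.valuation_eq_iff, map_pow (algebraMap E F), map_pow (algebraMap E F)] at h
  have h1 : w.valuation (algebraMap E F a * x ^ j) ^ expo v f x S = 1 := by
    rw [← map_pow, mul_pow, map_mul, h, ← pow_mul, mul_comm j, pow_mul x, ← map_mul, ← mul_pow,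
      map_pow, hc.2 w hw, one_pow]
  exact (pow_eq_one_iff_of_nonneg zero_le (expo_spec hw hS hx).1.ne').1 h1

theorem transcendental_of_notMem_range (h : algebraicClosure E F = ⊥)
    (hx : x ∉ Set.range (algebraMap E F)) : Transcendental E x := by
  intro hxa
  have : x ∈ algebraicClosure E F := mem_algebraicClosure_iff.2 hxa
  rw [h, IntermediateField.mem_bot] at this
  exact hx this

theorem separable_of_natDegree_le {k : Type*} [Field k] {q : k[X]} (hq : Irreducible q) {n : ℕ}
    (hn : q.natDegree ≤ n) (hchar : ∀ m, 0 < m → m ≤ n → (m : k) ≠ 0) : q.Separable := by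
  rw [separable_iff_derivative_ne_zero hq]
  intro h0
  have hpos := hq.natDegree_pos
  have h1 := congrArg (fun p => p.coeff (q.natDegree - 1)) h0
  simp only [coeff_derivative, coeff_zero] at h1
  rw [Nat.sub_add_cancel hpos, coeff_natDegree] at h1
  refine mul_ne_zero (leadingCoeff_ne_zero.2 hq.ne_zero) (hchar _ hpos hn) ?_
  rw [← h1]
  norm_cast
  rw [Nat.sub_add_cancel hpos]

variable {FQ F' : Type*} [Field FQ] [Field F'] [Algebra F FQ]
  [Algebra E FQ] [IsScalarTower E F FQ] [Algebra FQ F'] [Algebra F F'] [IsScalarTower F FQ F']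
  [Algebra E F'] [IsScalarTower E F F'] {Q : v[X]} {α : FQ} {l : F'}

/-- The characteristic enters through two bounds: `e` divides `gap S`, which is at most `deg f`, and
`deg q` is at most `deg f`. Hence `e` is nonzero in `Ev` and `q` is separable. -/
theorem isLiftTower_of_mem_omegaS (hE : algebraicClosure E F = ⊥)
    (hx : x ∉ Set.range (algebraMap E F))
    (hchar : ringChar (Res v) = 0 ∨ f.natDegree < ringChar (Res v)) (hw : w ∈ OmegaS v f x S)
    (hS : 2 ≤ S.card) (hc : c ∈ Scale v f x S) (hQ : Q.Monic)
    (hirr : Irreducible (Q.map (IsLocalRing.residue v)))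
    (hdvd : Q.map (IsLocalRing.residue v) ∣ resPoly v f x S c)
    (hα : aeval α (Q.map (algebraMap v E)) = 0)
    (hFQ : IntermediateField.adjoin F {α} = ⊤)
    (hl : l ^ expo v f x S = algebraMap FQ F' α⁻¹ * algebraMap E F' c)
    (hF' : IntermediateField.adjoin FQ {l} = ⊤) :
    IsLiftTower v x c (expo v f x S) Q α l ∧ IsIntegral E l := by
  have hx0 : x ≠ 0 := by rintro rfl; exact hx ⟨0, map_zero _⟩
  have he := (expo_spec hw hS hx0).1
  have hgap := gap_pos hS
  have hegap := Nat.le_of_dvd hgap (expo_dvd_gap hw hS hx0)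
  have hgapn := OmegaS.gap_le hw hS
  have hres0 := resPoly_coeff_zero (c := c) hw hS hx0
  have hne : resPoly v f x S c ≠ 0 := by
    intro h0
    rw [h0, coeff_zero] at hres0
    exact zero_ne_one hres0
  have h0 : (Q.map (IsLocalRing.residue v)).coeff 0 ≠ 0 := by
    intro h0
    obtain ⟨s, hs⟩ := hdvd
    rw [hs, mul_coeff_zero, h0, zero_mul] at hres0
    exact zero_ne_one hres0
  have hdeg := (natDegree_le_of_dvd hdvd hne).trans
    (natDegree_resPoly_le v f x S c fun i hi => OmegaS.le_natDegree hw hi)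
  obtain ⟨h1, h2, h3⟩ := irreducible_of_tower hE hQ hirr h0 hα hFQ he hc.1 hl hF'
    (expo_dvd_of_valuation_pow_eq hw hS hx0 hc)
  exact ⟨{ x_ne_zero := hx0
           c_ne_zero := hc.1
           e_pos := he
           e_res_ne_zero := natCast_res_ne_zero hchar he (hegap.trans hgapn)
           monic := hQ
           separable := separable_of_natDegree_le hirr hdeg fun m hm hmn =>
            natCast_res_ne_zero hchar hm hmn
           coeff_zero_ne_zero := h0
           root := hα
           irreducible := h1
           irreducible_pow := h2
           adjoin_root := hFQ
           pow_eq := hl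
           adjoin_eq_top := hF' }, h3⟩

theorem finiteDimensional_baseExt (hE'α : IsIntegral E (algebraMap FQ F' α)) (hl : IsIntegral E l) :
    FiniteDimensional E (baseExt E (algebraMap FQ F' α) l) := by
  refine IntermediateField.finiteDimensional_adjoin fun y hy => ?_
  rcases hy with rfl | rfl
  exacts [hE'α, hl]

theorem mem_of_adjoin_eq_top {y : F'} (htop : IntermediateField.adjoin F {y} = ⊤)
    (M : Subfield F') (hF : ∀ a, algebraMap F F' a ∈ M) (hy : y ∈ M) (a : F') : a ∈ M := by
  have h1 : IntermediateField.adjoin F {y} ≤ M.toIntermediateField hF :=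
    IntermediateField.adjoin_le_iff.2 (Set.singleton_subset_iff.2 hy)
  exact h1 (htop ▸ IntermediateField.mem_top)

theorem aeval_shiftPoly {E' : IntermediateField E F'} {l' : E'} (hl : (l' : F') = l)
    (hl0 : l ≠ 0) (f : E[X]) (x : F) :
    aeval (l * algebraMap F F' x - 1) (shiftPoly f l') = algebraMap F F' (aeval x f) := by
  rw [shiftPoly, aeval_comp, aeval_map_algebraMap, map_mul, aeval_C, map_add, aeval_X, map_one,
    sub_add_cancel, map_inv₀, show algebraMap E' F' l' = l from hl, ← mul_assoc,
    inv_mul_cancel₀ hl0, one_mul, aeval_algebraMap_apply]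

/-- As `g(x₁) = f(x)`, the same square root serves; `x` is recovered from `x₁` and `l`, and `l`
generates `F'` over `F`. -/
theorem IsQuadraticOver.shift {E' : IntermediateField E F'} {l' : E'} (hl : (l' : F') = l)
    (hl0 : l ≠ 0) (htop : IntermediateField.adjoin F {l} = ⊤) (h : IsQuadraticOver f x) :
    IsQuadraticOver (shiftPoly f l') (l * algebraMap F F' x - 1) := by
  obtain ⟨y, hy, hxy⟩ := h
  refine ⟨algebraMap F F' y, by rw [aeval_shiftPoly hl hl0, ← hy, map_pow], ?_⟩
  set M := IntermediateField.adjoin E' {l * algebraMap F F' x - 1, algebraMap F F' y} with hM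
  have hlM : l ∈ M := hl ▸ IntermediateField.algebraMap_mem M l'
  have hxM : algebraMap F F' x ∈ M := by
    have h1 : l * algebraMap F F' x - 1 ∈ M := IntermediateField.subset_adjoin _ _ (by simp)
    have h2 : algebraMap F F' x = (l * algebraMap F F' x - 1 + 1) * l⁻¹ := by
      rw [sub_add_cancel]
      field_simp
    rw [h2]
    exact mul_mem (add_mem h1 (one_mem _)) (inv_mem hlM)
  have hyM : algebraMap F F' y ∈ M := IntermediateField.subset_adjoin _ _ (by simp)
  have hFM : IntermediateField.adjoin E {x, y} ≤
      (M.restrictScalars E).comap (IsScalarTower.toAlgHom E F F') := by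
    refine IntermediateField.adjoin_le_iff.2 ?_
    rintro _ (rfl | rfl)
    exacts [hxM, hyM]
  refine eq_top_iff.2 fun a _ => mem_of_adjoin_eq_top htop M.toSubfield (fun b => ?_) hlM a
  have hb : b ∈ IntermediateField.adjoin E {x, y} := hxy ▸ IntermediateField.mem_top
  exact hFM hb

end Setup

/-! ### The root of multiplicity `r` and the bound on minimal terms -/

section Reduction

variable {E F FQ F' : Type*} [Field E] [Field F] [Field FQ] [Field F'] [Algebra E F] [Algebra F FQ]
  [Algebra E FQ] [IsScalarTower E F FQ] [Algebra FQ F'] [Algebra F F'] [IsScalarTower F FQ F']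
  [Algebra E F'] [IsScalarTower E F F']
  {v : ValuationSubring E} {Q : v[X]} {α : FQ} {l : F'} {c : E} {f : E[X]} {x : F} {S : Finset ℕ}
  {w : ValuationSubring F} {W : ValuationSubring F'} {r : ℕ}

theorem map_shiftPoly {E' : IntermediateField E F'} {l' : E'} (hl : (l' : F') = l) (f : E[X]) :
    (shiftPoly f l').map (algebraMap E' F') = shiftPoly f l := by
  rw [shiftPoly, shiftPoly, Polynomial.map_comp, Polynomial.map_map, Polynomial.map_mul, map_C,
    Polynomial.map_add, map_X, Polynomial.map_one, map_inv₀, ← IsScalarTower.algebraMap_eq,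
    show algebraMap E' F' l' = l from hl]

theorem natDegree_shiftPoly {K : Type*} [Field K] [Algebra E K] (f : E[X]) {l : K} (hl : l ≠ 0) :
    (shiftPoly f l).natDegree = f.natDegree := by
  rw [shiftPoly, natDegree_comp, natDegree_map, natDegree_C_mul (inv_ne_zero hl),
    ← C_1, natDegree_X_add_C, mul_one]

namespace IsLiftTower

/-- The residue of `α` is that of `c x^e`, a root of `q` and so a root of multiplicity `r` of the
residue polynomial. Substituting `ᾱ X^e` moves this root to `1` with the same multiplicity. -/
theorem exists_scaled_polynomial (T : IsLiftTower v x c (expo v f x S) Q α l)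
    (hirr : Irreducible (Q.map (IsLocalRing.residue v)))
    (hw : w ∈ OmegaSq v f x S c (Q.map (IsLocalRing.residue v))) (hS : 2 ≤ S.card)
    (hc : c ∈ Scale v f x S) (hr : Q.map (IsLocalRing.residue v) ^ r ∣ resPoly v f x S c)
    (hr' : ¬ Q.map (IsLocalRing.residue v) ^ (r + 1) ∣ resPoly v f x S c) (hW : Extends w W)
    (h1 : W.valuation (l * algebraMap F F' x) = 1) (h2 : res W (l * algebraMap F F' x) = 1) :
    ∃ (p : W[X]) (h : (Res W)[X]), p.map (algebraMap W F') =
        C ((algebraMap E F' (f.coeff (first S)))⁻¹ * l ^ first S) * scalePoly f l ∧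
      p.map (IsLocalRing.residue W) = (X - C 1) ^ r * h ∧ h.eval 1 ≠ 0 := by
  obtain ⟨hwS, hvw, hroot⟩ := hw
  have hvW : Extends v W := hvw.trans hW
  have hz := hc.2 w hwS
  obtain ⟨hres, hα, -⟩ := T.comap_root hz hW h1 h2
  have hC := Extends.comap_self (L := FQ) W
  have hα' : W.valuation (algebraMap FQ F' α) = 1 := hC.valuation_eq_one_iff.2 hα
  obtain ⟨p, hp, hpres⟩ := ResidueReduction.exists_scaled_polynomial hwS hS T.x_ne_zero hc hvW hW h1
    hα' (by rw [T.pow_eq, map_inv₀])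
  have hz' : W.valuation (algebraMap F F' (algebraMap E F c * x ^ expo v f x S)) = 1 :=
    hW.valuation_eq_one_iff.2 hz
  have hroot' : (Q.map (IsLocalRing.residue v)).eval₂ (resMap hvW)
      (res W (algebraMap FQ F' α)) = 0 := by
    have h3 : res W (algebraMap FQ F' α) =
        resMap hW (res w (algebraMap E F c * x ^ expo v f x S)) := by
      rw [hW.resMap_res (mem_of_valuation_eq_one hz), ← hC.resMap_res (mem_of_valuation_eq_one hα),
        hres, hC.resMap_res, ← IsScalarTower.algebraMap_apply F FQ F']
      rw [← hC.mem_iff, ← IsScalarTower.algebraMap_apply F FQ F']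
      exact mem_of_valuation_eq_one hz'
    have h4 : resMap hvW = (resMap hW).comp (resMap hvw) :=
      RingHom.ext fun a => hvw.resMap_trans hW hvW a
    rw [h3, h4, ← hom_eval₂, hroot, map_zero]
  obtain ⟨h, hh, hh0⟩ := exists_eq_pow_mul_of_separable (resMap hvW) hirr T.separable hr hr' hroot'
  obtain ⟨h', hh', hh0'⟩ := exists_comp_eq_pow_mul (res_ne_zero_iff.2 hα') (e := expo v f x S)
    (by rw [← map_natCast (resMap hvW)]; exact (_root_.map_ne_zero _).2 T.e_res_ne_zero) hh hh0
    (first S)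
  exact ⟨p, h', hp, hpres.trans hh', hh0'⟩

end IsLiftTower

/-- The shift `X ↦ X + 1` moves the root `1` of multiplicity `r` to `0`. -/
theorem le_of_mem_supp_shiftPoly {E' : IntermediateField E F'} {l' : E'} (hl : (l' : F') = l)
    {a : F'} (ha : a ≠ 0) {p : W[X]} {h : (Res W)[X]}
    (hp : p.map (algebraMap W F') = C a * scalePoly f l)
    (hpr : p.map (IsLocalRing.residue W) = (X - C 1) ^ r * h) (hh : h.eval 1 ≠ 0) {y : F'}
    (hy0 : y - 1 ≠ 0) (hy : W.valuation (y - 1) < 1) {i : ℕ}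
    (hi : i ∈ supp (shiftPoly f l') (y - 1) W) : i ≤ r := by
  refine le_of_mem_supp (p := p.comp (X + 1)) (h := h.comp (X + 1)) ha ?_ ?_ ?_ hy0 hy hi
  · rw [Polynomial.map_comp, hp, map_shiftPoly hl, shiftPoly_eq_comp]
    simp
  · rw [Polynomial.map_comp, hpr]
    simp
  · simpa using hh

end Reduction

/-! ### Nonruled residue fields require two minimal terms -/

section Covering

variable {E F' : Type*} [Field E] [Field F'] [Algebra E F'] {v : ValuationSubring E}
  {W : ValuationSubring F'}

/-- A single minimal term would make the residue field ruled. Degree one is treated apart, as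
residue characteristic `2` is not excluded there and the square root argument is not available. -/
theorem two_le_card_supp_of_mem_omegaStar (htr : Algebra.trdeg E F' = 1)
    {E' : IntermediateField E F'} [FiniteDimensional E E'] {g : E'[X]} {x₁ : F'}
    (hx₁ : x₁ ≠ 0) (hq : IsQuadraticOver g x₁) (hg : 0 < g.natDegree)
    (h2 : 2 ≤ g.natDegree → (2 : Res v) ≠ 0) (hW : W ∈ OmegaStar v F') :
    2 ≤ (supp g x₁ W).card := by
  obtain ⟨y, hy, htop⟩ := hq
  obtain ⟨⟨hvW, htrans⟩, _, hnr⟩ := hW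
  by_contra hcard
  refine hnr ?_
  by_cases hg1 : g.natDegree = 1
  · obtain ⟨V, hWV⟩ := exists_extends F' (AlgebraicClosure F') W
    exact isRuled_of_natDegree_eq_one hvW hWV (trdeg_eq_one_of_isAlgebraic htr) hy htop hg1 htrans
  · have h1 := Finset.card_pos.2 (supp_nonempty g x₁ W)
    obtain ⟨j, hj⟩ := Finset.card_eq_one.1 (show (supp g x₁ W).card = 1 by omega)
    exact isRuled_of_supp_eq_singleton hvW htr hx₁ hy htop (by rintro rfl; simp at hg)
      (h2 (by omega)) hj htrans

end Covering

end ResidueReduction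

end

/-! ### The reduction theorem -/

theorem mainTheorem4
    {E F : Type*} [Field E] [Field F] [Algebra E F]
    (hF : ResidueReduction.IsRegularFunctionField E F)
    (v : ValuationSubring E)
    (f : Polynomial E) (x : F) (hx : x ∉ Set.range (algebraMap E F))
    (hchar : ringChar (ResidueReduction.Res v) = 0 ∨
      f.natDegree < ringChar (ResidueReduction.Res v))
    (S : Finset ℕ) (hS : S ∈ ResidueReduction.Supports v f x)
    (e : ℕ) (he : e = ResidueReduction.expo v f x S)
    (c : E) (hc : c ∈ ResidueReduction.Scale v f x S)
    (q : Polynomial (ResidueReduction.Res v)) (hq_monic : q.Monic) (hq_irr : Irreducible q)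
    (hq_dvd : q ∣ ResidueReduction.resPoly v f x S c)
    (r : ℕ) (hr : q ^ r ∣ ResidueReduction.resPoly v f x S c)
    (hr_max : ¬ q ^ (r + 1) ∣ ResidueReduction.resPoly v f x S c)
    -- a monic lift `Q` of `q`, and `FQ = F[t]/(Q) = F(α)` with `α` the class of `t`
    (Q : Polynomial v) (hQ_monic : Q.Monic) (hQ : Q.map (IsLocalRing.residue v) = q)
    {FQ : Type*} [Field FQ] [Algebra F FQ] [Algebra E FQ] [IsScalarTower E F FQ]
    (α : FQ) (hα : Polynomial.aeval α (Q.map (algebraMap v E)) = 0)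
    (hFQ : IntermediateField.adjoin F {α} = ⊤)
    -- `F' = FQ(l)` with `l ^ e = α⁻¹ c`
    {F' : Type*} [Field F'] [Algebra FQ F'] [Algebra F F'] [IsScalarTower F FQ F']
    [Algebra E F'] [IsScalarTower E F F']
    (l : F') (hl : l ^ e = algebraMap FQ F' α⁻¹ * algebraMap E F' c)
    (hF' : IntermediateField.adjoin FQ {l} = ⊤)
    -- the base extension `E' = E[α][l]`, the polynomial `g = f(l⁻¹ (t + 1))` and `x₁ = l x - 1`
    (E' : IntermediateField E F')
    (hE' : E' = ResidueReduction.baseExt E (algebraMap FQ F' α) l)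
    (l' : E') (hl' : (l' : F') = l)
    (g : Polynomial E') (hg : g = ResidueReduction.shiftPoly f l')
    (x₁ : F') (hx₁ : x₁ = l * algebraMap F F' x - 1) :
    -- the root fields, and the presentation of `F'`
    Irreducible (Q.map ((algebraMap E F).comp (algebraMap v E))) ∧
    Irreducible (Polynomial.X ^ e - Polynomial.C (α⁻¹ * algebraMap E FQ c)) ∧
    FiniteDimensional E E' ∧
    IntermediateField.adjoin F (E' : Set F') = ⊤ ∧
    (ResidueReduction.IsQuadraticOver f x → ResidueReduction.IsQuadraticOver g x₁) ∧
    -- the extensions of the valuations `w ∈ Ω_{S,f,x,q}`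
    (∀ w ∈ ResidueReduction.OmegaSq v f x S c q,
      -- the unique extension to `FQ`, which has the same value group as `w`
      (∃! wQ : ValuationSubring FQ, ResidueReduction.Extends w wQ ∧ wQ.valuation α = 1 ∧
        ResidueReduction.res wQ α =
          ResidueReduction.res wQ (algebraMap F FQ (algebraMap E F c * x ^ e))) ∧
      (∀ wQ : ValuationSubring FQ, ResidueReduction.Extends w wQ → wQ.valuation α = 1 →
        ResidueReduction.res wQ α =
          ResidueReduction.res wQ (algebraMap F FQ (algebraMap E F c * x ^ e)) →
        ∀ y : FQ, ∃ z : F, wQ.valuation y = wQ.valuation (algebraMap F FQ z)) ∧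
      -- the unique extension to `F'`
      (∃! w' : ValuationSubring F', ResidueReduction.Extends w w' ∧
        w'.valuation (l * algebraMap F F' x) = 1 ∧
        ResidueReduction.res w' (l * algebraMap F F' x) = 1) ∧
      (∀ (w' : ValuationSubring F') (hw' : ResidueReduction.Extends w w'),
        w'.valuation (l * algebraMap F F' x) = 1 →
        ResidueReduction.res w' (l * algebraMap F F' x) = 1 →
        -- `F'w' = Fw`
        Function.Surjective (ResidueReduction.resMap hw') ∧
        -- `a_{i₀}⁻¹ l ^ i₀ f(l⁻¹ t)` is primitive over the valuation ring of `w'`, and the residue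
        -- of `l x` is a root of multiplicity `r` of its residue polynomial
        (∃ p : Polynomial w',
          p.map (algebraMap w' F') =
            Polynomial.C ((algebraMap E F' (f.coeff (ResidueReduction.first S)))⁻¹ *
              l ^ ResidueReduction.first S) * ResidueReduction.scalePoly f l ∧
          p.map (IsLocalRing.residue w') ≠ 0 ∧
          (p.map (IsLocalRing.residue w')).rootMultiplicity
            (ResidueReduction.res w' (l * algebraMap F F' x)) = r) ∧
        -- `max S_{g,x₁}(w') ≤ r`
        (∀ i ∈ ResidueReduction.supp g x₁ w', i ≤ r) ∧
        -- the dichotomy for `S₁ = S_{g,x₁}(w')`, over `E'` with the valuation `w'|_{E'}`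
        (2 ≤ (ResidueReduction.supp g x₁ w').card →
          ∀ c₁ ∈ ResidueReduction.Scale (w'.comap (algebraMap E' F')) g x₁
              (ResidueReduction.supp g x₁ w'),
            (∀ m ∈ ResidueReduction.Mult (ResidueReduction.resPoly
                (w'.comap (algebraMap E' F')) g x₁ (ResidueReduction.supp g x₁ w') c₁), m < r) ∨
            ResidueReduction.IsPurelyInsepPoly (ResidueReduction.resPoly
                (w'.comap (algebraMap E' F')) g x₁ (ResidueReduction.supp g x₁ w') c₁) r))) ∧
    -- restriction is a bijection from `Ω ∩ Ω*_v(F')` onto `Ω_{S,f,x,q} ∩ Ω*_v(F)`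
    Set.BijOn (fun w' : ValuationSubring F' => w'.comap (algebraMap F F'))
      (ResidueReduction.OmegaLift v f x S c q l ∩ ResidueReduction.OmegaStar v F')
      (ResidueReduction.OmegaSq v f x S c q ∩ ResidueReduction.OmegaStar v F) ∧
    -- if `F = E(x)[√f(x)]`, then `Ω ∩ Ω*_v(F')` is covered by the sets `Ω_{S₁,g,x₁}`
    (ResidueReduction.IsQuadraticOver f x →
      ResidueReduction.OmegaLift v f x S c q l ∩ ResidueReduction.OmegaStar v F' ⊆
        ⋃ S₁ ∈ {S₁ : Finset ℕ | S₁ ∈ ResidueReduction.Supports v g x₁ ∧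
            S₁ ⊆ Finset.range (r + 1)},
          ResidueReduction.OmegaS v g x₁ S₁) := by
  obtain ⟨hSsub, hScard, w₀, hw₀⟩ := hS
  obtain ⟨hFG, htr, hE⟩ := hF
  subst he hQ hE' hg hx₁
  obtain ⟨T, hlint⟩ := ResidueReduction.isLiftTower_of_mem_omegaS hE hx hchar hw₀ hScard hc hQ_monic
    hq_irr hq_dvd hα hFQ hl hF'
  have : IsScalarTower E FQ F' := ResidueReduction.isScalarTower_of_tower E F FQ F'
  have hlF := ResidueReduction.adjoin_root_eq_top hFQ hF' T.c_ne_zero hl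
  have hlmem : l ∈ ResidueReduction.baseExt E (algebraMap FQ F' α) l :=
    IntermediateField.subset_adjoin _ _ (by simp)
  have hα0 : algebraMap FQ F' α ≠ 0 := by simpa using T.root_ne_zero
  have hc0 : algebraMap E F' c ≠ 0 := by simpa using T.c_ne_zero
  have hl0 : l ≠ 0 := by
    rintro rfl
    rw [zero_pow T.e_pos.ne', map_inv₀] at hl
    exact mul_ne_zero (inv_ne_zero hα0) hc0 hl.symm
  have hl0' : l' ≠ 0 := by
    rintro rfl
    exact hl0 hl'.symm
  have hαint : IsIntegral E (algebraMap FQ F' α) := by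
    refine IsIntegral.algebraMap (IsIntegral.tower_top (R := v) ⟨Q, hQ_monic, ?_⟩)
    rw [← Polynomial.aeval_def, ← Polynomial.aeval_map_algebraMap E, hα]
  have hfin := ResidueReduction.finiteDimensional_baseExt hαint hlint
  have hxt := ResidueReduction.transcendental_of_notMem_range hE hx
  -- Otherwise `x = l⁻¹` would be algebraic over `E`.
  have hy0 : l * algebraMap F F' x - 1 ≠ 0 := by
    intro h0
    have h1 : algebraMap F F' x = l⁻¹ := eq_inv_of_mul_eq_one_right (sub_eq_zero.1 h0)
    have h2 : IsAlgebraic E (algebraMap F F' x) := h1 ▸ hlint.inv.isAlgebraic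
    exact hxt ((isAlgebraic_algebraMap_iff (algebraMap F F').injective).1 h2)
  have hr0 : 0 < r := by
    refine Nat.pos_of_ne_zero fun h0 => hr_max ?_
    rwa [h0, zero_add, pow_one]
  have hlt : ∀ W : ValuationSubring F', W.valuation (l * algebraMap F F' x) = 1 →
      ResidueReduction.res W (l * algebraMap F F' x) = 1 →
      W.valuation (l * algebraMap F F' x - 1) < 1 := fun W h1 h2 =>
    (ResidueReduction.res_eq_one_iff (ResidueReduction.mem_of_valuation_eq_one h1)).1 h2
  have ha : (algebraMap E F' (f.coeff (ResidueReduction.first S)))⁻¹ *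
      l ^ ResidueReduction.first S ≠ 0 := by
    refine mul_ne_zero (inv_ne_zero ?_) (pow_ne_zero _ hl0)
    simpa using ResidueReduction.OmegaS.coeff_ne_zero hw₀ hScard T.x_ne_zero
      (ResidueReduction.first_mem (Finset.card_pos.1 (by omega)))
  have hsupp : ∀ w ∈ ResidueReduction.OmegaSq v f x S c (Q.map (IsLocalRing.residue v)),
      ∀ W : ValuationSubring F', ResidueReduction.Extends w W →
      W.valuation (l * algebraMap F F' x) = 1 →
      ResidueReduction.res W (l * algebraMap F F' x) = 1 →
      ∀ i ∈ ResidueReduction.supp (ResidueReduction.shiftPoly f l') (l * algebraMap F F' x - 1) W,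
        i ≤ r := by
    intro w hw W hW h1 h2 i hi
    obtain ⟨p, h, hp, hpr, hh⟩ := T.exists_scaled_polynomial hq_irr hw hScard hc hr hr_max hW h1 h2
    exact ResidueReduction.le_of_mem_supp_shiftPoly hl' ha hp hpr hh hy0 (hlt W h1 h2) hi
  refine ⟨T.irreducible, T.irreducible_pow, hfin, ?_, fun h => h.shift hl' hl0 hlF, ?_, ?_, ?_⟩
  · rw [eq_top_iff, ← hlF]
    exact IntermediateField.adjoin.mono _ _ _ (Set.singleton_subset_iff.2 hlmem)
  · intro w hw
    obtain ⟨hwS, hvw, hroot⟩ := id hw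
    have hz := hc.2 w hwS
    refine ⟨T.existsUnique_extends_root hvw hz hroot, fun W hW hαW hres y => ?_,
      T.existsUnique_extends hvw hz hroot, fun W hW h1 h2 => ?_⟩
    · exact (T.root_generator hvw hz hroot).exists_valuation_eq hW
        (ResidueReduction.mem_of_valuation_eq_one hαW) hres y
    · obtain ⟨p, h, hp, hpr, hh⟩ :=
        T.exists_scaled_polynomial hq_irr hw hScard hc hr hr_max hW h1 h2
      obtain ⟨hp0, hmult⟩ := ResidueReduction.rootMultiplicity_eq_of_eq_pow_mul hpr hh
      refine ⟨T.resMap_surjective hvw hz hroot hW h1 h2, ⟨p, hp, hp0, by rw [h2]; exact hmult⟩,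
        hsupp w hw W hW h1 h2, fun _ c₁ _ => ?_⟩
      -- All indices of `S₁` are at most `r`, and so is the degree of its residue polynomial.
      exact ResidueReduction.mult_lt_or_isPurelyInsepPoly hr0
        (ResidueReduction.natDegree_resPoly_le _ _ _ _ _ (hsupp w hw W hW h1 h2))
  · refine ⟨?_, ?_, ?_⟩
    · rintro W ⟨⟨hWO, hw, h1, h2⟩, hWs⟩
      have hW : ResidueReduction.Extends (W.comap (algebraMap F F')) W := rfl
      obtain ⟨hwS, hvw, hroot⟩ := id hw
      exact ⟨hw, (ResidueReduction.mem_omega_iff_of_surjective hW hvw (hvw.trans hW)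
        (T.resMap_surjective hvw (hc.2 _ hwS) hroot hW h1 h2)).2.2 hWs⟩
    -- Injectivity is the uniqueness of the extension with `λX` of residue `1`.
    · rintro W ⟨⟨-, hw, h1, h2⟩, -⟩ W' ⟨⟨-, -, h1', h2'⟩, -⟩ heq
      obtain ⟨hwS, hvw, hroot⟩ := hw
      exact (T.existsUnique_extends hvw (hc.2 _ hwS) hroot).unique ⟨rfl, h1, h2⟩
        ⟨heq.symm, h1', h2'⟩
    · rintro w ⟨hw, hws⟩
      obtain ⟨hwS, hvw, hroot⟩ := id hw
      obtain ⟨W, ⟨hW, h1, h2⟩, -⟩ := T.existsUnique_extends hvw (hc.2 _ hwS) hroot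
      have hiff := ResidueReduction.mem_omega_iff_of_surjective hW hvw (hvw.trans hW)
        (T.resMap_surjective hvw (hc.2 _ hwS) hroot hW h1 h2)
      have hWw : W.comap (algebraMap F F') = w := hW
      exact ⟨W, ⟨⟨hiff.1.1 hwS.1, hWw.symm ▸ hw, h1, h2⟩, hiff.2.1 hws⟩, hW⟩
  · rintro hquad W ⟨⟨hWO, hw, h1, h2⟩, hWs⟩
    have hle := hsupp _ hw W rfl h1 h2
    have hdeg := ResidueReduction.natDegree_shiftPoly f hl0'
    -- Algebraicity of `F'/F` keeps the transcendence degree over `E` equal to one.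
    have hlint' : Algebra.IsAlgebraic F F' := by
      have : FiniteDimensional F (IntermediateField.adjoin F {l}) :=
        IntermediateField.adjoin.finiteDimensional hlint.tower_top
      rw [hlF] at this
      have : FiniteDimensional F F' :=
        (IntermediateField.topEquiv (F := F) (E := F')).toLinearEquiv.finiteDimensional
      infer_instance
    have hcard := ResidueReduction.two_le_card_supp_of_mem_omegaStar
      (ResidueReduction.trdeg_eq_one_of_isAlgebraic (F := F) htr) hy0 (hquad.shift hl' hl0 hlF)
      (by rw [hdeg]; exact ResidueReduction.OmegaS.natDegree_pos hw₀ hScard)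
      (fun h => by
        rw [hdeg] at h
        exact_mod_cast ResidueReduction.natCast_res_ne_zero hchar two_pos h) hWs
    have hmem : W ∈ ResidueReduction.OmegaS v (ResidueReduction.shiftPoly f l')
      (l * algebraMap F F' x - 1) (ResidueReduction.supp (ResidueReduction.shiftPoly f l')
      (l * algebraMap F F' x - 1) W) := ⟨hWO, rfl⟩
    refine Set.mem_iUnion₂.2 ⟨_, ⟨⟨fun i hi => ?_, hcard, W, hmem⟩, fun i hi => ?_⟩, hmem⟩
    · exact Finset.mem_range_succ_iff.2 (ResidueReduction.mem_supp_iff.1 hi).1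
    · exact Finset.mem_range_succ_iff.2 (hle i hi)
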